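/- Let $k$ be an algebraically closed field of characteristic $0$ and let $(H,R)$ be a finite-dimensional quasi-triangular Hopf algebra over $k$, $R=R^1\otimes R^2$, with $(\Delta\otimes\mathrm{id})R=R_{13}R_{23}$, $(\mathrm{id}\otimes\Delta)R=R_{13}R_{12}$, $R\,\Delta(h)=\Delta^{\mathrm{op}}(h)R$. All modules are finite-dimensional; $\mathrm{Rep}(H)$ is the tensor category of left $H$-modules, braided by $c_{X,Y}(x\otimes y)=R^2y\otimes R^1x$. Let $K$ and $S$ be finite-dimensional left $H$-comodule algebras that are right $H$-simple, i.e. whose only right ideals stable under the coaction are $0$ and the whole algebra. The category ${}_S\mathcal M$ of left $S$-modules is a $\mathrm{Rep}(H)$-module category by $X\odot N=X\otimes_k N$, with $S$ acting through its coaction $S\to H\otimes_k S$; similarly ${}_K\mathcal M$. Let ${}^H_K\mathcal M_S$ be the category of finite-dimensional $(K,S)$-bimodules $P$ with a left $H$-coaction satisfying $\delta(a\cdot p\cdot s)=a_{-1}p_{-1}s_{-1}\otimes a_0\cdot p_0\cdot s_0$. It is a left $\mathrm{Rep}(H)$-module category by $X\odot P=P\otimes_S(X\otimes_kS)$, with $S$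 acting on the right by multiplication on the factor $S$, $K$ acting on $P$, coaction $$\delta(p\otimes x\otimes s)=p_{-1}R^2s_{-1}\otimes(p_0\otimes R^1x\otimes s_0),$$ and associativity $(X\otimes Y)\odot P\to X\odot(Y\odot P)$, $p\otimes(x\otimes y)\otimes s\mapsto(p\otimes R^{-1}y\otimes1)\otimes R^{-2}x\otimes s$, where $R^{-1}\otimes R^{-2}$ denotes the inverse of $R$. Let $\mathrm{Fun}_{\mathrm{Rep}(H)}({}_S\mathcal M,{}_K\mathcal M)$ be the category of $k$-linear $\mathrm{Rep}(H)$-module functors and module natural transformations. It is a left $\mathrm{Rep}(H)$-module category by $(X\odot F)(N)=F(X\odot N)$: the module structure of $X\odot F$ is $F(X\odot(A\odot N))\to F(A\odot(X\odot N))\to A\odot F(X\odot N)$, whose first map comes from $c_{X,A}$ and whose second is the structure of $F$, and the associativity isomorphism $F((X\otimes Y)\odot N)\to F(Y\odot(X\odot N))$ comes from $c_{Y,X}^{-1}$. Then: 1. For every $P\in{}^H_K\mathcal M_S$ the functor $P\otimes_S-:{}_S\mathcal M\to{}_K\mathcal M$ is a module functor with structure isomorphisms $P\otimes_S(X\otimes_kN)\to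 X\otimes_k(P\otimes_SN)$, $p\otimes x\otimes n\mapsto p_{-1}x\otimes p_0\otimes n$. 2. The functor $\Phi:{}^H_K\mathcal M_S\to\mathrm{Fun}_{\mathrm{Rep}(H)}({}_S\mathcal M,{}_K\mathcal M)$, $\Phi(P)=P\otimes_S-$, with the structure isomorphisms $\Phi(X\odot P)\to X\odot\Phi(P)$ given by $(P\otimes_S(X\otimes_kS))\otimes_SN\to P\otimes_S(X\otimes_kN)$, $p\otimes x\otimes s\otimes n\mapsto p\otimes x\otimes s\cdot n$, is a module functor and an equivalence of left $\mathrm{Rep}(H)$-module categories: it has a quasi-inverse which is a module functor, the unit and counit being isomorphisms of module functors. -/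

import Mathlib

open CategoryTheory MonoidalCategory MonoidalLeftAction
open scoped TensorProduct

universe u

set_option linter.unusedSectionVars false
set_option linter.unusedSimpArgs false
set_option linter.unusedVariables false

namespace ModCat

section General

universe w v₁ v₂ v₃ u₁ u₂ u₃

variable {C : Type u₁} [Category.{v₁} C] [MonoidalCategory C] [BraidedCategory C]
  {D : Type u₂} [Category.{v₂} D] [MonoidalLeftAction C D]

/-- The isomorphism `X ⊙ (A ⊙ d) ≅ A ⊙ (X ⊙ d)` given by the braiding `X ⊗ A ⟶ A ⊗ X`. -/
def swapIso (X A : C) (d : D) : X ⊙ₗ A ⊙ₗ d ≅ A ⊙ₗ X ⊙ₗ d where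
  hom := (αₗ X A d).inv ≫ (β_ X A).hom ⊵ₗ d ≫ (αₗ A X d).hom
  inv := (αₗ A X d).inv ≫ (β_ X A).inv ⊵ₗ d ≫ (αₗ X A d).hom
  hom_inv_id := by simp
  inv_hom_id := by simp

/-- The isomorphism `(X ⊗ Y) ⊙ d ≅ Y ⊙ (X ⊙ d)` given by the inverse `X ⊗ Y ⟶ Y ⊗ X` of the
braiding `Y ⊗ X ⟶ X ⊗ Y`; it is the associativity isomorphism of the reverse (right) action
`d ◁ X = X ⊙ d` of a braided category. -/
def revAssoc (X Y : C) (d : D) : (X ⊗ Y) ⊙ₗ d ≅ Y ⊙ₗ X ⊙ₗ d where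
  hom := (β_ Y X).inv ⊵ₗ d ≫ (αₗ Y X d).hom
  inv := (αₗ Y X d).inv ≫ (β_ Y X).hom ⊵ₗ d
  hom_inv_id := by simp
  inv_hom_id := by simp

theorem actionHomRight_left {A B : C} (X : C) (f : A ⟶ B) (d : D) :
    X ⊴ₗ f ⊵ₗ d = (αₗ X A d).inv ≫ (X ◁ f) ⊵ₗ d ≫ (αₗ X B d).hom := by simp

theorem assocRight (X Y : C) {d d' : D} (f : d ⟶ d') :
    (αₗ X Y d).hom ≫ X ⊴ₗ Y ⊴ₗ f = (X ⊗ Y) ⊴ₗ f ≫ (αₗ X Y d').hom := by simp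

theorem swapIso_natural_left {X X' : C} (f : X ⟶ X') (A : C) (d : D) :
    f ⊵ₗ (A ⊙ₗ d) ≫ (swapIso X' A d).hom = (swapIso X A d).hom ≫ A ⊴ₗ f ⊵ₗ d := by
  simp only [swapIso, actionHomLeft_action, actionHomRight_left, Category.assoc,
    Iso.hom_inv_id_assoc, Iso.cancel_iso_inv_left]
  simp only [← comp_actionHomLeft_assoc, BraidedCategory.braiding_naturality_left]

theorem swapIso_natural_mid (X : C) {A A' : C} (f : A ⟶ A') (d : D) :
    X ⊴ₗ f ⊵ₗ d ≫ (swapIso X A' d).hom = (swapIso X A d).hom ≫ f ⊵ₗ (X ⊙ₗ d) := by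
  simp only [swapIso, actionHomLeft_action, actionHomRight_left, Category.assoc,
    Iso.hom_inv_id_assoc, Iso.cancel_iso_inv_left]
  simp only [← comp_actionHomLeft_assoc, BraidedCategory.braiding_naturality_right]

theorem swapIso_natural_right (X A : C) {d d' : D} (f : d ⟶ d') :
    X ⊴ₗ A ⊴ₗ f ≫ (swapIso X A d').hom = (swapIso X A d).hom ≫ A ⊴ₗ X ⊴ₗ f := by
  simp only [swapIso, Category.assoc, assocRight]
  rw [Iso.eq_inv_comp, ← Category.assoc, assocRight, Category.assoc, Iso.hom_inv_id_assoc,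
    action_exchange_assoc]

theorem associator_action (X Y Z : C) (d : D) :
    (α_ X Y Z).hom ⊵ₗ d = (αₗ (X ⊗ Y) Z d).hom ≫ (αₗ X Y (Z ⊙ₗ d)).hom ≫
      X ⊴ₗ (αₗ Y Z d).inv ≫ (αₗ X (Y ⊗ Z) d).inv := by
  have h := associator_actionHom X Y Z d
  rw [← reassoc_of% h]; simp

theorem associator_inv_action (X Y Z : C) (d : D) :
    (α_ X Y Z).inv ⊵ₗ d = (αₗ X (Y ⊗ Z) d).hom ≫ X ⊴ₗ (αₗ Y Z d).hom ≫
      (αₗ X Y (Z ⊙ₗ d)).inv ≫ (αₗ (X ⊗ Y) Z d).inv := by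
  rw [← cancel_epi ((α_ X Y Z).hom ⊵ₗ d), hom_inv_actionHomLeft, associator_action]; simp

theorem swapIso_tensor (X A B : C) (d : D) :
    (swapIso X (A ⊗ B) d).hom ≫ (αₗ A B (X ⊙ₗ d)).hom =
      X ⊴ₗ (αₗ A B d).hom ≫ (swapIso X A (B ⊙ₗ d)).hom ≫ A ⊴ₗ (swapIso X B d).hom := by
  simp only [swapIso, BraidedCategory.braiding_tensor_right_hom, comp_actionHomLeft,
    associator_action, associator_inv_action, whiskerLeft_actionHomLeft,
    whiskerRight_actionHomLeft, Category.assoc, actionHomRight_comp, Iso.inv_hom_id_assoc,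
    Iso.hom_inv_id_assoc, actionHomRight_hom_inv_assoc, actionHomRight_inv_hom_assoc,
    Iso.inv_hom_id, Category.comp_id]

theorem swapIso_revAssoc (X Y A : C) (d : D) :
    (revAssoc X Y (A ⊙ₗ d)).hom ≫ Y ⊴ₗ (swapIso X A d).hom ≫ (swapIso Y A (X ⊙ₗ d)).hom =
      (swapIso (X ⊗ Y) A d).hom ≫ A ⊴ₗ (revAssoc X Y d).hom := by
  have h : (swapIso (X ⊗ Y) A d).hom ≫ A ⊴ₗ (β_ Y X).inv ⊵ₗ d =
      (β_ Y X).inv ⊵ₗ (A ⊙ₗ d) ≫ (swapIso (Y ⊗ X) A d).hom :=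
    (swapIso_natural_left (β_ Y X).inv A d).symm
  simp only [revAssoc, actionHomRight_comp]
  rw [reassoc_of% h]
  simp only [swapIso, BraidedCategory.braiding_tensor_left_hom, comp_actionHomLeft,
    associator_action, associator_inv_action, whiskerLeft_actionHomLeft,
    whiskerRight_actionHomLeft, Category.assoc, actionHomRight_comp, Iso.inv_hom_id_assoc,
    Iso.hom_inv_id_assoc, actionHomRight_hom_inv_assoc, actionHomRight_inv_hom_assoc,
    Iso.inv_hom_id, Category.comp_id, actionHomRight_inv_hom]

theorem revAssoc_pentagon (X Y Z : C) (d : D) :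
    (α_ X Y Z).hom ⊵ₗ d ≫ (revAssoc X (Y ⊗ Z) d).hom ≫ (revAssoc Y Z (X ⊙ₗ d)).hom =
      (revAssoc (X ⊗ Y) Z d).hom ≫ Z ⊴ₗ (revAssoc X Y d).hom := by
  have h : (α_ X Y Z).hom ≫ (β_ (Y ⊗ Z) X).inv ≫ (β_ Z Y).inv ▷ X =
      (β_ Z (X ⊗ Y)).inv ≫ Z ◁ (β_ Y X).inv ≫ (α_ Z Y X).inv := by
    have h1 := congrArg Iso.inv (BraidedCategory.yang_baxter_iso Z Y X)
    simp at h1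
    simp [BraidedCategory.braiding_tensor_left_inv, BraidedCategory.braiding_tensor_right_inv]
    rw [← cancel_mono (α_ Z Y X).hom]
    simp [← h1]
  have h' := congrArg (· ⊵ₗ d) h
  simp only [comp_actionHomLeft, associator_inv_action, whiskerLeft_actionHomLeft,
    whiskerRight_actionHomLeft, Category.assoc, Iso.inv_hom_id_assoc] at h'
  simp only [revAssoc, actionHomRight_comp, Category.assoc]
  simp only [← Category.assoc, cancel_mono, Iso.cancel_iso_inv_right] at h' ⊢
  rw [h']; simp

theorem swapIso_unit_mid (X : C) (d : D) :
    (swapIso X (𝟙_ C) d).hom ≫ (λₗ (X ⊙ₗ d)).hom = X ⊴ₗ (λₗ d).hom := by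
  simp [swapIso, -actionHomLeft_action, ← leftUnitor_actionHom, ← comp_actionHomLeft]

theorem swapIso_unit_left (A : C) (d : D) :
    (swapIso (𝟙_ C) A d).hom ≫ A ⊴ₗ (λₗ d).hom = (λₗ (A ⊙ₗ d)).hom := by
  have := rightUnitor_actionHom A d
  simp [swapIso, -actionHomLeft_action, -rightUnitor_actionHom, ← this, ← comp_actionHomLeft]

theorem revAssoc_natural (X Y : C) {d d' : D} (f : d ⟶ d') :
    (X ⊗ Y) ⊴ₗ f ≫ (revAssoc X Y d').hom = (revAssoc X Y d).hom ≫ Y ⊴ₗ X ⊴ₗ f := by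
  simp only [revAssoc, Category.assoc, assocRight, action_exchange_assoc]

theorem revAssoc_natural_left {X X' : C} (f : X ⟶ X') (Y : C) (d : D) :
    (f ▷ Y) ⊵ₗ d ≫ (revAssoc X' Y d).hom = (revAssoc X Y d).hom ≫ Y ⊴ₗ f ⊵ₗ d := by
  simp only [revAssoc, actionHomRight_left, Category.assoc, Iso.hom_inv_id_assoc,
    ← comp_actionHomLeft_assoc, BraidedCategory.braiding_inv_naturality_left]

theorem revAssoc_natural_mid (X : C) {Y Y' : C} (f : Y ⟶ Y') (d : D) :
    (X ◁ f) ⊵ₗ d ≫ (revAssoc X Y' d).hom = (revAssoc X Y d).hom ≫ f ⊵ₗ (X ⊙ₗ d) := by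
  simp only [revAssoc, actionHomLeft_action, Category.assoc, Iso.hom_inv_id_assoc,
    ← comp_actionHomLeft_assoc, BraidedCategory.braiding_inv_naturality_right]

theorem revAssoc_unit_left (X : C) (d : D) :
    (λ_ X).hom ⊵ₗ d = (revAssoc (𝟙_ C) X d).hom ≫ X ⊴ₗ (λₗ d).hom := by
  simp only [revAssoc, Category.assoc, ← rightUnitor_actionHom, ← comp_actionHomLeft]
  congr 1; simp

theorem revAssoc_unit_right (X : C) (d : D) :
    (ρ_ X).hom ⊵ₗ d = (revAssoc X (𝟙_ C) d).hom ≫ (λₗ (X ⊙ₗ d)).hom := by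
  simp only [revAssoc, Category.assoc, ← leftUnitor_actionHom, ← comp_actionHomLeft]
  congr 1; simp

end General

section ModuleFunctors

universe v v₁ v₂ v₃ v₄ u₁ u₂ u₃ u₄

/-- The action of a `k`-linear monoidal category `C` on a `k`-linear category `D` is
`k`-bilinear on morphisms. -/
class LinearAction (k : Type v) [Field k] (C : Type u₁) [Category.{v₁} C] [MonoidalCategory C]
    [Preadditive C] [Linear k C] (D : Type u₂) [Category.{v₂} D] [Preadditive D] [Linear k D]
    [MonoidalLeftAction C D] : Prop where
  right_add (X : C) {d d' : D} (f g : d ⟶ d') : X ⊴ₗ (f + g) = X ⊴ₗ f + X ⊴ₗ g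
  right_smul (X : C) (a : k) {d d' : D} (f : d ⟶ d') : X ⊴ₗ (a • f) = a • X ⊴ₗ f
  left_add {X X' : C} (f g : X ⟶ X') (d : D) : (f + g) ⊵ₗ d = f ⊵ₗ d + g ⊵ₗ d
  left_smul (a : k) {X X' : C} (f : X ⟶ X') (d : D) : (a • f) ⊵ₗ d = a • f ⊵ₗ d

variable (k : Type v) [Field k] (C : Type u₁) [Category.{v₁} C] [MonoidalCategory C]
  [Preadditive C] [Linear k C]
  (D : Type u₂) [Category.{v₂} D] [Preadditive D] [Linear k D]
  [MonoidalLeftAction C D] [LinearAction k C D]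
  (E : Type u₃) [Category.{v₃} E] [Preadditive E] [Linear k E]
  [MonoidalLeftAction C E] [LinearAction k C E]

/-- A `k`-linear oplax module functor `D ⥤ E`: a `k`-linear functor `F` with a natural family of
morphisms `δₗ F X d : F (X ⊙ d) ⟶ X ⊙ F d` compatible with associativity and unit constraints
(these are not required to be isomorphisms; see `ModuleFunctor` for that). -/
structure OplaxModuleFunctor where
  /-- the underlying functor -/
  functor : D ⥤ E
  [additive : functor.Additive]
  [linear : functor.Linear k]
  /-- the natural family `F (X ⊙ d) ⟶ X ⊙ F d` -/
  [oplax : functor.OplaxLeftLinear C]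

attribute [instance] OplaxModuleFunctor.additive OplaxModuleFunctor.linear OplaxModuleFunctor.oplax

namespace OplaxModuleFunctor

open Functor.OplaxLeftLinear

variable {k C D E}

/-- The structure map `F (X ⊙ d) ⟶ X ⊙ F d` of a module functor. -/
abbrev str (F : OplaxModuleFunctor k C D E) (X : C) (d : D) :
    F.functor.obj (X ⊙ₗ d) ⟶ X ⊙ₗ F.functor.obj d := δₗ F.functor X d

/-- A morphism of oplax module functors: a natural transformation compatible with the structure
maps. -/
@[ext]
structure Hom (F G : OplaxModuleFunctor k C D E) where
  /-- the underlying natural transformation -/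
  nat : F.functor ⟶ G.functor
  comm (X : C) (d : D) : nat.app (X ⊙ₗ d) ≫ G.str X d = F.str X d ≫ X ⊴ₗ nat.app d

attribute [simp] Hom.comm

instance : Category (OplaxModuleFunctor k C D E) where
  Hom F G := Hom F G
  id F := ⟨𝟙 _, by simp⟩
  comp {F G K} f g := ⟨f.nat ≫ g.nat, fun X d => by
    rw [NatTrans.comp_app, NatTrans.comp_app, Category.assoc, g.comm, ← Category.assoc, f.comm,
      Category.assoc, actionHomRight_comp]⟩

@[simp] theorem id_nat (F : OplaxModuleFunctor k C D E) : Hom.nat (𝟙 F) = 𝟙 F.functor := rfl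

@[simp] theorem comp_nat {F G K : OplaxModuleFunctor k C D E} (f : F ⟶ G) (g : G ⟶ K) :
    Hom.nat (f ≫ g) = Hom.nat f ≫ Hom.nat g := rfl

@[ext]
theorem hom_ext {F G : OplaxModuleFunctor k C D E} {f g : F ⟶ G}
    (h : ∀ d, (Hom.nat f).app d = (Hom.nat g).app d) : f = g :=
  Hom.ext (NatTrans.ext (funext h))

/-- Morphisms of oplax module functors as a subspace of the space of natural transformations. -/
def homSubmodule (F G : OplaxModuleFunctor k C D E) : Submodule k (F.functor ⟶ G.functor) where
  carrier := {t | ∀ (X : C) (d : D), t.app (X ⊙ₗ d) ≫ G.str X d = F.str X d ≫ X ⊴ₗ t.app d}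
  add_mem' {s t} hs ht X d := by
    have h1 := hs X d
    have h2 := ht X d
    simp [Preadditive.add_comp, Preadditive.comp_add, h1, h2,
      LinearAction.right_add (k := k) (C := C)]
  zero_mem' X d := by
    have : X ⊴ₗ (0 : F.functor.obj d ⟶ G.functor.obj d) = 0 := by
      simpa using LinearAction.right_smul X (0 : k) (0 : F.functor.obj d ⟶ G.functor.obj d)
    simp [this]
  smul_mem' a t ht X d := by
    have h := ht X d
    simp [h, LinearAction.right_smul]

/-- Identification of morphisms with the elements of the subspace. -/
def homEquiv (F G : OplaxModuleFunctor k C D E) : (F ⟶ G) ≃ homSubmodule F G where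
  toFun f := ⟨Hom.nat f, Hom.comm f⟩
  invFun f := ⟨f.1, f.2⟩
  left_inv _ := rfl
  right_inv _ := rfl

instance (F G : OplaxModuleFunctor k C D E) : AddCommGroup (F ⟶ G) := (homEquiv F G).addCommGroup

instance (F G : OplaxModuleFunctor k C D E) : Module k (F ⟶ G) := (homEquiv F G).module k

@[simp] theorem add_nat {F G : OplaxModuleFunctor k C D E} (f g : F ⟶ G) :
    Hom.nat (f + g) = Hom.nat f + Hom.nat g := rfl

@[simp] theorem smul_nat {F G : OplaxModuleFunctor k C D E} (a : k) (f : F ⟶ G) :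
    Hom.nat (a • f) = a • Hom.nat f := rfl

instance : Preadditive (OplaxModuleFunctor k C D E) where
  add_comp _ _ _ _ _ _ := by ext; simp
  comp_add _ _ _ _ _ _ := by ext; simp

instance : Linear k (OplaxModuleFunctor k C D E) where
  smul_comp _ _ _ _ _ _ := by ext; simp
  comp_smul _ _ _ _ _ _ := by ext; simp

/-- An isomorphism of oplax module functors from a natural isomorphism compatible with the
structure maps. -/
def isoMk {F G : OplaxModuleFunctor k C D E} (e : F.functor ≅ G.functor)
    (h : ∀ X d, e.hom.app (X ⊙ₗ d) ≫ G.str X d = F.str X d ≫ X ⊴ₗ e.hom.app d) : F ≅ G where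
  hom := ⟨e.hom, h⟩
  inv := ⟨e.inv, fun X d => by
    rw [← cancel_epi (e.hom.app (X ⊙ₗ d)), reassoc_of% (h X d), ← actionHomRight_comp]
    simp⟩
  hom_inv_id := by ext; simp
  inv_hom_id := by ext; simp

/-- The identity module functor. -/
def idFunctor : OplaxModuleFunctor k C D D where
  functor := 𝟭 D
  oplax := { δₗ X d := 𝟙 (X ⊙ₗ d) }

variable {E' : Type u₄} [Category.{v₄} E'] [Preadditive E'] [Linear k E']
  [MonoidalLeftAction C E'] [LinearAction k C E']

/-- The composition of oplax module functors. -/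
def compFunctor (F : OplaxModuleFunctor k C D E) (G : OplaxModuleFunctor k C E E') :
    OplaxModuleFunctor k C D E' where
  functor := F.functor ⋙ G.functor
  oplax :=
    { δₗ X d := G.functor.map (F.str X d) ≫ G.str X (F.functor.obj d)
      δₗ_naturality_left f d := by
        rw [Functor.comp_map, ← Functor.map_comp_assoc, δₗ_naturality_left, Functor.map_comp,
          Category.assoc, δₗ_naturality_left, Category.assoc]
        rfl
      δₗ_naturality_right X _ _ f := by
        rw [Functor.comp_map, ← Functor.map_comp_assoc, δₗ_naturality_right, Functor.map_comp,
          Category.assoc, δₗ_naturality_right, Category.assoc]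
        rfl
      δₗ_associativity X Y d := by
        have h1 := δₗ_associativity G.functor X Y (F.functor.obj d)
        have h2 := δₗ_associativity F.functor X Y d
        have h3 := δₗ_naturality_right G.functor X (F.str Y d)
        dsimp only [Functor.comp_obj, Functor.comp_map]
        rw [Category.assoc, h1, ← Functor.map_comp_assoc, h2, actionHomRight_comp]
        simp only [Functor.map_comp, Category.assoc]
        rw [reassoc_of% h3]
      δₗ_unitality_inv d := by
        have h1 := δₗ_unitality_inv (C := C) G.functor (F.functor.obj d)
        have h2 := δₗ_unitality_inv (C := C) F.functor d
        dsimp only [Functor.comp_obj, Functor.comp_map]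
        rw [h1, h2, Functor.map_comp, Category.assoc] }

section Braided

variable [BraidedCategory C]

/-- The left action of a braided `C` on oplax module functors: `(X ⊙ F)(d) = F (X ⊙ d)`, with
structure map `F (X ⊙ (A ⊙ d)) ⟶ F (A ⊙ (X ⊙ d)) ⟶ A ⊙ F (X ⊙ d)` given by the braiding. -/
def act (X : C) (F : OplaxModuleFunctor k C D E) : OplaxModuleFunctor k C D E where
  functor :=
    { obj d := F.functor.obj (X ⊙ₗ d)
      map f := F.functor.map (X ⊴ₗ f)
      map_id d := by simp
      map_comp f g := by simp }
  additive := ⟨fun {_ _ f g} => by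
    change F.functor.map (X ⊴ₗ (f + g)) = F.functor.map (X ⊴ₗ f) + F.functor.map (X ⊴ₗ g)
    rw [LinearAction.right_add (k := k), Functor.map_add]⟩
  linear := ⟨fun f a => by
    change F.functor.map (X ⊴ₗ (a • f)) = a • F.functor.map (X ⊴ₗ f)
    rw [LinearAction.right_smul (k := k), Functor.map_smul]⟩
  oplax :=
    { δₗ A d := F.functor.map (swapIso X A d).hom ≫ F.str A (X ⊙ₗ d)
      δₗ_naturality_left f d := by
        have h1 := δₗ_naturality_left F.functor f (X ⊙ₗ d)
        dsimp only
        rw [← Functor.map_comp_assoc, swapIso_natural_mid, Functor.map_comp, Category.assoc, h1,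
          Category.assoc]
      δₗ_naturality_right A _ _ f := by
        have h1 := δₗ_naturality_right F.functor A (X ⊴ₗ f)
        dsimp only
        rw [← Functor.map_comp_assoc, swapIso_natural_right, Functor.map_comp, Category.assoc, h1,
          Category.assoc]
      δₗ_associativity A B d := by
        have h1 := δₗ_associativity F.functor A B (X ⊙ₗ d)
        have h2 := congrArg F.functor.map (swapIso_tensor X A B d)
        have h3 := δₗ_naturality_right F.functor A (swapIso X B d).hom
        simp only [Functor.map_comp] at h2
        dsimp only
        rw [Category.assoc, h1, reassoc_of% h2, actionHomRight_comp, Category.assoc,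
          reassoc_of% h3]
      δₗ_unitality_inv d := by
        have h1 := δₗ_unitality_inv (C := C) F.functor (X ⊙ₗ d)
        have h2 : X ⊴ₗ (λₗ[C] d).inv ≫ (swapIso X (𝟙_ C) d).hom = (λₗ (X ⊙ₗ d)).inv := by
          rw [← cancel_mono (λₗ (X ⊙ₗ d)).hom, Category.assoc, swapIso_unit_mid,
            actionHomRight_inv_hom, Iso.inv_hom_id]
        dsimp only
        rw [h1, ← Functor.map_comp_assoc, h2] }

/-- The action of a braided category on oplax module functors is a left module category: the
associativity isomorphism `((X ⊗ Y) ⊙ F)(d) ⟶ (X ⊙ (Y ⊙ F))(d)` is `F` applied to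
`revAssoc X Y d : (X ⊗ Y) ⊙ d ≅ Y ⊙ (X ⊙ d)`. -/
instance : MonoidalLeftAction C (OplaxModuleFunctor k C D E) where
  actionObj X F := act X F
  actionHomLeft {X X'} f F :=
    { nat :=
        { app d := F.functor.map (f ⊵ₗ d)
          naturality d d' g := by
            change F.functor.map (X ⊴ₗ g) ≫ F.functor.map (f ⊵ₗ d') =
              F.functor.map (f ⊵ₗ d) ≫ F.functor.map (X' ⊴ₗ g)
            rw [← Functor.map_comp, ← Functor.map_comp, action_exchange] }
      comm A d := by
        change F.functor.map (f ⊵ₗ (A ⊙ₗ d)) ≫ F.functor.map (swapIso X' A d).hom ≫ _ =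
          (F.functor.map (swapIso X A d).hom ≫ F.str A (X ⊙ₗ d)) ≫ A ⊴ₗ F.functor.map (f ⊵ₗ d)
        have h := δₗ_naturality_right F.functor A (f ⊵ₗ d)
        rw [← Functor.map_comp_assoc, swapIso_natural_left, Functor.map_comp, Category.assoc, h,
          Category.assoc] }
  actionHomRight X {F G} t :=
    { nat :=
        { app d := (Hom.nat t).app (X ⊙ₗ d)
          naturality d d' g := (Hom.nat t).naturality (X ⊴ₗ g) }
      comm A d := by
        change (Hom.nat t).app (X ⊙ₗ A ⊙ₗ d) ≫ G.functor.map (swapIso X A d).hom ≫ _ =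
          (F.functor.map (swapIso X A d).hom ≫ F.str A (X ⊙ₗ d)) ≫ A ⊴ₗ (Hom.nat t).app (X ⊙ₗ d)
        rw [Category.assoc, ← Hom.comm, NatTrans.naturality_assoc] }
  actionAssocIso X Y F :=
    isoMk (NatIso.ofComponents (fun d => F.functor.mapIso (revAssoc X Y d)) (fun {d d'} f => by
      change F.functor.map ((X ⊗ Y) ⊴ₗ f) ≫ F.functor.map (revAssoc X Y d').hom =
        F.functor.map (revAssoc X Y d).hom ≫ F.functor.map (Y ⊴ₗ X ⊴ₗ f)
      rw [← Functor.map_comp, ← Functor.map_comp, revAssoc_natural])) (fun A d => by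
        have h := congrArg F.functor.map (swapIso_revAssoc X Y A d)
        have h3 := δₗ_naturality_right F.functor A (revAssoc X Y d).hom
        simp only [Functor.map_comp] at h
        change F.functor.map (revAssoc X Y (A ⊙ₗ d)).hom ≫
          F.functor.map (Y ⊴ₗ (swapIso X A d).hom) ≫ F.functor.map (swapIso Y A (X ⊙ₗ d)).hom ≫
            F.str A (Y ⊙ₗ X ⊙ₗ d) = (F.functor.map (swapIso (X ⊗ Y) A d).hom ≫
            F.str A ((X ⊗ Y) ⊙ₗ d)) ≫ A ⊴ₗ F.functor.map (revAssoc X Y d).hom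
        rw [reassoc_of% h, Category.assoc, h3])
  actionUnitIso F :=
    isoMk (NatIso.ofComponents (fun d => F.functor.mapIso (λₗ d)) (fun {d d'} f => by
      change F.functor.map (𝟙_ C ⊴ₗ f) ≫ F.functor.map (λₗ d').hom =
        F.functor.map (λₗ d).hom ≫ F.functor.map f
      rw [← Functor.map_comp, ← Functor.map_comp, actionUnitIso_hom_naturality])) (fun A d => by
        have h := congrArg F.functor.map (swapIso_unit_left A d)
        have h3 := δₗ_naturality_right F.functor A (λₗ[C] d).hom
        simp only [Functor.map_comp] at h
        change F.functor.map (λₗ (A ⊙ₗ d)).hom ≫ F.str A d =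
          (F.functor.map (swapIso (𝟙_ C) A d).hom ≫ F.str A (𝟙_ C ⊙ₗ d)) ≫
            A ⊴ₗ F.functor.map (λₗ d).hom
        rw [Category.assoc, ← h3, reassoc_of% h])
  actionHom_comp {X X' X'' F F' F''} f f' s t := by
    ext d
    change F.functor.map ((f ≫ f') ⊵ₗ d) ≫ (Hom.nat s).app _ ≫ (Hom.nat t).app _ =
      (F.functor.map (f ⊵ₗ d) ≫ (Hom.nat s).app _) ≫ F'.functor.map (f' ⊵ₗ d) ≫ (Hom.nat t).app _
    simp
  actionAssocIso_hom_naturality {X X' Y Y' F F'} f g t := by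
    ext d
    change (F.functor.map ((f ⊗ₘ g) ⊵ₗ d) ≫ (Hom.nat t).app ((X' ⊗ Y') ⊙ₗ d)) ≫
      F'.functor.map (revAssoc X' Y' d).hom = F.functor.map (revAssoc X Y d).hom ≫
      F.functor.map (Y ⊴ₗ f ⊵ₗ d) ≫ F.functor.map (g ⊵ₗ (X' ⊙ₗ d)) ≫ (Hom.nat t).app _
    have h : (f ⊗ₘ g) ⊵ₗ d ≫ (revAssoc X' Y' d).hom =
        (revAssoc X Y d).hom ≫ Y ⊴ₗ f ⊵ₗ d ≫ g ⊵ₗ (X' ⊙ₗ d) := by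
      rw [MonoidalCategory.tensorHom_def, comp_actionHomLeft, Category.assoc, revAssoc_natural_mid,
        ← Category.assoc, revAssoc_natural_left, Category.assoc]
    have h' := congrArg F.functor.map h
    simp only [Functor.map_comp] at h'
    rw [Category.assoc, ← (Hom.nat t).naturality, reassoc_of% h']
  actionUnitIso_hom_naturality {F G} t := by
    ext d
    exact (Hom.nat t).naturality (λₗ d).hom
  whiskerLeft_actionHomLeft X Y Y' f F := by
    ext d
    change F.functor.map ((X ◁ f) ⊵ₗ d) = F.functor.map (revAssoc X Y d).hom ≫
      F.functor.map (f ⊵ₗ (X ⊙ₗ d)) ≫ F.functor.map (revAssoc X Y' d).inv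
    simp only [← Functor.map_comp]
    congr 1
    rw [← Category.assoc, Iso.eq_comp_inv, revAssoc_natural_mid]
  whiskerRight_actionHomLeft {X X'} Y f F := by
    ext d
    change F.functor.map ((f ▷ Y) ⊵ₗ d) = F.functor.map (revAssoc X Y d).hom ≫
      F.functor.map (Y ⊴ₗ f ⊵ₗ d) ≫ F.functor.map (revAssoc X' Y d).inv
    simp only [← Functor.map_comp]
    congr 1
    rw [← Category.assoc, Iso.eq_comp_inv, revAssoc_natural_left]
  associator_actionHom X Y Z F := by
    ext d
    change F.functor.map _ ≫ F.functor.map _ ≫ F.functor.map _ = F.functor.map _ ≫ F.functor.map _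
    simp only [← Functor.map_comp]
    exact congrArg F.functor.map (revAssoc_pentagon X Y Z d)
  leftUnitor_actionHom X F := by
    ext d
    change F.functor.map _ = F.functor.map _ ≫ F.functor.map _
    simp only [← Functor.map_comp]
    exact congrArg F.functor.map (revAssoc_unit_left X d)
  rightUnitor_actionHom X F := by
    ext d
    change F.functor.map _ = F.functor.map _ ≫ F.functor.map _
    simp only [← Functor.map_comp]
    exact congrArg F.functor.map (revAssoc_unit_right X d)
  actionHomRight_id X F := by ext d; rfl
  id_actionHomLeft X F := by
    ext d
    change F.functor.map (𝟙 X ⊵ₗ d) = 𝟙 (F.functor.obj (X ⊙ₗ d))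
    simp

instance : LinearAction k C (OplaxModuleFunctor k C D E) where
  right_add X F G s t := by ext d; rfl
  right_smul X a F G s := by ext d; rfl
  left_add {X X'} f g F := by
    ext d
    change F.functor.map ((f + g) ⊵ₗ d) = F.functor.map (f ⊵ₗ d) + F.functor.map (g ⊵ₗ d)
    rw [LinearAction.left_add (k := k), Functor.map_add]
  left_smul a {X X'} f F := by
    ext d
    change F.functor.map ((a • f) ⊵ₗ d) = a • F.functor.map (f ⊵ₗ d)
    rw [LinearAction.left_smul (k := k), Functor.map_smul]

end Braided

end OplaxModuleFunctor

/-- A (`k`-linear) module functor `D ⥤ E`: a `k`-linear functor `F` with a natural family of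
isomorphisms `F (X ⊙ d) ≅ X ⊙ F d` compatible with associativity and unit constraints. -/
structure ModuleFunctor extends OplaxModuleFunctor k C D E where
  isIso (X : C) (d : D) : IsIso (toOplaxModuleFunctor.str X d)

namespace ModuleFunctor

variable {k C D E}

/-- Morphisms of module functors are natural transformations compatible with the structure
maps. -/
instance : Category (ModuleFunctor k C D E) where
  Hom F G := F.toOplaxModuleFunctor ⟶ G.toOplaxModuleFunctor
  id F := 𝟙 F.toOplaxModuleFunctor
  comp f g := OplaxModuleFunctor.instCategory.comp f g

instance : Preadditive (ModuleFunctor k C D E) where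
  homGroup F G := Preadditive.homGroup F.toOplaxModuleFunctor G.toOplaxModuleFunctor
  add_comp F G K := Preadditive.add_comp F.toOplaxModuleFunctor G.toOplaxModuleFunctor
    K.toOplaxModuleFunctor
  comp_add F G K := Preadditive.comp_add F.toOplaxModuleFunctor G.toOplaxModuleFunctor
    K.toOplaxModuleFunctor

instance : Linear k (ModuleFunctor k C D E) where
  homModule F G := Linear.homModule F.toOplaxModuleFunctor G.toOplaxModuleFunctor
  smul_comp F G K := Linear.smul_comp F.toOplaxModuleFunctor G.toOplaxModuleFunctor
    K.toOplaxModuleFunctor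
  comp_smul F G K := Linear.comp_smul F.toOplaxModuleFunctor G.toOplaxModuleFunctor
    K.toOplaxModuleFunctor

/-- A module functor is an equivalence of module categories if it has a quasi-inverse which is
a module functor, with unit and counit isomorphisms of module functors. -/
def IsEquivalence (F : ModuleFunctor k C D E) : Prop :=
  ∃ G : ModuleFunctor k C E D,
    Nonempty (OplaxModuleFunctor.idFunctor ≅
      F.toOplaxModuleFunctor.compFunctor G.toOplaxModuleFunctor) ∧
    Nonempty (OplaxModuleFunctor.idFunctor ≅
      G.toOplaxModuleFunctor.compFunctor F.toOplaxModuleFunctor)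

section Braided

variable [BraidedCategory C]

/-- An isomorphism of oplax module functors between module functors. -/
def isoMk {F G : ModuleFunctor k C D E} (e : F.toOplaxModuleFunctor ≅ G.toOplaxModuleFunctor) :
    F ≅ G where
  hom := e.hom
  inv := e.inv
  hom_inv_id := e.hom_inv_id
  inv_hom_id := e.inv_hom_id

/-- The left action of a braided `C` on module functors, `(X ⊙ F)(d) = F (X ⊙ d)`, given by the
action on oplax module functors. -/
instance : MonoidalLeftAction C (ModuleFunctor k C D E) where
  actionObj X F :=
    { toOplaxModuleFunctor := X ⊙ₗ F.toOplaxModuleFunctor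
      isIso A d := by
        have := F.isIso A (X ⊙ₗ d)
        exact (inferInstance :
          IsIso (F.functor.map (swapIso X A d).hom ≫ F.str A (X ⊙ₗ d))) }
  actionHomLeft f F := f ⊵ₗ F.toOplaxModuleFunctor
  actionHomRight X F G t := actionHomRight X (D := OplaxModuleFunctor k C D E) t
  actionAssocIso X Y F := isoMk (αₗ X Y F.toOplaxModuleFunctor)
  actionUnitIso F := isoMk (λₗ F.toOplaxModuleFunctor)
  actionHom_comp f f' s t := actionHom_comp (D := OplaxModuleFunctor k C D E) f f' s t
  actionAssocIso_hom_naturality f g t :=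
    actionAssocIso_hom_naturality (D := OplaxModuleFunctor k C D E) f g t
  actionUnitIso_hom_naturality t :=
    actionUnitIso_hom_naturality (D := OplaxModuleFunctor k C D E) t
  whiskerLeft_actionHomLeft X _ _ f F :=
    whiskerLeft_actionHomLeft X f F.toOplaxModuleFunctor
  whiskerRight_actionHomLeft Y f F :=
    whiskerRight_actionHomLeft Y f F.toOplaxModuleFunctor
  associator_actionHom X Y Z F := associator_actionHom X Y Z F.toOplaxModuleFunctor
  leftUnitor_actionHom X F := leftUnitor_actionHom X F.toOplaxModuleFunctor
  rightUnitor_actionHom X F := rightUnitor_actionHom X F.toOplaxModuleFunctor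
  actionHomRight_id X F := actionHomRight_id X F.toOplaxModuleFunctor
  id_actionHomLeft X F := id_actionHomLeft X F.toOplaxModuleFunctor

instance : LinearAction k C (ModuleFunctor k C D E) where
  right_add X F G s t :=
    LinearAction.right_add (k := k) (D := OplaxModuleFunctor k C D E) X s t
  right_smul X a F G s :=
    LinearAction.right_smul (k := k) (D := OplaxModuleFunctor k C D E) X a s
  left_add f g F := LinearAction.left_add (k := k) f g F.toOplaxModuleFunctor
  left_smul a _ _ f F := LinearAction.left_smul (k := k) a f F.toOplaxModuleFunctor

end Braided

end ModuleFunctor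

end ModuleFunctors

section Pair

variable {k A B C D X Y N X' Y' N' : Type u} [Field k]
  [AddCommGroup A] [Module k A] [AddCommGroup B] [Module k B] [AddCommGroup C] [Module k C]
  [AddCommGroup D] [Module k D]
  [AddCommGroup X] [Module k X] [AddCommGroup Y] [Module k Y] [AddCommGroup N] [Module k N]
  [AddCommGroup X'] [Module k X'] [AddCommGroup Y'] [Module k Y'] [AddCommGroup N'] [Module k N']

/-- The element `a ⊗ b` acts on `X ⊗ N` by `f a ⊗ g b`. -/
def pair (f : A →ₗ[k] X →ₗ[k] X') (g : B →ₗ[k] N →ₗ[k] N') :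
    A ⊗[k] B →ₗ[k] X ⊗[k] N →ₗ[k] X' ⊗[k] N' :=
  TensorProduct.homTensorHomMap (RingHom.id k) X N X' N' ∘ₗ TensorProduct.map f g

@[simp] theorem pair_tmul (f : A →ₗ[k] X →ₗ[k] X') (g : B →ₗ[k] N →ₗ[k] N')
    (a : A) (b : B) : pair f g (a ⊗ₜ b) = TensorProduct.map (f a) (g b) := rfl

theorem pair_assoc (f : A →ₗ[k] X →ₗ[k] X') (g : B →ₗ[k] Y →ₗ[k] Y')
    (h : C →ₗ[k] N →ₗ[k] N') (d : D →ₗ[k] A ⊗[k] B) (z : D ⊗[k] C) (x : X) (y : Y) (n : N) :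
    TensorProduct.assoc k X' Y' N' (pair (pair f g ∘ₗ d) h z ((x ⊗ₜ y) ⊗ₜ n)) =
      pair f (pair g h) (TensorProduct.assoc k A B C (d.rTensor C z)) (x ⊗ₜ (y ⊗ₜ n)) := by
  induction z with
  | zero => simp
  | add z w hz hw => simp only [map_add, LinearMap.add_apply, hz, hw]
  | tmul e c =>
    simp only [LinearMap.rTensor_tmul, pair_tmul, LinearMap.comp_apply]
    generalize d e = w
    induction w with
    | zero => simp
    | add z w hz hw =>
      simp only [map_add, LinearMap.add_apply, TensorProduct.add_tmul, TensorProduct.map_tmul]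
        at hz hw ⊢
      rw [hz, hw]
    | tmul a b => simp

theorem pair_nested (f : A →ₗ[k] X →ₗ[k] X') (g : B →ₗ[k] N →ₗ[k] N')
    (d : D →ₗ[k] B) (z : A ⊗[k] D) : pair f (g ∘ₗ d) z = pair f g (d.lTensor A z) := by
  induction z with
  | zero => simp
  | add z w hz hw => simp only [map_add, hz, hw]
  | tmul e c => simp

end Pair

/-- Finite-dimensional left modules over a `k`-algebra `A`: finite-dimensional vector spaces
with an algebra homomorphism from `A` to the endomorphism algebra. -/
structure FinMod (k A : Type u) [Field k] [Ring A] [Algebra k A] where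
  /-- the underlying vector space -/
  carrier : Type u
  [addCommGroup : AddCommGroup carrier]
  [module : Module k carrier]
  [finite : FiniteDimensional k carrier]
  /-- the action of `A` -/
  act : A →ₐ[k] Module.End k carrier

namespace FinMod

attribute [instance] addCommGroup module finite

section Basic

variable {k A : Type u} [Field k] [Ring A] [Algebra k A]

instance : CoeSort (FinMod k A) (Type u) := ⟨carrier⟩

/-- Homomorphisms of `A`-modules. -/
@[ext]
structure Hom (V W : FinMod k A) where
  /-- the underlying linear map -/
  lin : V →ₗ[k] W
  comm (a : A) (v : V) : lin (V.act a v) = W.act a (lin v)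

instance : Category (FinMod k A) where
  Hom := Hom
  id V := ⟨LinearMap.id, fun _ _ => rfl⟩
  comp f g := ⟨g.lin ∘ₗ f.lin, fun a v => by simp [f.comm, g.comm]⟩

@[simp] theorem id_lin (V : FinMod k A) : Hom.lin (𝟙 V) = LinearMap.id := rfl

@[simp] theorem comp_lin {U V W : FinMod k A} (f : U ⟶ V) (g : V ⟶ W) :
    Hom.lin (f ≫ g) = Hom.lin g ∘ₗ Hom.lin f := rfl

@[ext] theorem hom_ext {V W : FinMod k A} {f g : V ⟶ W} (h : Hom.lin f = Hom.lin g) : f = g :=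
  Hom.ext h

/-- Homomorphisms of `A`-modules as a subspace of the space of linear maps. -/
def homSubmodule (V W : FinMod k A) : Submodule k (V →ₗ[k] W) where
  carrier := {f | ∀ (a : A) (v : V), f (V.act a v) = W.act a (f v)}
  add_mem' {f g} hf hg a v := by simp [hf a v, hg a v]
  zero_mem' a v := by simp
  smul_mem' c f hf a v := by simp [hf a v]

/-- Identification of morphisms with the elements of the subspace. -/
def homEquiv (V W : FinMod k A) : (V ⟶ W) ≃ homSubmodule V W where
  toFun f := ⟨Hom.lin f, Hom.comm f⟩
  invFun f := ⟨f.1, f.2⟩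
  left_inv _ := rfl
  right_inv _ := rfl

instance (V W : FinMod k A) : AddCommGroup (V ⟶ W) := (homEquiv V W).addCommGroup

instance (V W : FinMod k A) : Module k (V ⟶ W) := (homEquiv V W).module k

@[simp] theorem add_lin {V W : FinMod k A} (f g : V ⟶ W) :
    Hom.lin (f + g) = Hom.lin f + Hom.lin g := rfl

@[simp] theorem smul_lin {V W : FinMod k A} (a : k) (f : V ⟶ W) :
    Hom.lin (a • f) = a • Hom.lin f := rfl

instance : Preadditive (FinMod k A) where
  add_comp _ _ _ _ _ _ := by ext; simp
  comp_add _ _ _ _ _ _ := by ext; simp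

instance : Linear k (FinMod k A) where
  smul_comp _ _ _ _ _ _ := by ext; simp
  comp_smul _ _ _ _ _ _ := by ext; simp

/-- An isomorphism of modules from a linear equivalence compatible with the actions. -/
@[simps] def isoMk {V W : FinMod k A} (e : V ≃ₗ[k] W) (h : ∀ a v, e (V.act a v) = W.act a (e v)) :
    V ≅ W where
  hom := ⟨e, h⟩
  inv := ⟨e.symm, fun a w => by
    apply e.injective; simp [h]⟩
  hom_inv_id := by ext; simp
  inv_hom_id := by ext; simp

/-- The regular module. -/
def regular (k A : Type u) [Field k] [Ring A] [Algebra k A] [FiniteDimensional k A] :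
    FinMod k A where
  carrier := A
  act := Algebra.lmul k A

end Basic

section Tens

variable {k A B A' : Type u} [Field k] [Ring A] [Algebra k A] [Ring B] [Algebra k B]
  [Ring A'] [Algebra k A']

/-- The tensor product (over `k`) of modules over `B` and `A'`, made into an `A`-module through
an algebra homomorphism `c : A → B ⊗ A'`. -/
def tens (c : A →ₐ[k] B ⊗[k] A') (X : FinMod k B) (N : FinMod k A') : FinMod k A where
  carrier := X ⊗[k] N
  act := (Module.endTensorEndAlgHom (R := k) (S := k) (A := k) (M := X) (N := N)).comp
    ((Algebra.TensorProduct.map X.act N.act).comp c)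

theorem tens_act (c : A →ₐ[k] B ⊗[k] A') (X : FinMod k B) (N : FinMod k A') (a : A) :
    (tens c X N).act a = pair X.act.toLinearMap N.act.toLinearMap (c a) := by
  change Module.endTensorEndAlgHom (Algebra.TensorProduct.map X.act N.act (c a)) = _
  induction c a with
  | zero => simp
  | add z w hz hw => simp only [map_add, hz, hw]
  | tmul e c =>
    rw [Algebra.TensorProduct.map_tmul, Module.endTensorEndAlgHom_apply]
    rfl

theorem tens_act' (c : A →ₐ[k] B ⊗[k] A') (X : FinMod k B) (N : FinMod k A') :
    (tens c X N).act.toLinearMap = pair X.act.toLinearMap N.act.toLinearMap ∘ₗ c.toLinearMap := by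
  ext a : 1
  exact tens_act c X N a

theorem map_pair {X X' : FinMod k B} {N N' : FinMod k A'} (f : X ⟶ X') (g : N ⟶ N')
    (z : B ⊗[k] A') (v : X ⊗[k] N) :
    TensorProduct.map (Hom.lin f) (Hom.lin g)
      (pair X.act.toLinearMap N.act.toLinearMap z v) =
    pair X'.act.toLinearMap N'.act.toLinearMap z (TensorProduct.map (Hom.lin f) (Hom.lin g) v) := by
  induction z with
  | zero => simp
  | add z w hz hw => simp only [map_add, LinearMap.add_apply, hz, hw]
  | tmul b a =>
    induction v with
    | zero => simp
    | add z w hz hw => simp only [map_add, hz, hw]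
    | tmul x n => simp [f.comm, g.comm]

/-- Functoriality of `tens`. -/
@[simps] def tensMap (c : A →ₐ[k] B ⊗[k] A') {X X' : FinMod k B} {N N' : FinMod k A'}
    (f : X ⟶ X') (g : N ⟶ N') : tens c X N ⟶ tens c X' N' where
  lin := TensorProduct.map (Hom.lin f) (Hom.lin g)
  comm a v := by
    rw [tens_act, tens_act]
    exact map_pair f g (c a) v

end Tens

section Hopf

variable {k H : Type u} [Field k] [Ring H] [Bialgebra k H] {S : Type u} [Ring S] [Algebra k S]

/-- The trivial module `k`, on which `H` acts through the counit. -/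
def triv (k H : Type u) [Field k] [Ring H] [Bialgebra k H] : FinMod k H where
  carrier := k
  act := (Algebra.lmul k k).comp (Bialgebra.counitAlgHom k H)

theorem tensAssoc_aux (c : S →ₐ[k] H ⊗[k] S)
    (hc : TensorProduct.assoc k H H S ∘ₗ (Coalgebra.comul (R := k) (A := H)).rTensor S ∘ₗ
      c.toLinearMap = c.toLinearMap.lTensor H ∘ₗ c.toLinearMap)
    (X Y : FinMod k H) (N : FinMod k S) (s : S) (v : (X ⊗[k] Y) ⊗[k] N) :
    TensorProduct.assoc k X Y N (pair (pair X.act.toLinearMap Y.act.toLinearMap ∘ₗ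
      (Bialgebra.comulAlgHom k H).toLinearMap) N.act.toLinearMap (c s) v) =
    pair X.act.toLinearMap (pair Y.act.toLinearMap N.act.toLinearMap ∘ₗ c.toLinearMap) (c s)
      (TensorProduct.assoc k X Y N v) := by
  have h := LinearMap.congr_fun hc s
  simp only [LinearMap.comp_apply, AlgHom.toLinearMap_apply] at h
  rw [pair_nested, ← h]
  induction v with
  | zero => simp
  | add v w hv hw => simp only [map_add, hv, hw]
  | tmul v n =>
    induction v with
    | zero => simp
    | add v w hv hw => simp only [map_add, TensorProduct.add_tmul, hv, hw]
    | tmul x y => exact pair_assoc _ _ _ _ _ _ _ _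

/-- The associativity isomorphism `(X ⊗ Y) ⊗ N ≅ X ⊗ (Y ⊗ N)`. -/
def tensAssoc (c : S →ₐ[k] H ⊗[k] S)
    (hc : TensorProduct.assoc k H H S ∘ₗ (Coalgebra.comul (R := k) (A := H)).rTensor S ∘ₗ
      c.toLinearMap = c.toLinearMap.lTensor H ∘ₗ c.toLinearMap)
    (X Y : FinMod k H) (N : FinMod k S) :
    tens c (tens (Bialgebra.comulAlgHom k H) X Y) N ≅ tens c X (tens c Y N) :=
  isoMk (TensorProduct.assoc k X Y N) fun s v => by
    rw [tens_act, tens_act, tens_act', tens_act']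
    exact tensAssoc_aux c hc X Y N s v

theorem tensUnit_aux (N : FinMod k S) (z : H ⊗[k] S) (v : k ⊗[k] N) :
    TensorProduct.lid k N (pair (A := H) ((Algebra.lmul k k).comp
      (Bialgebra.counitAlgHom k H)).toLinearMap N.act.toLinearMap z v) =
      N.act (TensorProduct.lid k S ((Coalgebra.counit (R := k) (A := H)).rTensor S z))
        (TensorProduct.lid k N v) := by
  induction z with
  | zero => simp
  | add z w hz hw => simp only [map_add, LinearMap.add_apply, hz, hw]
  | tmul h s =>
    induction v with
    | zero => simp
    | add v w hv hw => simp only [map_add, hv, hw]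
    | tmul a n => simp [smul_comm a, mul_smul]

/-- The unit isomorphism `k ⊗ N ≅ N`. -/
def tensUnit (c : S →ₐ[k] H ⊗[k] S)
    (hc : ∀ s, (Coalgebra.counit (R := k) (A := H)).rTensor S (c s) = 1 ⊗ₜ s)
    (N : FinMod k S) : tens c (triv k H) N ≅ N :=
  isoMk (TensorProduct.lid k N) fun s v => by
    rw [tens_act]
    refine (tensUnit_aux N (c s) v).trans ?_
    rw [hc, TensorProduct.lid_tmul, one_smul]
    rfl

theorem tensUnitRight_aux (N : FinMod k H) (z : H ⊗[k] H) (v : N ⊗[k] k) :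
    TensorProduct.rid k N (pair N.act.toLinearMap (B := H) ((Algebra.lmul k k).comp
      (Bialgebra.counitAlgHom k H)).toLinearMap z v) =
      N.act (TensorProduct.rid k H ((Coalgebra.counit (R := k) (A := H)).lTensor H z))
        (TensorProduct.rid k N v) := by
  induction z with
  | zero => simp
  | add z w hz hw => simp only [map_add, LinearMap.add_apply, hz, hw]
  | tmul h s =>
    induction v with
    | zero => simp
    | add v w hv hw => simp only [map_add, hv, hw]
    | tmul n a => simp [smul_comm a, mul_smul]

/-- The unit isomorphism `N ⊗ k ≅ N`. -/
def tensUnitRight (N : FinMod k H) : tens (Bialgebra.comulAlgHom k H) N (triv k H) ≅ N :=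
  isoMk (TensorProduct.rid k N) fun s v => by
    rw [tens_act]
    refine (tensUnitRight_aux N _ v).trans ?_
    rw [Bialgebra.comulAlgHom_apply, Coalgebra.lTensor_counit_comul, TensorProduct.rid_tmul,
      one_smul]
    rfl

/-- The tensor category `Rep(H)` of finite-dimensional `H`-modules. -/
instance : MonoidalCategory (FinMod k H) where
  tensorObj X Y := tens (Bialgebra.comulAlgHom k H) X Y
  whiskerLeft X _ _ f := tensMap _ (𝟙 X) f
  whiskerRight f Y := tensMap _ f (𝟙 Y)
  tensorHom f g := tensMap _ f g
  tensorUnit := triv k H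
  associator X Y Z := tensAssoc (Bialgebra.comulAlgHom k H) (by
    ext x; simp) X Y Z
  leftUnitor X := tensUnit (Bialgebra.comulAlgHom k H) (by simp) X
  rightUnitor X := tensUnitRight X
  tensorHom_def f g := by
    ext : 1; exact TensorProduct.ext' fun _ _ => rfl
  id_tensorHom_id X Y := by
    ext : 1; exact TensorProduct.ext' fun _ _ => rfl
  tensorHom_comp_tensorHom _ _ _ _ := by
    ext : 1; exact TensorProduct.ext' fun _ _ => rfl
  whiskerLeft_id _ _ := by
    ext : 1; exact TensorProduct.ext' fun _ _ => rfl
  id_whiskerRight _ _ := by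
    ext : 1; exact TensorProduct.ext' fun _ _ => rfl
  associator_naturality _ _ _ := by
    ext : 1; exact TensorProduct.ext_threefold fun _ _ _ => rfl
  leftUnitor_naturality f := by
    ext : 1; exact TensorProduct.ext' fun a x => (f.lin.map_smul a x).symm
  rightUnitor_naturality f := by
    ext : 1; exact TensorProduct.ext' fun x a => (f.lin.map_smul a x).symm
  pentagon _ _ _ _ := by
    ext : 1; exact TensorProduct.ext_fourfold fun _ _ _ _ => rfl
  triangle X Y := by
    ext : 1; exact TensorProduct.ext_threefold fun x a y =>
      (TensorProduct.smul_tmul (R := k) (R' := k) (M := X) (N := Y) a x y).symm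

theorem tensorHom_lin {X X' Y Y' : FinMod k H} (f : X ⟶ X') (g : Y ⟶ Y') :
    Hom.lin (f ⊗ₘ g) = TensorProduct.map (Hom.lin f) (Hom.lin g) := rfl

end Hopf

end FinMod

section Legs

variable (k H : Type u) [Field k] [Ring H] [Algebra k H]

/-- `a ⊗ b ↦ a ⊗ b ⊗ 1`. -/
def leg12 : H ⊗[k] H →ₐ[k] H ⊗[k] (H ⊗[k] H) :=
  Algebra.TensorProduct.map (AlgHom.id k H) Algebra.TensorProduct.includeLeft

/-- `a ⊗ b ↦ a ⊗ 1 ⊗ b`. -/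
def leg13 : H ⊗[k] H →ₐ[k] H ⊗[k] (H ⊗[k] H) :=
  Algebra.TensorProduct.map (AlgHom.id k H) Algebra.TensorProduct.includeRight

/-- `a ⊗ b ↦ 1 ⊗ a ⊗ b`. -/
def leg23 : H ⊗[k] H →ₐ[k] H ⊗[k] (H ⊗[k] H) :=
  Algebra.TensorProduct.includeRight

end Legs

/-- A quasi-triangular structure on a Hopf algebra `H`: an invertible element `R` of `H ⊗ H`
with `(Δ ⊗ id) R = R₁₃ R₂₃`, `(id ⊗ Δ) R = R₁₃ R₁₂` (in `H ⊗ (H ⊗ H)`) and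
`R Δ(h) = Δᵒᵖ(h) R`. -/
class QuasiTriangular (k H : Type u) [Field k] [Ring H] [Bialgebra k H] where
  /-- the `R`-matrix -/
  R : (H ⊗[k] H)ˣ
  comul_left : TensorProduct.assoc k H H H
      ((Coalgebra.comul (R := k) (A := H)).rTensor H (R : H ⊗[k] H)) =
    leg13 k H R * leg23 k H R
  comul_right : (Coalgebra.comul (R := k) (A := H)).lTensor H (R : H ⊗[k] H) =
    leg13 k H R * leg12 k H R
  mul_comul (h : H) : (R : H ⊗[k] H) * Coalgebra.comul (R := k) h =
    TensorProduct.comm k H H (Coalgebra.comul (R := k) h) * (R : H ⊗[k] H)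

namespace FinMod

section Braided

variable {k : Type u} [Field k]

section

variable {A B : Type u} [Ring A] [Algebra k A] [Ring B] [Algebra k B]

theorem pair_mul (X : FinMod k A) (Y : FinMod k B) (z w : A ⊗[k] B) (v : X ⊗[k] Y) :
    pair X.act.toLinearMap Y.act.toLinearMap (z * w) v =
      pair X.act.toLinearMap Y.act.toLinearMap z
        (pair X.act.toLinearMap Y.act.toLinearMap w v) := by
  induction z with
  | zero => simp
  | add z z' hz hw => simp only [map_add, add_mul, LinearMap.add_apply, hz, hw]
  | tmul a b =>
    induction w with
    | zero => simp
    | add z z' hz hw => simp only [map_add, mul_add, LinearMap.add_apply, hz, hw]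
    | tmul c d =>
      induction v with
      | zero => simp
      | add v w hv hw => simp only [map_add, hv, hw]
      | tmul x y => simp

theorem pair_one (X : FinMod k A) (Y : FinMod k B) (v : X ⊗[k] Y) :
    pair X.act.toLinearMap Y.act.toLinearMap (1 : A ⊗[k] B) v = v := by
  rw [Algebra.TensorProduct.one_def, pair_tmul]
  simp

theorem pair_comm (X : FinMod k A) (Y : FinMod k B) (z : A ⊗[k] B) (v : X ⊗[k] Y) :
    TensorProduct.comm k X Y (pair X.act.toLinearMap Y.act.toLinearMap z v) =
      pair Y.act.toLinearMap X.act.toLinearMap (TensorProduct.comm k A B z)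
        (TensorProduct.comm k X Y v) := by
  induction z with
  | zero => simp
  | add z z' hz hw => simp only [map_add, LinearMap.add_apply, hz, hw]
  | tmul a b =>
    induction v with
    | zero => simp
    | add v w hv hw => simp only [map_add, hv, hw]
    | tmul x y => simp

end

variable {H : Type u} [Ring H] [Bialgebra k H]

theorem hexagon_aux₁ (X Y Z : FinMod k H) (r w : H ⊗[k] H) (x : X) (y : Y) (z : Z) :
    TensorProduct.assoc k Y Z X (TensorProduct.comm k X (Y ⊗[k] Z)
      (pair X.act.toLinearMap (pair Y.act.toLinearMap Z.act.toLinearMap)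
        (leg13 k H w * leg12 k H r) (x ⊗ₜ (y ⊗ₜ z)))) =
    TensorProduct.map (LinearMap.id (M := Y))
      ((TensorProduct.comm k X Z).toLinearMap ∘ₗ pair X.act.toLinearMap Z.act.toLinearMap w)
      (TensorProduct.assoc k Y X Z
        (TensorProduct.comm k X Y (pair X.act.toLinearMap Y.act.toLinearMap r (x ⊗ₜ y)) ⊗ₜ z)) := by
  induction r with
  | zero => simp
  | add r r' h h' =>
    simp only [map_add, mul_add, LinearMap.add_apply, h, h', TensorProduct.add_tmul]
  | tmul a b =>
    induction w with
    | zero => simp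
    | add w w' h h' =>
      simp only [map_add, add_mul, LinearMap.add_apply, h, h', LinearMap.comp_add,
        TensorProduct.map_add_right]
    | tmul c d => simp [leg13, leg12]

theorem hexagon_aux₂ (X Y Z : FinMod k H) (r w : H ⊗[k] H) (x : X) (y : Y) (z : Z) :
    (TensorProduct.assoc k Z X Y).symm (TensorProduct.comm k (X ⊗[k] Y) Z
      ((TensorProduct.assoc k X Y Z).symm
      (pair X.act.toLinearMap (pair Y.act.toLinearMap Z.act.toLinearMap)
        (leg13 k H w * leg23 k H r) (x ⊗ₜ (y ⊗ₜ z))))) =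
    TensorProduct.map
      ((TensorProduct.comm k X Z).toLinearMap ∘ₗ pair X.act.toLinearMap Z.act.toLinearMap w)
      (LinearMap.id (M := Y)) ((TensorProduct.assoc k X Z Y).symm
        (x ⊗ₜ TensorProduct.comm k Y Z (pair Y.act.toLinearMap Z.act.toLinearMap r (y ⊗ₜ z)))) := by
  induction r with
  | zero => simp
  | add r r' h h' =>
    simp only [map_add, mul_add, LinearMap.add_apply, h, h', TensorProduct.tmul_add]
  | tmul a b =>
    induction w with
    | zero => simp
    | add w w' h h' =>
      simp only [map_add, add_mul, LinearMap.add_apply, h, h', LinearMap.comp_add,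
        TensorProduct.map_add_left]
    | tmul c d => simp [leg13, leg23]

variable [QuasiTriangular k H]

open QuasiTriangular

/-- The linear map `x ⊗ y ↦ R² y ⊗ R¹ x`, with inverse `y ⊗ x ↦ R⁻¹ x ⊗ R⁻² y`. -/
def braidLin (X Y : FinMod k H) : X ⊗[k] Y ≃ₗ[k] Y ⊗[k] X :=
  LinearEquiv.ofLinearMap
    ((TensorProduct.comm k X Y).toLinearMap ∘ₗ
      pair X.act.toLinearMap Y.act.toLinearMap (R (k := k) (H := H)).val)
    (pair X.act.toLinearMap Y.act.toLinearMap (R (k := k) (H := H))⁻¹.val ∘ₗ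
      (TensorProduct.comm k Y X).toLinearMap)
    (by
      refine LinearMap.ext fun v => ?_
      simp only [LinearMap.comp_apply, ← pair_mul, LinearEquiv.coe_coe, Units.mul_inv, pair_one]
      exact (TensorProduct.comm k X Y).apply_symm_apply v)
    (by
      refine LinearMap.ext fun v => ?_
      simp only [LinearMap.comp_apply, LinearEquiv.coe_coe]
      rw [← TensorProduct.comm_symm, LinearEquiv.symm_apply_apply, ← pair_mul, Units.inv_mul,
        pair_one]
      rfl)

theorem braidLin_apply (X Y : FinMod k H) (v : X ⊗[k] Y) :
    braidLin X Y v = TensorProduct.comm k X Y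
      (pair X.act.toLinearMap Y.act.toLinearMap (R (k := k) (H := H)).val v) := rfl

theorem braidLin_pair (X Y : FinMod k H) (h : H) (v : X ⊗[k] Y) :
    braidLin X Y (pair X.act.toLinearMap Y.act.toLinearMap (Coalgebra.comul (R := k) h) v) =
      pair Y.act.toLinearMap X.act.toLinearMap (Coalgebra.comul (R := k) h)
        (braidLin X Y v) := by
  rw [braidLin_apply, braidLin_apply, ← pair_mul, mul_comul, pair_mul, pair_comm]
  congr 2
  exact (TensorProduct.comm k H H).symm_apply_apply _

theorem braidLin_map {X X' Y Y' : FinMod k H} (f : X ⟶ X') (g : Y ⟶ Y') (v : X ⊗[k] Y) :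
    braidLin X' Y' (TensorProduct.map (Hom.lin f) (Hom.lin g) v) =
      TensorProduct.map (Hom.lin g) (Hom.lin f) (braidLin X Y v) := by
  rw [braidLin_apply, braidLin_apply, ← map_pair, TensorProduct.map_comm]

/-- The braiding `x ⊗ y ↦ R² y ⊗ R¹ x` as an isomorphism of modules. -/
def braid (X Y : FinMod k H) : X ⊗ Y ≅ Y ⊗ X :=
  isoMk (braidLin X Y) fun h v => by
    change braidLin X Y ((tens _ X Y).act h v) = (tens _ Y X).act h (braidLin X Y v)
    rw [tens_act, tens_act]
    exact braidLin_pair X Y h v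

instance : BraidedCategory (FinMod k H) where
  braiding := braid
  braiding_naturality_right X {Y Z} f := by
    ext : 1
    exact LinearMap.ext fun v => braidLin_map (𝟙 X) f v
  braiding_naturality_left {X Y} f Z := by
    ext : 1
    exact LinearMap.ext fun v => braidLin_map f (𝟙 Z) v
  hexagon_forward X Y Z := by
    ext : 1
    refine TensorProduct.ext_threefold fun x y z => ?_
    refine Eq.trans ?_ (hexagon_aux₁ X Y Z R.val R.val x y z)
    rw [← comul_right]
    change TensorProduct.assoc k Y Z X (braidLin X (tens _ Y Z) (x ⊗ₜ (y ⊗ₜ z))) = _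
    rw [braidLin_apply, tens_act']
    have h := pair_nested X.act.toLinearMap (pair Y.act.toLinearMap Z.act.toLinearMap)
      (Bialgebra.comulAlgHom k H).toLinearMap (R (k := k) (H := H)).val
    exact congrArg (fun e : Module.End k (X ⊗[k] (Y ⊗[k] Z)) =>
      TensorProduct.assoc k Y Z X (TensorProduct.comm k X _ (e (x ⊗ₜ (y ⊗ₜ z))))) h
  hexagon_reverse X Y Z := by
    ext : 1
    refine TensorProduct.ext (LinearMap.ext fun x => TensorProduct.ext' fun y z => ?_)
    refine Eq.trans ?_ (hexagon_aux₂ X Y Z R.val R.val x y z)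
    rw [← comul_left]
    change (TensorProduct.assoc k Z X Y).symm (braidLin (tens _ X Y) Z ((x ⊗ₜ y) ⊗ₜ z)) = _
    rw [braidLin_apply, tens_act']
    have h := pair_assoc X.act.toLinearMap Y.act.toLinearMap Z.act.toLinearMap
      (Bialgebra.comulAlgHom k H).toLinearMap (R (k := k) (H := H)).val x y z
    rw [← LinearEquiv.eq_symm_apply] at h
    exact congrArg (fun v => (TensorProduct.assoc k Z X Y).symm (TensorProduct.comm k _ Z v)) h

end Braided

end FinMod

/-- Left `H`-comodule algebras: algebras `S` with an algebra homomorphism `S → H ⊗ S` which is a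
coassociative and counital coaction. -/
class LeftComoduleAlgebra (k H S : Type u) [Field k] [Ring H] [Bialgebra k H] [Ring S]
    [Algebra k S] where
  /-- the coaction -/
  coact : S →ₐ[k] H ⊗[k] S
  coassoc : TensorProduct.assoc k H H S ∘ₗ (Coalgebra.comul (R := k) (A := H)).rTensor S ∘ₗ
    coact.toLinearMap = coact.toLinearMap.lTensor H ∘ₗ coact.toLinearMap
  counit (s : S) : (Coalgebra.counit (R := k) (A := H)).rTensor S (coact s) = 1 ⊗ₜ s

open LeftComoduleAlgebra

/-- A left `H`-comodule algebra is right `H`-simple if its only right ideals `J` which are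
`H`-costable (stable under the coaction), that is, map to (the image of) `H ⊗ J` under the coaction, are `0` and `S`. -/
def IsRightSimple (k H S : Type u) [Field k] [Ring H] [Bialgebra k H] [Ring S] [Algebra k S]
    [LeftComoduleAlgebra k H S] : Prop :=
  ∀ J : Submodule k S, (∀ x ∈ J, ∀ s : S, x * s ∈ J) →
    (∀ x ∈ J, coact (k := k) (H := H) x ∈ LinearMap.range (J.subtype.lTensor H)) →
    J = ⊥ ∨ J = ⊤

namespace FinMod

section Action

variable {k H S : Type u} [Field k] [Ring H] [Bialgebra k H] [Ring S] [Algebra k S]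
  [LeftComoduleAlgebra k H S]

/-- The action of `Rep(H)` on the category of finite-dimensional `S`-modules: `X ⊙ N = X ⊗ N` on
which `S` acts through the coaction `S → H ⊗ S`. -/
instance : MonoidalLeftAction (FinMod k H) (FinMod k S) where
  actionObj X N := tens coact X N
  actionHomLeft f N := tensMap coact f (𝟙 N)
  actionHomRight X _ _ g := tensMap coact (𝟙 X) g
  actionHom f g := tensMap coact f g
  actionAssocIso X Y N := tensAssoc coact coassoc X Y N
  actionUnitIso N := tensUnit coact counit N
  actionHom_def f g := by
    ext : 1; exact TensorProduct.ext' fun _ _ => rfl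
  actionHomRight_id X N := by
    ext : 1; exact TensorProduct.ext' fun _ _ => rfl
  id_actionHomLeft X N := by
    ext : 1; exact TensorProduct.ext' fun _ _ => rfl
  actionHom_comp _ _ _ _ := by
    ext : 1; exact TensorProduct.ext' fun _ _ => rfl
  actionAssocIso_hom_naturality _ _ _ := by
    ext : 1; exact TensorProduct.ext_threefold fun _ _ _ => rfl
  actionUnitIso_hom_naturality f := by
    ext : 1; exact TensorProduct.ext' fun a x => (f.lin.map_smul a x)
  whiskerLeft_actionHomLeft _ _ _ _ _ := by
    ext : 1; exact TensorProduct.ext_threefold fun _ _ _ => rfl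
  whiskerRight_actionHomLeft _ _ _ := by
    ext : 1; exact TensorProduct.ext_threefold fun _ _ _ => rfl
  associator_actionHom _ _ _ _ := by
    ext : 1; exact TensorProduct.ext_fourfold fun _ _ _ _ => rfl
  leftUnitor_actionHom X N := by
    ext : 1; exact TensorProduct.ext_threefold fun a x n =>
      (TensorProduct.smul_tmul' (R := k) (M := X) (N := N)
        (show k from a) x n).symm
  rightUnitor_actionHom X N := by
    ext : 1; exact TensorProduct.ext_threefold fun x a n =>
      (TensorProduct.smul_tmul (R := k) (R' := k) (M := X) (N := N) a x n)

instance : LinearAction k (FinMod k H) (FinMod k S) where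
  right_add X _ _ f g := by
    ext : 1; exact TensorProduct.map_add_right _ _ _
  right_smul X a _ _ f := by
    ext : 1; exact TensorProduct.map_smul_right _ _ _
  left_add f g N := by
    ext : 1; exact TensorProduct.map_add_left _ _ _
  left_smul a _ _ f N := by
    ext : 1; exact TensorProduct.map_smul_left _ _ _

theorem actionHomRight_lin (X : FinMod k H) {N N' : FinMod k S} (g : N ⟶ N') :
    Hom.lin (X ⊴ₗ g) = TensorProduct.map (LinearMap.id (M := X)) (Hom.lin g) := rfl

theorem actionHomLeft_lin {X X' : FinMod k H} (f : X ⟶ X') (N : FinMod k S) :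
    Hom.lin (f ⊵ₗ N) = TensorProduct.map (Hom.lin f) (LinearMap.id (M := N)) := rfl

variable (k S) in
/-- Right multiplication as an endomorphism of the regular module. -/
def rmul [FiniteDimensional k S] (t : S) : regular k S ⟶ regular k S where
  lin := (LinearMap.mul k S).flip t
  comm a v := mul_assoc (G := S) a v t

theorem act_mul (N : FinMod k S) (a b : S) (n : N) :
    N.act (a * b) n = N.act a (N.act b n) := by
  rw [map_mul]; rfl

theorem act_one (N : FinMod k S) (n : N) : N.act 1 n = n := by
  rw [map_one]; rfl

/-- The map `s ↦ s n` from the regular module to `N`. -/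
def ev [FiniteDimensional k S] {N : FinMod k S} (n : N) : regular k S ⟶ N where
  lin := LinearMap.flip N.act.toLinearMap n
  comm a v := act_mul N a v n

theorem mul_eq_pair {A B : Type u} [Ring A] [Algebra k A] [Ring B] [Algebra k B]
    (z w : A ⊗[k] B) :
    z * w = pair (Algebra.lmul k A).toLinearMap (Algebra.lmul k B).toLinearMap z w := by
  induction z with
  | zero => simp
  | add z z' hz hw => simp only [map_add, add_mul, LinearMap.add_apply, hz, hw]
  | tmul a b =>
    induction w with
    | zero => simp
    | add z z' hz hw => simp only [map_add, mul_add, hz, hw]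
    | tmul c d => simp

theorem coact_mul' (a b : S) : coact (k := k) (H := H) (a * b) =
    pair (Algebra.lmul k H).toLinearMap (Algebra.lmul k S).toLinearMap (coact a) (coact b) := by
  rw [map_mul, mul_eq_pair]

theorem comul_mul' (a b : H) : Coalgebra.comul (R := k) (a * b) =
    pair (Algebra.lmul k H).toLinearMap (Algebra.lmul k H).toLinearMap
      (Coalgebra.comul (R := k) a) (Coalgebra.comul (R := k) b) := by
  rw [Bialgebra.comul_mul, mul_eq_pair]

variable (k H S) in
/-- The coaction of `S` as a morphism of `S`-modules `S ⟶ H ⊙ S`. -/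
def coactHom [FiniteDimensional k H] [FiniteDimensional k S] :
    regular k S ⟶ (regular k H) ⊙ₗ (regular k S) where
  lin := (coact (k := k) (H := H) (S := S)).toLinearMap
  comm a v := by
    refine (coact_mul' (H := H) a v).trans ?_
    change _ = (tens coact (regular k H) (regular k S)).act a _
    rw [tens_act]
    rfl

variable (k H) in
/-- The comultiplication as a morphism of `H`-modules. -/
def comulHom [FiniteDimensional k H] : regular k H ⟶ regular k H ⊗ regular k H where
  lin := Coalgebra.comul (R := k) (A := H)
  comm a v := by
    refine (comul_mul' (H := H) a v).trans ?_
    change _ = (tens _ (regular k H) (regular k H)).act a _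
    rw [tens_act]
    rfl

variable (k H) in
/-- The counit as a morphism of `H`-modules. -/
def counitHom [FiniteDimensional k H] : regular k H ⟶ 𝟙_ (FinMod k H) where
  lin := Coalgebra.counit (R := k) (A := H)
  comm a v := Bialgebra.counit_mul (R := k) (A := H) a v

end Action

end FinMod

section Transport

universe v₁ v₂ v₃ u₁ u₂ u₃

variable {C : Type u₁} [Category.{v₁} C] [MonoidalCategory C]
  {D : Type u₂} [Category.{v₂} D] {E : Type u₃} [Category.{v₃} E] [MonoidalLeftAction C E]

/-- If `T : D ⥤ E` is fully faithful, `C` acts on `E` and objects `X ⊙ d` of `D` with isomorphisms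
`θ X d : T (X ⊙ d) ≅ X ⊙ T d` are given, then `C` acts on `D` in such a way that the `θ` are
natural and compatible with the constraints. -/
@[reducible] def transportAction {T : D ⥤ E} (hT : T.FullyFaithful) (obj : C → D → D)
    (θ : ∀ X d, T.obj (obj X d) ≅ X ⊙ₗ T.obj d) : MonoidalLeftAction C D where
  actionObj := obj
  actionHomLeft {X X'} f d := hT.preimage ((θ X d).hom ≫ f ⊵ₗ T.obj d ≫ (θ X' d).inv)
  actionHomRight X {d d'} f := hT.preimage ((θ X d).hom ≫ X ⊴ₗ T.map f ≫ (θ X d').inv)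
  actionAssocIso X Y d := hT.preimageIso (θ (X ⊗ Y) d ≪≫ αₗ X Y (T.obj d) ≪≫
    { hom := X ⊴ₗ (θ Y d).inv, inv := X ⊴ₗ (θ Y d).hom } ≪≫ (θ X (obj Y d)).symm)
  actionUnitIso d := hT.preimageIso (θ (𝟙_ C) d ≪≫ λₗ (T.obj d))
  actionHom_comp f f' g g' := hT.map_injective (by simp [action_exchange_assoc])
  actionAssocIso_hom_naturality f g h := hT.map_injective (by
    simp [action_exchange_assoc, MonoidalCategory.tensorHom_def])
  actionUnitIso_hom_naturality f := hT.map_injective (by simp)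
  whiskerLeft_actionHomLeft X _ _ f d := hT.map_injective (by simp)
  whiskerRight_actionHomLeft Y f d := hT.map_injective (by simp [action_exchange_assoc])
  associator_actionHom X Y Z d := hT.map_injective (by simp)
  leftUnitor_actionHom X d := hT.map_injective (by simp)
  rightUnitor_actionHom X d := hT.map_injective (by simp)
  actionHomRight_id X d := hT.map_injective (by simp)
  id_actionHomLeft X d := hT.map_injective (by simp)

end Transport

/-- Finite-dimensional `(K, S)`-bimodules (over `k`, which acts centrally): left `K`-modules with
a compatible right action of `S`; `right s p` is `p s`. -/
structure Bimod (k K S : Type u) [Field k] [Ring K] [Algebra k K] [Ring S] [Algebra k S] extends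
    FinMod k K where
  /-- the right action of `S` -/
  right : S →ₗ[k] Module.End k carrier
  right_one (p : carrier) : right 1 p = p
  right_mul (s t : S) (p : carrier) : right (s * t) p = right t (right s p)
  act_right (a : K) (s : S) (p : carrier) : act a (right s p) = right s (act a p)

namespace Bimod

section

variable {k K S : Type u} [Field k] [Ring K] [Algebra k K] [Ring S] [Algebra k S]

/-- The relations `p s ⊗ n = p ⊗ s n` defining `P ⊗_S N`. -/
def rel (P : Bimod k K S) (N : FinMod k S) : Submodule k (P.carrier ⊗[k] N) :=
  Submodule.span k {z | ∃ (p : P.carrier) (s : S) (n : N),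
    z = P.right s p ⊗ₜ n - p ⊗ₜ N.act s n}

/-- The vector space `P ⊗_S N`. -/
abbrev Bal (P : Bimod k K S) (N : FinMod k S) : Type u := (P.carrier ⊗[k] N) ⧸ P.rel N

variable (P : Bimod k K S) (N : FinMod k S)

/-- The canonical map to `P ⊗_S N`, sending `p ⊗ n` to its class. -/
def cls : P.carrier →ₗ[k] N →ₗ[k] P.Bal N := (TensorProduct.mk k P.carrier N).compr₂ (P.rel N).mkQ

variable {P N}

theorem cls_right (p : P.carrier) (s : S) (n : N) :
    P.cls N (P.right s p) n = P.cls N p (N.act s n) := by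
  refine (Submodule.Quotient.eq _).2 (Submodule.subset_span ⟨p, s, n, rfl⟩)

/-- Linear maps out of `P ⊗_S N` are given by balanced bilinear maps. -/
def lift {V : Type u} [AddCommGroup V] [Module k V] (f : P.carrier →ₗ[k] N →ₗ[k] V)
    (h : ∀ p s n, f (P.right s p) n = f p (N.act s n)) : P.Bal N →ₗ[k] V :=
  (P.rel N).liftQ (TensorProduct.lift f) (by
    rw [rel, Submodule.span_le]
    rintro _ ⟨p, s, n, rfl⟩
    simp [h])

@[simp] theorem lift_cls {V : Type u} [AddCommGroup V] [Module k V]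
    (f : P.carrier →ₗ[k] N →ₗ[k] V) (h : ∀ p s n, f (P.right s p) n = f p (N.act s n))
    (p : P.carrier) (n : N) : lift f h (P.cls N p n) = f p n := rfl

theorem bal_ext {V : Type u} [AddCommGroup V] [Module k V] {f g : P.Bal N →ₗ[k] V}
    (h : ∀ p n, f (P.cls N p n) = g (P.cls N p n)) : f = g :=
  Submodule.linearMap_qext _ (TensorProduct.ext' h)

theorem bal_induction {motive : P.Bal N → Prop} (q : P.Bal N) (zero : motive 0)
    (add : ∀ x y, motive x → motive y → motive (x + y))
    (cls : ∀ p n, motive (P.cls N p n)) : motive q := by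
  obtain ⟨z, rfl⟩ := Submodule.mkQ_surjective _ q
  induction z with
  | zero => simpa using zero
  | add x y hx hy => rw [map_add]; exact add _ _ hx hy
  | tmul p n => exact cls p n

instance : FiniteDimensional k (P.Bal N) :=
  inferInstanceAs (FiniteDimensional k ((P.carrier ⊗[k] N) ⧸ P.rel N))

variable (P N) in
/-- The left action of `a : K` on `P ⊗_S N`. -/
def balAct (a : K) : P.Bal N →ₗ[k] P.Bal N :=
  lift (P.cls N ∘ₗ P.act a) (fun p s n => by simp [P.act_right, cls_right])

variable (P N) in
/-- The left `K`-module `P ⊗_S N`. -/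
def tensObj : FinMod k K where
  carrier := P.Bal N
  act := AlgHom.ofLinearMap
    { toFun a := P.balAct N a
      map_add' a b := bal_ext fun p n => by simp [balAct]
      map_smul' c a := bal_ext fun p n => by simp [balAct] }
    (bal_ext fun p n => by simp [balAct])
    (fun a b => bal_ext fun p n => by simp [balAct])

@[simp] theorem tensObj_act (a : K) (p : P.carrier) (n : N) :
    (P.tensObj N).act a (P.cls N p n) = P.cls N (P.act a p) n := rfl

variable (P) in
/-- The linear map underlying `P ⊗_S f`. -/
def balMap {N N' : FinMod k S} (f : N ⟶ N') : P.Bal N →ₗ[k] P.Bal N' :=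
  lift ((P.cls N').compl₂ f.lin) (fun p s n => by simp [cls_right, f.comm])

variable (P) in
/-- The morphism `P ⊗_S f`. -/
def tensMap {N N' : FinMod k S} (f : N ⟶ N') : P.tensObj N ⟶ P.tensObj N' where
  lin := P.balMap f
  comm a q := LinearMap.congr_fun (show P.balMap f ∘ₗ P.balAct N a =
    P.balAct N' a ∘ₗ P.balMap f from bal_ext fun p n => rfl) q

@[simp] theorem tensMap_cls {N N' : FinMod k S} (f : N ⟶ N') (p : P.carrier) (n : N) :
    (P.tensMap f).lin (P.cls N p n) = P.cls N' p (f.lin n) := rfl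

variable (P) in
/-- The functor `P ⊗_S -`. -/
@[simps] def functor : FinMod k S ⥤ FinMod k K where
  obj N := P.tensObj N
  map f := P.tensMap f
  map_id N := by ext : 1; exact bal_ext fun p n => rfl
  map_comp f g := by ext : 1; exact bal_ext fun p n => rfl

instance : P.functor.Additive where
  map_add {_ _ f g} := by
    ext : 1; exact bal_ext fun p n => (P.cls _ p).map_add (f.lin n) (g.lin n)

instance : P.functor.Linear k where
  map_smul f a := by
    ext : 1; exact bal_ext fun p n => (P.cls _ p).map_smul a (f.lin n)

end

end Bimod

/-- Finite-dimensional Hopf bimodules in `^H_K M_S`: `(K, S)`-bimodules with a coaction of `H`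
which is a morphism of bimodules, that is `δ(a p s) = a₋₁ p₋₁ s₋₁ ⊗ a₀ p₀ s₀`. -/
structure HopfBimod (k H K S : Type u) [Field k] [Ring H] [Bialgebra k H] [Ring K] [Algebra k K]
    [LeftComoduleAlgebra k H K] [Ring S] [Algebra k S] [LeftComoduleAlgebra k H S] extends
    Bimod k K S where
  /-- the coaction -/
  coact : carrier →ₗ[k] H ⊗[k] carrier
  coassoc : TensorProduct.assoc k H H carrier ∘ₗ
    (Coalgebra.comul (R := k) (A := H)).rTensor carrier ∘ₗ coact = coact.lTensor H ∘ₗ coact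
  counit (p : carrier) : (Coalgebra.counit (R := k) (A := H)).rTensor carrier (coact p) = 1 ⊗ₜ p
  coact_act (a : K) (p : carrier) : coact (act a p) =
    pair (LinearMap.mul k H) act.toLinearMap (LeftComoduleAlgebra.coact a) (coact p)
  coact_right (s : S) (p : carrier) : coact (right s p) =
    pair (LinearMap.mul k H).flip right (LeftComoduleAlgebra.coact s) (coact p)

namespace HopfBimod

section

open LeftComoduleAlgebra

variable {k H K S : Type u} [Field k] [Ring H] [Bialgebra k H] [Ring K] [Algebra k K]
  [LeftComoduleAlgebra k H K] [Ring S] [Algebra k S] [LeftComoduleAlgebra k H S]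

/-- Homomorphisms of Hopf bimodules. -/
@[ext]
structure Hom (P Q : HopfBimod k H K S) where
  /-- the underlying linear map -/
  lin : P.carrier →ₗ[k] Q.carrier
  comm (a : K) (p : P.carrier) : lin (P.act a p) = Q.act a (lin p)
  comm_right (s : S) (p : P.carrier) : lin (P.right s p) = Q.right s (lin p)
  comm_coact (p : P.carrier) : Q.coact (lin p) = lin.lTensor H (P.coact p)

instance : Category (HopfBimod k H K S) where
  Hom := Hom
  id P := ⟨LinearMap.id, fun _ _ => rfl, fun _ _ => rfl, fun _ => by simp⟩
  comp f g := ⟨g.lin ∘ₗ f.lin, fun a v => by simp [f.comm, g.comm],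
    fun a v => by simp [f.comm_right, g.comm_right], fun p => by
      simp [f.comm_coact, g.comm_coact, LinearMap.lTensor_comp]⟩

@[simp] theorem id_lin (P : HopfBimod k H K S) : Hom.lin (𝟙 P) = LinearMap.id := rfl

@[simp] theorem comp_lin {P Q R : HopfBimod k H K S} (f : P ⟶ Q) (g : Q ⟶ R) :
    Hom.lin (f ≫ g) = Hom.lin g ∘ₗ Hom.lin f := rfl

@[ext] theorem hom_ext {P Q : HopfBimod k H K S} {f g : P ⟶ Q} (h : Hom.lin f = Hom.lin g) :
    f = g :=
  Hom.ext h

/-- Homomorphisms of Hopf bimodules as a subspace of the space of linear maps. -/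
def homSubmodule (P Q : HopfBimod k H K S) : Submodule k (P.carrier →ₗ[k] Q.carrier) where
  carrier := {f | (∀ (a : K) (p : P.carrier), f (P.act a p) = Q.act a (f p)) ∧
    (∀ (s : S) (p : P.carrier), f (P.right s p) = Q.right s (f p)) ∧
    ∀ p : P.carrier, Q.coact (f p) = f.lTensor H (P.coact p)}
  add_mem' {f g} hf hg := ⟨fun a v => by simp [hf.1 a v, hg.1 a v],
    fun a v => by simp [hf.2.1 a v, hg.2.1 a v],
    fun v => by simp [hf.2.2 v, hg.2.2 v, LinearMap.lTensor_add]⟩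
  zero_mem' := ⟨fun a v => by simp, fun a v => by simp, fun v => by simp⟩
  smul_mem' c f hf := ⟨fun a v => by simp [hf.1 a v], fun a v => by simp [hf.2.1 a v],
    fun v => by simp [hf.2.2 v, LinearMap.lTensor_smul]⟩

/-- Identification of morphisms with the elements of the subspace. -/
def homEquiv (P Q : HopfBimod k H K S) : (P ⟶ Q) ≃ homSubmodule P Q where
  toFun f := ⟨Hom.lin f, Hom.comm f, Hom.comm_right f, Hom.comm_coact f⟩
  invFun f := ⟨f.1, f.2.1, f.2.2.1, f.2.2.2⟩
  left_inv _ := rfl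
  right_inv _ := rfl

instance (P Q : HopfBimod k H K S) : AddCommGroup (P ⟶ Q) := (homEquiv P Q).addCommGroup

instance (P Q : HopfBimod k H K S) : Module k (P ⟶ Q) := (homEquiv P Q).module k

@[simp] theorem add_lin {P Q : HopfBimod k H K S} (f g : P ⟶ Q) :
    Hom.lin (f + g) = Hom.lin f + Hom.lin g := rfl

@[simp] theorem smul_lin {P Q : HopfBimod k H K S} (a : k) (f : P ⟶ Q) :
    Hom.lin (a • f) = a • Hom.lin f := rfl

instance : Preadditive (HopfBimod k H K S) where
  add_comp _ _ _ _ _ _ := by ext; simp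
  comp_add _ _ _ _ _ _ := by ext; simp

instance : Linear k (HopfBimod k H K S) where
  smul_comp _ _ _ _ _ _ := by ext; simp
  comp_smul _ _ _ _ _ _ := by ext; simp

end

end HopfBimod

section PairLemmas

variable {k A B A' B' A'' B'' X N X' N' X'' N'' : Type u} [Field k]
  [AddCommGroup A] [Module k A] [AddCommGroup B] [Module k B]
  [AddCommGroup A'] [Module k A'] [AddCommGroup B'] [Module k B']
  [AddCommGroup A''] [Module k A''] [AddCommGroup B''] [Module k B'']
  [AddCommGroup X] [Module k X] [AddCommGroup N] [Module k N]
  [AddCommGroup X'] [Module k X'] [AddCommGroup N'] [Module k N']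
  [AddCommGroup X''] [Module k X''] [AddCommGroup N''] [Module k N'']

theorem pair_pair_left {m : A →ₗ[k] A' →ₗ[k] A''} {m' : B →ₗ[k] B' →ₗ[k] B''}
    {f₃ : A'' →ₗ[k] X →ₗ[k] X''} {g₃ : B'' →ₗ[k] N →ₗ[k] N''} {f₂ : A →ₗ[k] X' →ₗ[k] X''}
    {g₂ : B →ₗ[k] N' →ₗ[k] N''} {f₁ : A' →ₗ[k] X →ₗ[k] X'} {g₁ : B' →ₗ[k] N →ₗ[k] N'}
    (hf : ∀ a b x, f₃ (m a b) x = f₂ a (f₁ b x)) (hg : ∀ a b x, g₃ (m' a b) x = g₂ a (g₁ b x))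
    (z : A ⊗[k] B) (w : A' ⊗[k] B') (v : X ⊗[k] N) :
    pair f₃ g₃ (pair m m' z w) v = pair f₂ g₂ z (pair f₁ g₁ w v) := by
  induction z with
  | zero => simp
  | add z z' h h' => simp only [map_add, LinearMap.add_apply, h, h']
  | tmul a s =>
    induction w with
    | zero => simp
    | add w w' h h' => simp only [map_add, LinearMap.add_apply, h, h']
    | tmul b p =>
      induction v with
      | zero => simp
      | add v v' h h' => simp only [map_add, h, h']
      | tmul x n => simp [hf, hg]

theorem pair_pair_right {m : A →ₗ[k] A' →ₗ[k] A''} {m' : B →ₗ[k] B' →ₗ[k] B''}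
    {f₃ : A'' →ₗ[k] X →ₗ[k] X''} {g₃ : B'' →ₗ[k] N →ₗ[k] N''} {f₂ : A' →ₗ[k] X' →ₗ[k] X''}
    {g₂ : B' →ₗ[k] N' →ₗ[k] N''} {f₁ : A →ₗ[k] X →ₗ[k] X'} {g₁ : B →ₗ[k] N →ₗ[k] N'}
    (hf : ∀ a b x, f₃ (m a b) x = f₂ b (f₁ a x)) (hg : ∀ a b x, g₃ (m' a b) x = g₂ b (g₁ a x))
    (z : A ⊗[k] B) (w : A' ⊗[k] B') (v : X ⊗[k] N) :
    pair f₃ g₃ (pair m m' z w) v = pair f₂ g₂ w (pair f₁ g₁ z v) := by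
  induction z with
  | zero => simp
  | add z z' h h' => simp only [map_add, LinearMap.add_apply, h, h']
  | tmul a s =>
    induction w with
    | zero => simp
    | add w w' h h' => simp only [map_add, LinearMap.add_apply, h, h']
    | tmul b p =>
      induction v with
      | zero => simp
      | add v v' h h' => simp only [map_add, h, h']
      | tmul x n => simp [hf, hg]

theorem lTensor_pair {f : A →ₗ[k] X →ₗ[k] X'} {g : B →ₗ[k] N →ₗ[k] N'} {φ : N' →ₗ[k] N''}
    {g' : B →ₗ[k] N →ₗ[k] N''} (h : ∀ b n, φ (g b n) = g' b n) (z : A ⊗[k] B) (v : X ⊗[k] N) :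
    φ.lTensor X' (pair f g z v) = pair f g' z v := by
  induction z with
  | zero => simp
  | add z z' h h' => simp only [map_add, LinearMap.add_apply, h, h']
  | tmul a s =>
    induction v with
    | zero => simp
    | add v v' h h' => simp only [map_add, h, h']
    | tmul x n => simp [h]

theorem pair_assoc_gen {C Y Y' D : Type u} [AddCommGroup C] [Module k C] [AddCommGroup Y]
    [Module k Y] [AddCommGroup Y'] [Module k Y'] [AddCommGroup D] [Module k D]
    (f : A →ₗ[k] X →ₗ[k] X') (g : B →ₗ[k] Y →ₗ[k] Y') (h : C →ₗ[k] N →ₗ[k] N')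
    (d : D →ₗ[k] A ⊗[k] B) (z : D ⊗[k] C) (v : (X ⊗[k] Y) ⊗[k] N) :
    TensorProduct.assoc k X' Y' N' (pair (pair f g ∘ₗ d) h z v) =
      pair f (pair g h) (TensorProduct.assoc k A B C (d.rTensor C z))
        (TensorProduct.assoc k X Y N v) := by
  induction v with
  | zero => simp
  | add v v' h h' => simp only [map_add, h, h']
  | tmul v n =>
    induction v with
    | zero => simp
    | add v v' h h' => simp only [map_add, TensorProduct.add_tmul, h, h']
    | tmul x y => exact pair_assoc _ _ _ _ _ _ _ _

end PairLemmas

theorem FinMod.action_act {k H S : Type u} [Field k] [Ring H] [Bialgebra k H] [Ring S]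
    [Algebra k S] [LeftComoduleAlgebra k H S] (X : FinMod k H) (N : FinMod k S) (s : S) :
    (X ⊙ₗ N).act s = pair X.act.toLinearMap N.act.toLinearMap
      (LeftComoduleAlgebra.coact (H := H) s) :=
  tens_act _ X N s

namespace HopfBimod

section

open LeftComoduleAlgebra
open ModCat.Bimod ModCat.FinMod

variable {k H K S : Type u} [Field k] [Ring H] [Bialgebra k H] [Ring K] [Algebra k K]
  [LeftComoduleAlgebra k H K] [Ring S] [Algebra k S] [LeftComoduleAlgebra k H S]

variable (P : HopfBimod k H K S) (X Y : FinMod k H) (N : FinMod k S)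

/-- The bilinear map `(p, x ⊗ n) ↦ p₋₁ x ⊗ (p₀ ⊗ n)`. -/
def strLin : P.carrier →ₗ[k] X ⊗[k] N →ₗ[k] X ⊗[k] P.Bal N :=
  pair X.act.toLinearMap (P.cls N) ∘ₗ P.coact

theorem strLin_apply (p : P.carrier) :
    P.strLin X N p = pair X.act.toLinearMap (P.cls N) (P.coact p) := rfl

theorem strLin_right (p : P.carrier) (s : S) (v : X ⊗[k] N) :
    P.strLin X N (P.right s p) v = P.strLin X N p ((X ⊙ₗ N).act s v) := by
  rw [strLin_apply, strLin_apply, P.coact_right, FinMod.action_act]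
  exact pair_pair_right (fun a b x => FinMod.act_mul X b a x) (fun s p n => cls_right p s n) _ _ v

theorem strLin_act (a : K) (p : P.carrier) (v : X ⊗[k] N) :
    P.strLin X N (P.act a p) v = (X ⊙ₗ P.tensObj N).act a (P.strLin X N p v) := by
  rw [strLin_apply, strLin_apply, P.coact_act, FinMod.action_act]
  exact pair_pair_left (fun a b x => FinMod.act_mul X a b x) (fun a p n => rfl) _ _ v

/-- The morphism `P ⊗_S (X ⊙ N) ⟶ X ⊙ (P ⊗_S N)`, `p ⊗ (x ⊗ n) ↦ p₋₁ x ⊗ (p₀ ⊗ n)`. -/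
def str : P.tensObj (X ⊙ₗ N) ⟶ X ⊙ₗ P.tensObj N where
  lin := lift (N := X ⊙ₗ N) (P.strLin X N) (fun p s v => P.strLin_right X N p s v)
  comm a q := LinearMap.congr_fun (show
    lift (N := X ⊙ₗ N) (P.strLin X N) (fun p s v => P.strLin_right X N p s v) ∘ₗ
      P.balAct (X ⊙ₗ N) a = (X ⊙ₗ P.tensObj N).act a ∘ₗ
    lift (N := X ⊙ₗ N) (P.strLin X N) (fun p s v => P.strLin_right X N p s v)
    from bal_ext fun p v => P.strLin_act X N a p v) q

theorem str_cls (p : P.carrier) (v : X ⊗[k] N) :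
    (P.str X N).lin (P.cls (X ⊙ₗ N) p v) = pair X.act.toLinearMap (P.cls N) (P.coact p) v := rfl

theorem str_natural_aux {X X' : FinMod k H} {N N' : FinMod k S} (f : X ⟶ X') (g : N ⟶ N')
    (w : H ⊗[k] P.carrier) (v : X ⊗[k] N) :
    pair X'.act.toLinearMap (P.cls N') w (TensorProduct.map f.lin g.lin v) =
      TensorProduct.map f.lin (P.balMap g) (pair X.act.toLinearMap (P.cls N) w v) := by
  induction w with
  | zero => simp
  | add w w' h h' => simp only [map_add, LinearMap.add_apply, h, h']
  | tmul b p =>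
    induction v with
    | zero => simp
    | add v v' h h' => simp only [map_add, h, h']
    | tmul x n => simp [f.comm, balMap]

theorem str_assoc_aux (w : H ⊗[k] P.carrier) (v : X ⊗[k] (Y ⊗[k] N)) :
    (lift (N := Y ⊙ₗ N) (P.strLin Y N) (fun p s v => P.strLin_right Y N p s v)).lTensor X
      (pair X.act.toLinearMap (P.cls (Y ⊙ₗ N)) w v) =
    pair X.act.toLinearMap (P.strLin Y N) w v :=
  lTensor_pair (fun p v => rfl) w v

theorem str_assoc_aux₂ (p : P.carrier) (v : (X ⊗[k] Y) ⊗[k] N) :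
    TensorProduct.assoc k X Y (P.Bal N)
      (pair (tens (Bialgebra.comulAlgHom k H) X Y).act.toLinearMap (P.cls N) (P.coact p) v) =
      (lift (N := Y ⊙ₗ N) (P.strLin Y N) (fun p s v => P.strLin_right Y N p s v)).lTensor X
        (pair X.act.toLinearMap (P.cls (Y ⊙ₗ N)) (P.coact p) (TensorProduct.assoc k X Y N v)) := by
  refine Eq.trans ?_ (P.str_assoc_aux X Y N (P.coact p) _).symm
  rw [tens_act']
  have h1 := pair_nested X.act.toLinearMap (pair Y.act.toLinearMap (P.cls N)) P.coact (P.coact p)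
  have h2 := pair_assoc_gen X.act.toLinearMap Y.act.toLinearMap (P.cls N)
    (Coalgebra.comul (R := k) (A := H)) (P.coact p) v
  have h3 := LinearMap.congr_fun P.coassoc p
  simp only [LinearMap.comp_apply, LinearEquiv.coe_coe] at h3
  rw [h3, ← h1] at h2
  exact h2

theorem str_unit_aux (w : H ⊗[k] P.carrier) (n : N) :
    pair (A := H) ((Algebra.lmul k k).comp (Bialgebra.counitAlgHom k H)).toLinearMap
      (P.cls N) w (1 ⊗ₜ[k] n) = LinearMap.lTensor k (LinearMap.flip (P.cls N) n)
        ((Coalgebra.counit (R := k) (A := H)).rTensor P.carrier w) := by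
  induction w with
  | zero => simp
  | add w w' h h' => simp only [map_add, LinearMap.add_apply, h, h']
  | tmul b p => simp

/-- The oplax module structure of the functor `P ⊗_S -`. -/
@[simps] instance oplax : P.functor.OplaxLeftLinear (FinMod k H) where
  δₗ X N := P.str X N
  δₗ_naturality_left {X X'} f N := by
    ext : 1
    refine bal_ext (N := X ⊙ₗ N) fun p v => ?_
    refine (P.str_natural_aux f (𝟙 N) (P.coact p) v).trans ?_
    have h : P.balMap (𝟙 N) = LinearMap.id := bal_ext fun p n => rfl
    rw [h]
    rfl
  δₗ_naturality_right X N N' g := by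
    ext : 1
    refine bal_ext (N := X ⊙ₗ N) fun p v => ?_
    exact P.str_natural_aux (𝟙 X) g (P.coact p) v
  δₗ_associativity X Y N := by
    ext : 1
    exact bal_ext fun p v => P.str_assoc_aux₂ X Y N p v
  δₗ_unitality_inv N := by
    ext : 1
    refine bal_ext fun p n => ?_
    refine Eq.trans ?_ (P.str_unit_aux N (P.coact p) n).symm
    rw [P.counit]
    rfl

end

end HopfBimod

namespace FinMod

open LeftComoduleAlgebra

variable {k H S : Type u} [Field k] [Ring H] [Bialgebra k H] [Ring S] [Algebra k S]
  [LeftComoduleAlgebra k H S] [FiniteDimensional k H] [FiniteDimensional k S]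

theorem rmul_add (s t : S) : rmul k S (s + t) = rmul k S s + rmul k S t := by
  ext : 1; exact LinearMap.ext fun v => mul_add (R := S) v s t

theorem rmul_smul (c : k) (s : S) : rmul k S (c • s) = c • rmul k S s := by
  ext : 1; exact LinearMap.ext fun v => mul_smul_comm (α := k) (β := S) c v s

theorem rmul_one : rmul k S 1 = 𝟙 (regular k S) := by
  ext : 1; exact LinearMap.ext fun v => mul_one (M := S) v

theorem rmul_mul (s t : S) : rmul k S (s * t) = rmul k S s ≫ rmul k S t := by
  ext : 1; exact LinearMap.ext fun v => (mul_assoc (G := S) v s t).symm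

theorem ev_add {N : FinMod k S} (n n' : N) : ev (n + n') = ev n + ev n' := by
  ext : 1; exact LinearMap.ext fun v => (N.act v).map_add n n'

theorem ev_smul {N : FinMod k S} (c : k) (n : N) : ev (c • n) = c • ev n := by
  ext : 1; exact LinearMap.ext fun v => (N.act v).map_smul c n

theorem ev_zero {N : FinMod k S} : ev (0 : N) = 0 := by
  ext : 1; exact LinearMap.ext fun v => (N.act v).map_zero

theorem ev_one : ev (N := regular k S) (1 : S) = 𝟙 (regular k S) := by
  ext : 1; exact LinearMap.ext fun v => mul_one (M := S) v

theorem ev_act {N : FinMod k S} (s : S) (n : N) : ev (N.act s n) = rmul k S s ≫ ev n := by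
  ext : 1; exact LinearMap.ext fun v => (act_mul N v s n).symm

theorem ev_comp {N N' : FinMod k S} (n : N) (f : N ⟶ N') : ev n ≫ f = ev (f.lin n) := by
  ext : 1; exact LinearMap.ext fun v => f.comm v n

theorem ev_tmul (X : FinMod k H) (N : FinMod k S) (x : X) (n : N) :
    ev (N := X ⊙ₗ N) (x ⊗ₜ[k] n) = coactHom k H S ≫ ev x ⊵ₗ regular k S ≫ X ⊴ₗ ev n := by
  ext : 1
  refine LinearMap.ext fun s => ?_
  refine (LinearMap.congr_fun (action_act X N s) (x ⊗ₜ[k] n)).trans ?_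
  have h (z : H ⊗[k] S) : pair X.act.toLinearMap N.act.toLinearMap z (x ⊗ₜ n) =
      TensorProduct.map (LinearMap.id (M := X)) (LinearMap.flip N.act.toLinearMap n)
        (TensorProduct.map (LinearMap.flip X.act.toLinearMap x) (LinearMap.id (M := S)) z) := by
    induction z with
    | zero => simp
    | add z z' h h' => simp only [map_add, LinearMap.add_apply, h, h']
    | tmul a b => simp
  exact h _

theorem coactHom_assoc : coactHom k H S ≫ comulHom k H ⊵ₗ regular k S ≫
    (αₗ (regular k H) (regular k H) (regular k S)).hom =
      coactHom k H S ≫ regular k H ⊴ₗ coactHom k H S := by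
  ext : 1
  exact LeftComoduleAlgebra.coassoc (k := k) (H := H) (S := S)

theorem coactHom_counit : coactHom k H S ≫ counitHom k H ⊵ₗ regular k S =
    (λₗ[FinMod k H] (regular k S)).inv := by
  ext : 1
  exact LinearMap.ext fun s => LeftComoduleAlgebra.counit (k := k) (H := H) (S := S) s

theorem mul_eq_pair_flip {A B : Type u} [Ring A] [Algebra k A] [Ring B] [Algebra k B]
    (w z : A ⊗[k] B) :
    w * z = pair (LinearMap.mul k A).flip (LinearMap.mul k B).flip z w := by
  induction z with
  | zero => simp
  | add z z' h h' => simp only [map_add, mul_add, LinearMap.add_apply, h, h']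
  | tmul a b =>
    induction w with
    | zero => simp
    | add z z' h h' => simp only [map_add, add_mul, h, h']
    | tmul c d => simp

theorem pair_mul_one (X : FinMod k H) (x : X) (z : H ⊗[k] S) :
    pair X.act.toLinearMap (Algebra.lmul k S).toLinearMap z (x ⊗ₜ[k] (1 : S)) =
      LinearMap.rTensor S (LinearMap.flip X.act.toLinearMap x) z := by
  induction z with
  | zero => simp
  | add z z' h h' => simp only [map_add, LinearMap.add_apply, h, h']
  | tmul a b => simp

theorem map_split {X X' N N' : Type u} [AddCommGroup X] [Module k X] [AddCommGroup X']
    [Module k X'] [AddCommGroup N] [Module k N] [AddCommGroup N'] [Module k N']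
    (f : X →ₗ[k] X') (g : N →ₗ[k] N') (w : X ⊗[k] N) :
    TensorProduct.map LinearMap.id g (TensorProduct.map f LinearMap.id w) =
      TensorProduct.map f g w := by
  rw [← LinearMap.comp_apply, ← TensorProduct.map_comp]
  rfl

/-- Elements of `H ⊗ S` act on `H ⊙ S` by right multiplication. -/
theorem rmul_pair {K : Type u} [Ring K] [Algebra k K] [LeftComoduleAlgebra k H K]
    (F : OplaxModuleFunctor k (FinMod k H) (FinMod k S) (FinMod k K))
    (r : S →ₗ[k] Module.End k (F.functor.obj (regular k S)))
    (hr : ∀ s, r s = (F.functor.map (rmul k S s)).lin) (z : H ⊗[k] S) :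
    ∃ φ : regular k H ⊙ₗ regular k S ⟶ regular k H ⊙ₗ regular k S,
      (∀ w : H ⊗[k] S, φ.lin w = pair (LinearMap.mul k H).flip (LinearMap.mul k S).flip z w) ∧
      ∀ v, (F.str (regular k H) (regular k S)).lin ((F.functor.map φ).lin v) =
        pair (LinearMap.mul k H).flip r z ((F.str (regular k H) (regular k S)).lin v) := by
  induction z with
  | zero =>
    refine ⟨0, fun w => by rw [map_zero]; rfl, fun v => ?_⟩
    rw [Functor.map_zero, map_zero]
    exact map_zero (F.str (regular k H) (regular k S)).lin
  | add z z' h h' =>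
    obtain ⟨φ, h1, h2⟩ := h
    obtain ⟨φ', h1', h2'⟩ := h'
    refine ⟨φ + φ', fun w => ?_, fun v => ?_⟩
    · rw [map_add]
      exact congrArg₂ (· + ·) (h1 w) (h1' w)
    · rw [Functor.map_add, map_add]
      exact (map_add (F.str (regular k H) (regular k S)).lin _ _).trans
        (congrArg₂ (· + ·) (h2 v) (h2' v))
  | tmul a s =>
    refine ⟨rmul k H a ⊵ₗ regular k S ≫ regular k H ⊴ₗ rmul k S s, fun w => ?_, fun v => ?_⟩
    · rw [pair_tmul, comp_lin, actionHomRight_lin, actionHomLeft_lin]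
      exact map_split ((LinearMap.mul k H).flip a) ((LinearMap.mul k S).flip s) w
    · have h1 := Functor.OplaxLeftLinear.δₗ_naturality_left F.functor (rmul k H a) (regular k S)
      have h2 := Functor.OplaxLeftLinear.δₗ_naturality_right F.functor (regular k H) (rmul k S s)
      have h3 : F.functor.map (rmul k H a ⊵ₗ regular k S ≫ regular k H ⊴ₗ rmul k S s) ≫
          F.str (regular k H) (regular k S) = F.str (regular k H) (regular k S) ≫
          rmul k H a ⊵ₗ F.functor.obj (regular k S) ≫
            regular k H ⊴ₗ F.functor.map (rmul k S s) := by
        rw [Functor.map_comp, Category.assoc, h2, reassoc_of% h1]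
      refine (LinearMap.congr_fun (congrArg FinMod.Hom.lin h3) v).trans ?_
      rw [pair_tmul, hr, comp_lin, comp_lin, actionHomRight_lin, actionHomLeft_lin]
      exact map_split ((LinearMap.mul k H).flip a) ((F.functor.map (rmul k S s)).lin) _

end FinMod

namespace HopfBimod

section

open LeftComoduleAlgebra
open ModCat.Bimod ModCat.FinMod
open Functor.OplaxLeftLinear

variable {k H K S : Type u} [Field k] [Ring H] [Bialgebra k H] [Ring K] [Algebra k K]
  [LeftComoduleAlgebra k H K] [Ring S] [Algebra k S] [LeftComoduleAlgebra k H S]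
  [FiniteDimensional k H] [FiniteDimensional k S]

section OfFunctor

variable (F : OplaxModuleFunctor k (FinMod k H) (FinMod k S) (FinMod k K))

/-- The bimodule `F(S)`. -/
def bimodOf : Bimod k K S where
  toFinMod := F.functor.obj (regular k S)
  right :=
    { toFun s := (F.functor.map (rmul k S s)).lin
      map_add' s t := by rw [rmul_add, Functor.map_add]; rfl
      map_smul' c s := by rw [rmul_smul, Functor.map_smul]; rfl }
  right_one p := by
    change (F.functor.map (rmul k S 1)).lin p = p
    rw [rmul_one, CategoryTheory.Functor.map_id]; rfl
  right_mul s t p := by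
    change (F.functor.map (rmul k S (s * t))).lin p = _
    rw [rmul_mul, Functor.map_comp]; rfl
  act_right a s p := ((F.functor.map (rmul k S s)).comm a p).symm

/-- The coaction `F(S) ⟶ F(H ⊙ S) ⟶ H ⊙ F(S)`. -/
def coactOf : F.functor.obj (regular k S) ⟶ regular k H ⊙ₗ F.functor.obj (regular k S) :=
  F.functor.map (coactHom k H S) ≫ F.str (regular k H) (regular k S)

theorem coactOf_assoc : coactOf F ≫ comulHom k H ⊵ₗ F.functor.obj (regular k S) ≫
    (αₗ (regular k H) (regular k H) (F.functor.obj (regular k S))).hom =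
      coactOf F ≫ regular k H ⊴ₗ coactOf F := by
  have h1 := δₗ_naturality_left F.functor (comulHom k H) (regular k S)
  have h2 := δₗ_associativity F.functor (regular k H) (regular k H) (regular k S)
  have h3 := δₗ_naturality_right F.functor (regular k H) (coactHom k H S)
  have h4 := congrArg F.functor.map (coactHom_assoc (k := k) (H := H) (S := S))
  simp only [Functor.map_comp] at h4
  rw [coactOf, actionHomRight_comp, Category.assoc, Category.assoc, ← reassoc_of% h1, h2,
    reassoc_of% h4, reassoc_of% h3]

theorem coactOf_counit : coactOf F ≫ counitHom k H ⊵ₗ F.functor.obj (regular k S) =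
    (λₗ[FinMod k H] (F.functor.obj (regular k S))).inv := by
  have h1 := δₗ_naturality_left F.functor (counitHom k H) (regular k S)
  have h2 := δₗ_unitality_inv (C := FinMod k H) F.functor (regular k S)
  have h4 := congrArg F.functor.map (coactHom_counit (k := k) (H := H) (S := S))
  simp only [Functor.map_comp] at h4
  rw [coactOf, Category.assoc, ← h1, reassoc_of% h4, h2]

/-- The Hopf bimodule `F(S)` of an oplax module functor `F : _S M ⥤ _K M`: `S` acts on the right
through right multiplications on `S`, and the coaction is `F(S) ⟶ F(H ⊙ S) ⟶ H ⊙ F(S)`. -/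
def ofFunctor : HopfBimod k H K S where
  toBimod := bimodOf F
  coact := (coactOf F).lin
  coassoc := congrArg FinMod.Hom.lin (coactOf_assoc F)
  counit p := LinearMap.congr_fun (congrArg FinMod.Hom.lin (coactOf_counit F)) p
  coact_act a p := by
    refine ((coactOf F).comm a p).trans ?_
    rw [action_act]
    rfl
  coact_right s p := by
    obtain ⟨φ, h1, h2⟩ := rmul_pair F (bimodOf F).right (fun _ => rfl)
      (LeftComoduleAlgebra.coact (k := k) (H := H) s)
    have h3 : rmul k S s ≫ coactHom k H S = coactHom k H S ≫ φ := by
      ext : 1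
      refine LinearMap.ext fun v => ?_
      refine Eq.trans ?_ (h1 (LeftComoduleAlgebra.coact (k := k) (H := H) v)).symm
      refine (map_mul (LeftComoduleAlgebra.coact (k := k) (H := H) (S := S)) (show S from v)
        s).trans ?_
      exact mul_eq_pair_flip _ _
    have h4 := congrArg F.functor.map h3
    simp only [Functor.map_comp] at h4
    refine Eq.trans ?_ (h2 ((F.functor.map (coactHom k H S)).lin p))
    exact congrArg (F.str (regular k H) (regular k S)).lin
      (LinearMap.congr_fun (congrArg FinMod.Hom.lin h4) p)

/-- The bilinear map `(q, n) ↦ F(s ↦ s n) q`. -/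
def evalLin (N : FinMod k S) : F.functor.obj (regular k S) →ₗ[k] N →ₗ[k] F.functor.obj N :=
  LinearMap.flip
    { toFun n := (F.functor.map (ev n)).lin
      map_add' n n' := by rw [ev_add, Functor.map_add]; rfl
      map_smul' c n := by rw [ev_smul, Functor.map_smul]; rfl }

theorem evalLin_apply (N : FinMod k S) (q : F.functor.obj (regular k S)) (n : N) :
    evalLin F N q n = (F.functor.map (ev n)).lin q := rfl

/-- The linear map `F(S) ⊗_S N ⟶ F(N)`, `q ⊗ n ↦ F(s ↦ s n) q`. -/
def evalBal (N : FinMod k S) : (ofFunctor F).Bal N →ₗ[k] F.functor.obj N :=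
  lift (P := (ofFunctor F).toBimod) (evalLin F N) (fun q s n => by
    have h := congrArg FinMod.Hom.lin (congrArg F.functor.map (ev_act s n))
    rw [Functor.map_comp] at h
    exact (LinearMap.congr_fun h q).symm)

theorem evalBal_cls (N : FinMod k S) (q : F.functor.obj (regular k S)) (n : N) :
    evalBal F N ((ofFunctor F).cls N q n) = (F.functor.map (ev n)).lin q := rfl

/-- The morphism of modules `F(S) ⊗_S N ⟶ F(N)`, `q ⊗ n ↦ F(s ↦ s n) q`. -/
def evalHom (N : FinMod k S) : (ofFunctor F).tensObj N ⟶ F.functor.obj N where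
  lin := evalBal F N
  comm a q := LinearMap.congr_fun (show evalBal F N ∘ₗ (ofFunctor F).balAct N a =
    (F.functor.obj N).act a ∘ₗ evalBal F N from
    bal_ext fun q n => (F.functor.map (ev n)).comm a q) q

theorem evalHom_natural {N N' : FinMod k S} (f : N ⟶ N') :
    (ofFunctor F).tensMap f ≫ evalHom F N' = evalHom F N ≫ F.functor.map f := by
  ext : 1
  refine bal_ext (P := (ofFunctor F).toBimod) fun q n => ?_
  change (F.functor.map (ev (f.lin n))).lin q = (F.functor.map f).lin ((F.functor.map (ev n)).lin q)
  rw [← ev_comp, Functor.map_comp]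
  rfl

theorem evalHom_str_aux₁ (X : FinMod k H) (N : FinMod k S) (x : X) (n : N) :
    F.functor.map (ev (N := X ⊙ₗ N) (x ⊗ₜ[k] n)) ≫ F.str X N =
      coactOf F ≫ ev x ⊵ₗ F.functor.obj (regular k S) ≫ X ⊴ₗ F.functor.map (ev n) := by
  have h1 := δₗ_naturality_left F.functor (ev x) (regular k S)
  have h2 := δₗ_naturality_right F.functor X (ev n)
  rw [ev_tmul, Functor.map_comp, Functor.map_comp, Category.assoc, Category.assoc, h2,
    reassoc_of% h1, coactOf, Category.assoc]

theorem evalHom_str_aux₂ (X : FinMod k H) (N : FinMod k S)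
    (z : H ⊗[k] F.functor.obj (regular k S)) (x : X) (n : N) :
    pair X.act.toLinearMap (evalLin F N) z (x ⊗ₜ n) =
      TensorProduct.map LinearMap.id (F.functor.map (ev n)).lin
        (TensorProduct.map (LinearMap.flip X.act.toLinearMap x) LinearMap.id z) := by
  induction z with
  | zero => simp
  | add z z' h h' => simp only [map_add, LinearMap.add_apply, h, h']
  | tmul a b => simp [evalLin_apply]

theorem evalHom_str_aux₃ (X : FinMod k H) (N : FinMod k S) (q : F.functor.obj (regular k S))
    (v : X ⊗[k] N) :
    (F.str X N).lin ((F.functor.map (ev (N := X ⊙ₗ N) v)).lin q) =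
      pair X.act.toLinearMap (evalLin F N) ((coactOf F).lin q) v := by
  induction v with
  | zero =>
    have h : ev (N := X ⊙ₗ N) (0 : X ⊗[k] N) = 0 := ev_zero (N := X ⊙ₗ N)
    rw [h, Functor.map_zero, map_zero]
    exact map_zero (F.str X N).lin
  | add v v' h h' =>
    have h1 : ev (N := X ⊙ₗ N) (v + v' : X ⊗[k] N) = ev (N := X ⊙ₗ N) v + ev (N := X ⊙ₗ N) v' :=
      ev_add (N := X ⊙ₗ N) v v'
    rw [h1, Functor.map_add, map_add, ← h, ← h']
    exact map_add (F.str X N).lin _ _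
  | tmul x n =>
    refine (LinearMap.congr_fun (congrArg FinMod.Hom.lin (evalHom_str_aux₁ F X N x n)) q).trans ?_
    exact (evalHom_str_aux₂ F X N _ x n).symm

theorem evalHom_str (X : FinMod k H) (N : FinMod k S) :
    evalHom F (X ⊙ₗ N) ≫ F.str X N = (ofFunctor F).str X N ≫ X ⊴ₗ evalHom F N := by
  ext : 1
  refine bal_ext (P := (ofFunctor F).toBimod) fun q v => ?_
  refine (evalHom_str_aux₃ F X N q v).trans ?_
  exact (lTensor_pair (f := X.act.toLinearMap) (g := (ofFunctor F).cls N) (φ := evalBal F N)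
    (fun _ _ => rfl) ((coactOf F).lin q) v).symm

end OfFunctor

/-- The oplax module functor `P ⊗_S -`. -/
def toOplax (P : HopfBimod k H K S) :
    OplaxModuleFunctor k (FinMod k H) (FinMod k S) (FinMod k K) where
  functor := P.functor

/-- The linear map `f ⊗_S N`. -/
def mapBal {P Q : HopfBimod k H K S} (f : P ⟶ Q) (N : FinMod k S) : P.Bal N →ₗ[k] Q.Bal N :=
  lift (Q.cls N ∘ₗ f.lin) (fun p s n => by
    simp only [LinearMap.comp_apply, f.comm_right, cls_right])

/-- The morphism of modules `f ⊗_S N`. -/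
def mapHom {P Q : HopfBimod k H K S} (f : P ⟶ Q) (N : FinMod k S) : P.tensObj N ⟶ Q.tensObj N where
  lin := mapBal f N
  comm a q := LinearMap.congr_fun (show mapBal f N ∘ₗ P.balAct N a = Q.balAct N a ∘ₗ mapBal f N
    from bal_ext fun p n => congrArg (fun q => Q.cls N q n) (f.comm a p)) q

theorem mapHom_str_aux {P Q : HopfBimod k H K S} (f : P ⟶ Q) (X : FinMod k H) (N : FinMod k S)
    (p : P.carrier) (v : X ⊗[k] N) :
    pair X.act.toLinearMap (Q.cls N) (Q.coact (f.lin p)) v =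
      (mapBal f N).lTensor X (pair X.act.toLinearMap (P.cls N) (P.coact p) v) := by
  rw [lTensor_pair (g' := Q.cls N ∘ₗ f.lin) (fun _ _ => rfl), f.comm_coact, pair_nested]

theorem mapHom_str {P Q : HopfBimod k H K S} (f : P ⟶ Q) (X : FinMod k H) (N : FinMod k S) :
    mapHom f (X ⊙ₗ N) ≫ Q.str X N = P.str X N ≫ X ⊴ₗ mapHom f N := by
  ext : 1
  exact bal_ext fun p v => mapHom_str_aux f X N p v

variable (k H K S) in
/-- The functor sending `P` to the oplax module functor `P ⊗_S -`. -/
def toOplaxFunctor : HopfBimod k H K S ⥤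
    OplaxModuleFunctor k (FinMod k H) (FinMod k S) (FinMod k K) where
  obj P := P.toOplax
  map {P Q} f :=
    { nat :=
        { app N := mapHom f N
          naturality N N' g := by ext : 1; exact bal_ext fun p n => rfl }
      comm X N := mapHom_str f X N }
  map_id P := by
    ext N : 2
    exact bal_ext fun p n => rfl
  map_comp f g := by
    ext N : 2
    exact bal_ext fun p n => rfl

instance : (toOplaxFunctor k H K S).Additive where
  map_add {_ Q f g} := by
    ext N : 2
    exact bal_ext fun p n => LinearMap.congr_fun ((Q.cls N).map_add (f.lin p) (g.lin p)) n

instance : (toOplaxFunctor k H K S).Linear k where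
  map_smul {_ Q} f c := by
    ext N : 2
    exact bal_ext fun p n => LinearMap.congr_fun ((Q.cls N).map_smul c (f.lin p)) n

section FullyFaithful

/-- The map `P ⊗_S S ⟶ P`, `p ⊗ s ↦ p s`. -/
def unitBal (P : HopfBimod k H K S) : P.Bal (regular k S) →ₗ[k] P.carrier :=
  lift (N := regular k S) (LinearMap.flip P.right) (fun p s t => (P.right_mul s t p).symm)

theorem unitBal_cls (P : HopfBimod k H K S) (p : P.carrier) (s : S) :
    P.unitBal (P.cls (regular k S) p s) = P.right s p := rfl

/-- The map `P ⟶ P ⊗_S S`, `p ↦ p ⊗ 1`. -/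
def unitInv (P : HopfBimod k H K S) : P.carrier →ₗ[k] P.Bal (regular k S) :=
  LinearMap.flip (P.cls (regular k S)) (1 : S)

theorem unitBal_act (P : HopfBimod k H K S) (a : K) (y : P.Bal (regular k S)) :
    P.unitBal (P.balAct (regular k S) a y) = P.act a (P.unitBal y) :=
  LinearMap.congr_fun (f := P.unitBal ∘ₗ P.balAct (regular k S) a) (g := P.act a ∘ₗ P.unitBal)
    (bal_ext fun p (s : S) => (P.act_right a s p).symm) y

theorem unitBal_right (P : HopfBimod k H K S) (s : S) (y : P.Bal (regular k S)) :
    P.unitBal (P.balMap (rmul k S s) y) = P.right s (P.unitBal y) :=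
  LinearMap.congr_fun (f := P.unitBal ∘ₗ P.balMap (rmul k S s)) (g := P.right s ∘ₗ P.unitBal)
    (bal_ext fun p (t : S) => P.right_mul t s p) y

theorem unitBal_ev (P : HopfBimod k H K S) {N : FinMod k S} (n : N) (y : P.Bal (regular k S)) :
    P.cls N (P.unitBal y) n = P.balMap (ev n) y :=
  LinearMap.congr_fun (f := LinearMap.flip (P.cls N) n ∘ₗ P.unitBal) (g := P.balMap (ev n))
    (bal_ext fun p (s : S) => cls_right p s n) y

/-- The map `P × S ⟶ P ⊗_S S`. -/
def clsReg (P : HopfBimod k H K S) : P.carrier →ₗ[k] S →ₗ[k] P.Bal (regular k S) :=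
  P.cls (regular k S)

theorem unitBal_coact_aux (P : HopfBimod k H K S) (w : H ⊗[k] P.carrier) (z : H ⊗[k] S) :
    P.unitBal.lTensor H (pair (LinearMap.mul k H) P.clsReg w z) =
      pair (LinearMap.mul k H).flip P.right z w := by
  induction z with
  | zero => simp
  | add z z' h h' => simp only [map_add, LinearMap.add_apply, h, h']
  | tmul a s =>
    induction w with
    | zero => simp
    | add w w' h h' => simp only [map_add, LinearMap.add_apply, h, h']
    | tmul b p => rfl

theorem unitBal_coact (P : HopfBimod k H K S) (y : P.Bal (regular k S)) :
    P.coact (P.unitBal y) = P.unitBal.lTensor H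
      ((P.str (regular k H) (regular k S)).lin (P.balMap (coactHom k H S) y)) :=
  LinearMap.congr_fun (f := P.coact ∘ₗ P.unitBal) (g := P.unitBal.lTensor H ∘ₗ
      (P.str (regular k H) (regular k S)).lin ∘ₗ P.balMap (coactHom k H S))
    (bal_ext fun p (s : S) => (P.coact_right s p).trans (P.unitBal_coact_aux _ _).symm) y

theorem unitInv_coact_aux (P : HopfBimod k H K S) (w : H ⊗[k] P.carrier) :
    pair (LinearMap.mul k H) P.clsReg w (1 ⊗ₜ[k] (1 : S)) =
      P.unitInv.lTensor H w := by
  induction w with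
  | zero => simp
  | add w w' h h' => simp only [map_add, LinearMap.add_apply, h, h']
  | tmul b p =>
    refine (TensorProduct.map_tmul _ _ _ _).trans ?_
    rw [LinearMap.mul_apply', mul_one]
    rfl

theorem unitInv_coact (P : HopfBimod k H K S) (p : P.carrier) :
    (P.str (regular k H) (regular k S)).lin (P.balMap (coactHom k H S) (P.unitInv p)) =
      P.unitInv.lTensor H (P.coact p) := by
  refine Eq.trans ?_ (P.unitInv_coact_aux (P.coact p))
  have h : LeftComoduleAlgebra.coact (k := k) (H := H) (1 : S) = 1 ⊗ₜ[k] (1 : S) := by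
    rw [map_one, Algebra.TensorProduct.one_def]
  exact congrArg (pair (LinearMap.mul k H) P.clsReg (P.coact p)) h

/-- The linear map `P ⊗_S S ⟶ Q ⊗_S S` given by a morphism of functors. -/
def natBal {P Q : HopfBimod k H K S} (t : P.toOplax ⟶ Q.toOplax) :
    P.Bal (regular k S) →ₗ[k] Q.Bal (regular k S) := (t.nat.app (regular k S)).lin

variable (k H K S) in
/-- Every morphism `P ⊗_S - ⟶ Q ⊗_S -` of oplax module functors comes from a unique
homomorphism of Hopf bimodules. -/
def fullyFaithful : (toOplaxFunctor k H K S).FullyFaithful where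
  preimage {P Q} t :=
    { lin := Q.unitBal ∘ₗ natBal t ∘ₗ P.unitInv
      comm a p := by
        refine Eq.trans ?_ (Q.unitBal_act a _)
        exact congrArg Q.unitBal ((t.nat.app (regular k S)).comm a (P.unitInv p))
      comm_right s p := by
        refine Eq.trans ?_ (Q.unitBal_right s _)
        refine congrArg Q.unitBal (Eq.trans ?_ (LinearMap.congr_fun (congrArg FinMod.Hom.lin
          (t.nat.naturality (rmul k S s))) (P.unitInv p)))
        refine congrArg (t.nat.app (regular k S)).lin ?_
        refine (cls_right p s (N := regular k S) (1 : S)).trans ?_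
        exact congrArg (P.cls (regular k S) p) ((mul_one s).trans (one_mul s).symm)
      comm_coact p := by
        have h := congrArg FinMod.Hom.lin (t.comm (regular k H) (regular k S))
        have h1 := LinearMap.congr_fun (congrArg FinMod.Hom.lin
          (t.nat.naturality (coactHom k H S))) (P.unitInv p)
        refine (Q.unitBal_coact _).trans ?_
        rw [LinearMap.lTensor_comp, LinearMap.lTensor_comp]
        refine congrArg (Q.unitBal.lTensor H) ?_
        refine (congrArg (Q.str (regular k H) (regular k S)).lin h1.symm).trans ?_
        refine (LinearMap.congr_fun h _).trans ?_
        exact congrArg ((natBal t).lTensor H) (P.unitInv_coact p) }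
  map_preimage {P Q} t := by
    ext N : 2
    refine bal_ext fun p n => ?_
    refine (Q.unitBal_ev n _).trans ?_
    refine (LinearMap.congr_fun (congrArg FinMod.Hom.lin
      (t.nat.naturality (ev n))) (P.unitInv p)).symm.trans ?_
    refine congrArg (t.nat.app N).lin ?_
    exact congrArg (P.cls N p) (act_one N n)
  preimage_map {P Q} f := by
    ext p
    exact Q.right_one (f.lin p)

end FullyFaithful

end

end HopfBimod

namespace HopfBimod

section Action

open ModCat.Bimod ModCat.FinMod

variable {k H K S : Type u} [Field k] [Ring H] [Bialgebra k H] [Ring K] [Algebra k K]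
  [LeftComoduleAlgebra k H K] [Ring S] [Algebra k S] [LeftComoduleAlgebra k H S]
  [FiniteDimensional k H] [FiniteDimensional k S] [QuasiTriangular k H]

/-- The Hopf bimodule `X ⊙ P = P ⊗_S (X ⊗ S)`: it is the value at `S` of the oplax module functor
`N ↦ P ⊗_S (X ⊗ N)`. -/
def tensAct (X : FinMod k H) (P : HopfBimod k H K S) : HopfBimod k H K S :=
  ofFunctor (X ⊙ₗ P.toOplax)

variable (X : FinMod k H) (P : HopfBimod k H K S) (N : FinMod k S)

/-- The map `(p, x ⊗ s) ↦ p ⊗ (x ⊗ s)` to `P ⊗_S (X ⊗ S)`. -/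
def cls₃ : P.carrier →ₗ[k] X ⊗[k] S →ₗ[k] (tensAct X P).carrier := P.cls (X ⊙ₗ regular k S)

theorem tensAct_act (a : K) (p : P.carrier) (x : X) (s : S) :
    (tensAct X P).act a (cls₃ X P p (x ⊗ₜ s)) = cls₃ X P (P.act a p) (x ⊗ₜ s) := rfl

theorem tensAct_right (t : S) (p : P.carrier) (x : X) (s : S) :
    (tensAct X P).right t (cls₃ X P p (x ⊗ₜ s)) = cls₃ X P p (x ⊗ₜ (s * t)) := rfl

theorem cls₃_right (s : S) (p : P.carrier) (x : X) :
    cls₃ X P (P.right s p) (x ⊗ₜ 1) = cls₃ X P p (LinearMap.rTensor S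
      (LinearMap.flip X.act.toLinearMap x) (LeftComoduleAlgebra.coact s)) := by
  refine (cls_right p s (N := X ⊙ₗ regular k S) (x ⊗ₜ[k] (1 : S))).trans ?_
  refine congrArg (cls₃ X P p) ?_
  refine (LinearMap.congr_fun (action_act X (regular k S) s) (x ⊗ₜ[k] (1 : S))).trans ?_
  exact pair_mul_one X x (LeftComoduleAlgebra.coact s)

/-- The bilinear map `(p, x ⊗ n) ↦ (p ⊗ (x ⊗ 1)) ⊗ n`. -/
def thetaInvLin : P.carrier →ₗ[k] X ⊗[k] N →ₗ[k] (tensAct X P).Bal N :=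
  (TensorProduct.lift.equiv (RingHom.id k) X N ((tensAct X P).Bal N)).toLinearMap ∘ₗ
    ((cls₃ X P).compl₂ ((TensorProduct.mk k X S).flip 1)).compr₂ ((tensAct X P).cls N)

theorem thetaInvLin_tmul (p : P.carrier) (x : X) (n : N) :
    thetaInvLin X P N p (x ⊗ₜ n) = (tensAct X P).cls N (cls₃ X P p (x ⊗ₜ 1)) n := rfl

theorem thetaInvLin_right (p : P.carrier) (s : S) (v : X ⊗[k] N) :
    thetaInvLin X P N (P.right s p) v = thetaInvLin X P N p
      (pair X.act.toLinearMap N.act.toLinearMap (LeftComoduleAlgebra.coact s) v) := by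
  induction v with
  | zero => simp
  | add v v' h h' => simp only [map_add, h, h']
  | tmul x n =>
    rw [thetaInvLin_tmul, cls₃_right]
    generalize LeftComoduleAlgebra.coact (k := k) (H := H) s = z
    induction z with
    | zero => simp
    | add z z' h h' => simp only [map_add, LinearMap.add_apply, h, h']
    | tmul a t =>
      rw [pair_tmul, TensorProduct.map_tmul, thetaInvLin_tmul, LinearMap.rTensor_tmul]
      refine Eq.trans ?_ (cls_right (cls₃ X P p (X.act a x ⊗ₜ 1)) t n)
      rw [tensAct_right, one_mul]
      rfl

/-- The linear map `P ⊗_S (X ⊗ N) ⟶ (P ⊗_S (X ⊗ S)) ⊗_S N`, `p ⊗ (x ⊗ n) ↦ (p ⊗ (x ⊗ 1)) ⊗ n`. -/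
def thetaInv : P.Bal (X ⊙ₗ N) →ₗ[k] (tensAct X P).Bal N :=
  lift (N := X ⊙ₗ N) (thetaInvLin X P N) fun p s v =>
    (thetaInvLin_right X P N p s v).trans
      (congrArg (thetaInvLin X P N p) (LinearMap.congr_fun (action_act X N s) v).symm)

/-- The linear map `(P ⊗_S (X ⊗ S)) ⊗_S N ⟶ P ⊗_S (X ⊗ N)`, `(p ⊗ (x ⊗ s)) ⊗ n ↦ p ⊗ (x ⊗ s n)`. -/
def thetaLin : (tensAct X P).Bal N →ₗ[k] P.Bal (X ⊙ₗ N) := evalBal (X ⊙ₗ P.toOplax) N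

theorem thetaLin_cls (p : P.carrier) (x : X) (s : S) (n : N) :
    thetaLin X P N ((tensAct X P).cls N (cls₃ X P p (x ⊗ₜ s)) n) =
      P.cls (X ⊙ₗ N) p (x ⊗ₜ[k] N.act s n) := rfl

theorem thetaInv_cls (p : P.carrier) (x : X) (n : N) :
    thetaInv X P N (P.cls (X ⊙ₗ N) p (x ⊗ₜ[k] n)) =
      (tensAct X P).cls N (cls₃ X P p (x ⊗ₜ 1)) n := rfl

theorem tensAct_ext {V : Type u} [AddCommGroup V] [Module k V]
    {f g : (tensAct X P).carrier →ₗ[k] V}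
    (h : ∀ p x s, f (cls₃ X P p (x ⊗ₜ s)) = g (cls₃ X P p (x ⊗ₜ s))) : f = g :=
  bal_ext (P := P.toBimod) (N := X ⊙ₗ regular k S) fun p v =>
    LinearMap.congr_fun (TensorProduct.ext' (h p) : f ∘ₗ cls₃ X P p = g ∘ₗ cls₃ X P p) v

/-- The linear isomorphism `(P ⊗_S (X ⊗ S)) ⊗_S N ≅ P ⊗_S (X ⊗ N)`. -/
def thetaEquiv : (tensAct X P).Bal N ≃ₗ[k] P.Bal (X ⊙ₗ N) :=
  LinearEquiv.ofLinearMap (thetaLin X P N) (thetaInv X P N)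
    (bal_ext fun p v => LinearMap.congr_fun (f := thetaLin X P N ∘ₗ thetaInvLin X P N p)
      (g := P.cls (X ⊙ₗ N) p) (TensorProduct.ext' fun x n => by
        exact (thetaLin_cls X P N p x 1 n).trans
          (congrArg (fun m : N => P.cls (X ⊙ₗ N) p (x ⊗ₜ[k] m)) (act_one N n))) v)
    (bal_ext fun q n => LinearMap.congr_fun
      (f := (thetaInv X P N ∘ₗ thetaLin X P N) ∘ₗ ((tensAct X P).cls N).flip n)
      (g := ((tensAct X P).cls N).flip n) (tensAct_ext X P fun p x s => by
        refine (thetaInv_cls X P N p x (N.act s n)).trans ?_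
        refine (cls_right (cls₃ X P p (x ⊗ₜ 1)) s n).symm.trans ?_
        rw [tensAct_right, one_mul]
        rfl) q)

/-- The isomorphism of oplax module functors `(X ⊙ P) ⊗_S N ≅ P ⊗_S (X ⊗ N)`,
`(p ⊗ (x ⊗ s)) ⊗ n ↦ p ⊗ (x ⊗ s n)`. -/
def theta : (toOplaxFunctor k H K S).obj (tensAct X P) ≅
    X ⊙ₗ (toOplaxFunctor k H K S).obj P :=
  OplaxModuleFunctor.isoMk
    (NatIso.ofComponents
      (fun N => FinMod.isoMk (thetaEquiv X P N) (evalHom (X ⊙ₗ P.toOplax) N).comm)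
      (fun f => evalHom_natural (X ⊙ₗ P.toOplax) f))
    (fun Y N => evalHom_str (X ⊙ₗ P.toOplax) Y N)

theorem theta_cls (p : P.carrier) (x : X) (s : S) (n : N) :
    ((theta X P).hom.nat.app N).lin ((tensAct X P).cls N (cls₃ X P p (x ⊗ₜ s)) n) =
      P.cls (X ⊙ₗ N) p (x ⊗ₜ[k] N.act s n) := rfl

/-- The action of `Rep(H)` on Hopf bimodules, `X ⊙ P = P ⊗_S (X ⊗ S)`. -/
instance : MonoidalLeftAction (FinMod k H) (HopfBimod k H K S) :=
  transportAction (fullyFaithful k H K S) tensAct theta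

theorem action_obj : X ⊙ₗ P = tensAct X P := rfl

end Action

end HopfBimod

namespace HopfBimod

section Equivalence

open ModCat.Bimod ModCat.FinMod

variable {k H K S : Type u} [Field k] [Ring H] [Bialgebra k H] [Ring K] [Algebra k K]
  [LeftComoduleAlgebra k H K] [Ring S] [Algebra k S] [LeftComoduleAlgebra k H S]
  [FiniteDimensional k H] [FiniteDimensional k S] [QuasiTriangular k H]

instance : LinearAction k (FinMod k H) (HopfBimod k H K S) where
  right_add X P Q f g := (fullyFaithful k H K S).map_injective (by
    change (toOplaxFunctor k H K S).map ((fullyFaithful k H K S).preimage _) =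
      (toOplaxFunctor k H K S).map ((fullyFaithful k H K S).preimage _ +
        (fullyFaithful k H K S).preimage _)
    simp [LinearAction.right_add (k := k)])
  right_smul X a P Q f := (fullyFaithful k H K S).map_injective (by
    change (toOplaxFunctor k H K S).map ((fullyFaithful k H K S).preimage _) =
      (toOplaxFunctor k H K S).map (a • (fullyFaithful k H K S).preimage _)
    simp [LinearAction.right_smul (k := k)])
  left_add f g P := (fullyFaithful k H K S).map_injective (by
    change (toOplaxFunctor k H K S).map ((fullyFaithful k H K S).preimage _) =
      (toOplaxFunctor k H K S).map ((fullyFaithful k H K S).preimage _ +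
        (fullyFaithful k H K S).preimage _)
    simp [LinearAction.left_add (k := k)])
  left_smul a _ _ f P := (fullyFaithful k H K S).map_injective (by
    change (toOplaxFunctor k H K S).map ((fullyFaithful k H K S).preimage _) =
      (toOplaxFunctor k H K S).map (a • (fullyFaithful k H K S).preimage _)
    simp [LinearAction.left_smul (k := k)])

/-! Explicit formulas for the action of `Rep(H)` on Hopf bimodules. -/

/-- The morphism `X ⊙ f` is `p ⊗ (x ⊗ s) ↦ f p ⊗ (x ⊗ s)`. -/
theorem actionHomRight_cls₃ (X : FinMod k H) {P Q : HopfBimod k H K S} (f : P ⟶ Q)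
    (p : P.carrier) (x : X) (s : S) :
    (X ⊴ₗ f).lin (cls₃ X P p (x ⊗ₜ s)) = cls₃ X Q (f.lin p) (x ⊗ₜ s) := by
  have h : 1 * (s * 1) = s := by rw [mul_one, one_mul]
  exact congrArg (fun t : S => cls₃ X Q (f.lin p) (x ⊗ₜ t)) h

/-- The morphism `f ⊙ P` is `p ⊗ (x ⊗ s) ↦ p ⊗ (f x ⊗ s)`. -/
theorem actionHomLeft_cls₃ {X X' : FinMod k H} (f : X ⟶ X') (P : HopfBimod k H K S)
    (p : P.carrier) (x : X) (s : S) :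
    (f ⊵ₗ P).lin (cls₃ X P p (x ⊗ₜ s)) = cls₃ X' P p (f.lin x ⊗ₜ s) := by
  have h : 1 * (s * 1) = s := by rw [mul_one, one_mul]
  exact congrArg (fun t : S => cls₃ X' P p (f.lin x ⊗ₜ t)) h

/-- The unit isomorphism is `p ⊗ (a ⊗ s) ↦ a (p s)`. -/
theorem actionUnit_cls₃ (P : HopfBimod k H K S) (p : P.carrier) (a : k) (s : S) :
    (λₗ[FinMod k H] P).hom.lin (cls₃ (𝟙_ (FinMod k H)) P p (a ⊗ₜ s)) = a • P.right s p := by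
  have h : a • (s * 1) = a • s := by rw [mul_one]
  refine Eq.trans ?_ (LinearMap.congr_fun (P.right.map_smul a s) p)
  exact congrArg (fun t : S => P.right t p) h

/-- The associativity isomorphism `(X ⊗ Y) ⊙ P ≅ X ⊙ (Y ⊙ P)` sends
`p ⊗ ((R² x ⊗ R¹ y) ⊗ s)` to `(p ⊗ (y ⊗ 1)) ⊗ (x ⊗ s)`. -/
theorem actionAssoc_cls₃ (X Y : FinMod k H) (P : HopfBimod k H K S) (p : P.carrier)
    (x : X) (y : Y) (s : S) :
    (αₗ X Y P).hom.lin (cls₃ (X ⊗ Y) P p ((β_ Y X).hom.lin (y ⊗ₜ[k] x) ⊗ₜ s)) =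
      cls₃ X (Y ⊙ₗ P) (cls₃ Y P p (y ⊗ₜ 1)) (x ⊗ₜ s) := by
  have h0 : (β_ Y X).inv.lin ((β_ Y X).hom.lin (y ⊗ₜ[k] x)) = y ⊗ₜ[k] x :=
    LinearMap.congr_fun (congrArg FinMod.Hom.lin (β_ Y X).hom_inv_id) _
  have h1 : s * 1 = s := mul_one s
  have h2 (t : S) : (revAssoc X Y (regular k S)).hom.lin
      ((β_ Y X).hom.lin (y ⊗ₜ[k] x) ⊗ₜ[k] t) = y ⊗ₜ[k] (x ⊗ₜ[k] t) :=
    congrArg (fun v : Y ⊗[k] X => TensorProduct.assoc k Y X S (v ⊗ₜ t)) h0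
  refine (congrArg (fun u => (X ⊙ₗ (Y ⊙ₗ P)).unitBal (thetaInv X (Y ⊙ₗ P) (regular k S)
    (thetaInv Y P (X ⊙ₗ regular k S) (P.cls (Y ⊙ₗ X ⊙ₗ regular k S) p u))))
    ((h2 (s * 1)).trans (congrArg (fun t : S => y ⊗ₜ[k] (x ⊗ₜ[k] t)) h1))).trans ?_
  have h3 : 1 * s = s := one_mul s
  exact congrArg (fun t : S => cls₃ X (Y ⊙ₗ P) (cls₃ Y P p (y ⊗ₜ 1)) (x ⊗ₜ t)) h3

theorem swap_aux (X : FinMod k H) (r : H ⊗[k] H) (x : X) (w : H ⊗[k] S) :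
    TensorProduct.assoc k H X S (((TensorProduct.comm k X H).toLinearMap ∘ₗ
      pair X.act.toLinearMap (LinearMap.mul k H) r).rTensor S
        ((TensorProduct.assoc k X H S).symm (x ⊗ₜ w))) =
      TensorProduct.leftComm k X H S
        (pair X.act.toLinearMap (LinearMap.rTensorHom S ∘ₗ LinearMap.mul k H) r (x ⊗ₜ w)) := by
  induction r with
  | zero => simp
  | add r r' h h' =>
    simp only [map_add, LinearMap.add_apply, LinearMap.comp_add, LinearMap.rTensor_add, h, h']
  | tmul a b =>
    induction w with
    | zero => simp
    | add w w' h h' => simp only [map_add, TensorProduct.tmul_add, h, h']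
    | tmul c s => simp

/-- The coaction of `X ⊙ P` is
`p ⊗ (x ⊗ s) ↦ p₋₁ R² s₋₁ ⊗ (p₀ ⊗ (R¹ x ⊗ s₀))`. -/
theorem tensAct_coact (X : FinMod k H) (P : HopfBimod k H K S) (p : P.carrier) (x : X) (s : S) :
    (X ⊙ₗ P).coact (cls₃ X P p (x ⊗ₜ s)) =
      pair (LinearMap.mul k H) (cls₃ X P) (P.coact p) (TensorProduct.leftComm k X H S
        (pair X.act.toLinearMap (LinearMap.rTensorHom S ∘ₗ LinearMap.mul k H)
          (QuasiTriangular.R (k := k) (H := H)).val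
          (x ⊗ₜ LeftComoduleAlgebra.coact (k := k) (H := H) s))) := by
  have h (w : H ⊗[k] S) : (swapIso X (regular k H) (regular k S)).hom.lin (x ⊗ₜ[k] w) =
      TensorProduct.leftComm k X H S
        (pair X.act.toLinearMap (LinearMap.rTensorHom S ∘ₗ LinearMap.mul k H)
          (QuasiTriangular.R (k := k) (H := H)).val (x ⊗ₜ w)) := by
    change TensorProduct.assoc k H X S ((braidLin X (regular k H)).toLinearMap.rTensor S
      ((TensorProduct.assoc k X H S).symm (x ⊗ₜ w))) = _
    exact swap_aux X _ x w
  exact congrArg (pair (LinearMap.mul k H) (cls₃ X P) (P.coact p)) (h _)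

variable (k H K S) in
/-- The functor `P ↦ P ⊗_S -` from Hopf bimodules to module functors `_S M ⥤ _K M`, as a module
functor. The structure of module functor of `P ⊗_S -` is `p ⊗ (x ⊗ n) ↦ p₋₁ x ⊗ (p₀ ⊗ n)`, and
`h` says that these maps are isomorphisms. The structure isomorphism
`(X ⊙ P) ⊗_S - ≅ X ⊙ (P ⊗_S -)` is `theta`, that is
`(p ⊗ (x ⊗ s)) ⊗ n ↦ p ⊗ (x ⊗ s n)`. -/
def balancedTensor (h : ∀ (P : HopfBimod k H K S) (X : FinMod k H) (N : FinMod k S),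
    IsIso (P.toOplax.str X N)) :
    ModuleFunctor k (FinMod k H) (HopfBimod k H K S)
      (ModuleFunctor k (FinMod k H) (FinMod k S) (FinMod k K)) where
  functor :=
    { obj P := ⟨P.toOplax, h P⟩
      map f := (toOplaxFunctor k H K S).map f
      map_id P := (toOplaxFunctor k H K S).map_id P
      map_comp f g := (toOplaxFunctor k H K S).map_comp f g }
  additive := ⟨fun {P Q f g} => (toOplaxFunctor k H K S).map_add⟩
  linear := ⟨fun f a => (toOplaxFunctor k H K S).map_smul a f⟩
  oplax :=
    { δₗ X P := (theta X P).hom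
      δₗ_naturality_left {X X'} f P := by
        change (toOplaxFunctor k H K S).map ((fullyFaithful k H K S).preimage _) ≫
          (theta X' P).hom = (theta X P).hom ≫ f ⊵ₗ (toOplaxFunctor k H K S).obj P
        simp
      δₗ_naturality_right X P Q f := by
        change (toOplaxFunctor k H K S).map ((fullyFaithful k H K S).preimage _) ≫
          (theta X Q).hom = (theta X P).hom ≫ X ⊴ₗ (toOplaxFunctor k H K S).map f
        simp
      δₗ_associativity X Y P := by
        change (theta (X ⊗ Y) P).hom ≫ (αₗ X Y ((toOplaxFunctor k H K S).obj P)).hom =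
          (toOplaxFunctor k H K S).map ((fullyFaithful k H K S).preimage _) ≫
            (theta X (tensAct Y P)).hom ≫ X ⊴ₗ (theta Y P).hom
        simp
      δₗ_unitality_inv P := by
        change (λₗ ((toOplaxFunctor k H K S).obj P)).inv =
          (toOplaxFunctor k H K S).map ((fullyFaithful k H K S).preimage _) ≫
            (theta (𝟙_ (FinMod k H)) P).hom
        simp }
  isIso X P := ⟨(theta X P).inv, (theta X P).hom_inv_id, (theta X P).inv_hom_id⟩

end Equivalence

end HopfBimod

end ModCat

/-!
The functor `P ↦ P ⊗_S -` is fully faithful as a functor to oplax module functors, so it remains to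
show that its values are module functors, and that every module functor `F : _S M ⥤ _K M` is
isomorphic to `F(S) ⊗_S -`.

The first point is formal. The dual `X*` of a representation `X`, formed with the antipode, is a
dual on one side, and by the braiding it is a dual on the other side too. The mate of the structure
map `F(X* ⊙ (X ⊙ d)) ⟶ X* ⊙ F(X ⊙ d)` then inverts `F(X ⊙ d) ⟶ X ⊙ F(d)`
(`isIso_δₗ_of_exactPairing`); this replaces the inverse of the antipode.

For the second point, let `φ_N : F(S) ⊗_S N ⟶ F(N)` be the evaluation map. It is an isomorphism for
`N = S`, it is natural, and `φ_{X ⊗ N}` is identified with `X ⊗ φ_N` by the structure isomorphisms.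
So it is an isomorphism for `X ⊗ S`, for the retracts of such modules, and also for `N` as soon as
it is one for `H ⊗ N`. Hence it suffices that `M = H ⊗ N` is projective, that is, a retract of the
free module `M ⊗ S` (`FinMod.exists_section_of_isRightSimple`); this is where right simplicity
enters, and it makes exactness of `F` automatic.

Projectivity is proved by counting dimensions. Put `h(W) = dim Hom_S(M, W)`, which is subadditive on
short exact sequences, and let `c` be the maximum of `h(W) / dim W` over all `W ≠ 0`, attained at
`V`. By subadditivity the class of all `W` with `h(W) = c dim W` is closed under submodules and
quotients, and `h` is additive on short exact sequences in it. It is closed under `X ⊗ -`, as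
`x ⊗ f ↦ (h ⊗ n ↦ h₁ x ⊗ f(h₂ ⊗ n))` is an injection of `X ⊗ Hom(M, W)` into `Hom(M, X ⊗ W)`. Now the
kernel of `S → H ⊗ End V` is a costable ideal, so it is zero by right simplicity, and `S` acts
faithfully on `H ⊗ V`. Therefore `S` embeds into a power of `H ⊗ V` and belongs to the class, and so
do all quotients of free modules. It follows that the surjection `M ⊗ S ⟶ M` splits.
-/

namespace ModCat

/-! ### Invertibility of oplax module structures at dualizable objects -/

section Duality

universe v v₁ v₂ v₃ u₁ u₂ u₃

variable {C : Type u₁} [Category.{v₁} C] [MonoidalCategory C]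
  {D : Type u₂} [Category.{v₂} D] [MonoidalLeftAction C D]

theorem associator_inv_actionHom (X Y Z : C) (d : D) :
    (α_ X Y Z).inv ⊵ₗ d = (αₗ X (Y ⊗ Z) d).hom ≫ X ⊴ₗ (αₗ Y Z d).hom ≫
      (αₗ X Y (Z ⊙ₗ d)).inv ≫ (αₗ (X ⊗ Y) Z d).inv := by
  have h := associator_actionHom X Y Z d
  rw [← cancel_epi ((α_ X Y Z).hom ⊵ₗ d), hom_inv_actionHomLeft, reassoc_of% h]; simp

/-- The unit `d ⟶ Y ⊙ (X ⊙ d)` of the adjunction of `X ⊙ -` and `Y ⊙ -` given by a pairing of `X`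
and `Y`. -/
def dualUnit (Y X : C) [ExactPairing Y X] (d : D) : d ⟶ Y ⊙ₗ X ⊙ₗ d :=
  (λₗ d).inv ≫ (η_ Y X) ⊵ₗ d ≫ (αₗ Y X d).hom

/-- The counit `X ⊙ (Y ⊙ d) ⟶ d` of the adjunction of `X ⊙ -` and `Y ⊙ -` given by a pairing of
`X` and `Y`. -/
def dualCounit (Y X : C) [ExactPairing Y X] (d : D) : X ⊙ₗ Y ⊙ₗ d ⟶ d :=
  (αₗ X Y d).inv ≫ (ε_ Y X) ⊵ₗ d ≫ (λₗ d).hom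

variable (Y X : C) [ExactPairing Y X]

theorem dualCounit_natural {d d' : D} (f : d ⟶ d') :
    X ⊴ₗ Y ⊴ₗ f ≫ dualCounit Y X d' = dualCounit Y X d ≫ f := by
  have h : (αₗ X Y d).hom ≫ X ⊴ₗ Y ⊴ₗ f = (X ⊗ Y) ⊴ₗ f ≫ (αₗ X Y d').hom := by simp
  rw [dualCounit, dualCounit, Category.assoc, Category.assoc, actionUnitIso_hom_naturality,
    ← action_exchange_assoc, Iso.eq_inv_comp, reassoc_of% h, Iso.hom_inv_id_assoc]

theorem actionHomRight_dualUnit_comp_dualCounit (d : D) :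
    X ⊴ₗ dualUnit Y X d ≫ dualCounit Y X (X ⊙ₗ d) = 𝟙 (X ⊙ₗ d) := by
  have h := congrArg (· ⊵ₗ d) (ExactPairing.coevaluation_evaluation Y X)
  simp only [comp_actionHomLeft, associator_inv_actionHom, whiskerLeft_actionHomLeft,
    whiskerRight_actionHomLeft, Category.assoc, Iso.inv_hom_id_assoc] at h
  rw [dualUnit, dualCounit, actionHomRight_comp, actionHomRight_comp]
  have h2 := rightUnitor_actionHom X d
  have h3 := leftUnitor_actionHom X d
  have h4 : X ⊴ₗ (λₗ d).inv = (ρ_ X).inv ⊵ₗ d ≫ (αₗ X (𝟙_ C) d).hom := by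
    rw [← cancel_mono (X ⊴ₗ (λₗ[C] d).hom), actionHomRight_inv_hom, Category.assoc, ← h2,
      inv_hom_actionHomLeft]
  have h5 : (λₗ (X ⊙ₗ d)).hom = (αₗ (𝟙_ C) X d).inv ≫ (λ_ X).hom ⊵ₗ d := by
    rw [h3, Iso.inv_hom_id_assoc]
  rw [h4, h5]
  simp only [Category.assoc]
  rw [reassoc_of% h]
  simp only [inv_hom_actionHomLeft, Category.comp_id, ← comp_actionHomLeft]
  simp

variable {E : Type u₃} [Category.{v₃} E] [MonoidalLeftAction C E]

open Functor.OplaxLeftLinear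

theorem map_dualUnit (F : D ⥤ E) [F.OplaxLeftLinear C] (d : D) :
    F.map (dualUnit Y X d) ≫ δₗ F Y (X ⊙ₗ d) ≫ Y ⊴ₗ δₗ F X d = dualUnit Y X (F.obj d) := by
  have h1 := δₗ_associativity F Y X d
  have h2 := δₗ_naturality_left F (η_ Y X) d
  have h3 := δₗ_unitality_inv (C := C) F d
  rw [dualUnit, dualUnit, h3, Functor.map_comp, Functor.map_comp, Category.assoc, Category.assoc,
    Category.assoc, ← h1, reassoc_of% h2]

theorem map_dualCounit (F : D ⥤ E) [F.OplaxLeftLinear C] (d : D) :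
    δₗ F X (Y ⊙ₗ d) ≫ X ⊴ₗ δₗ F Y d ≫ dualCounit Y X (F.obj d) = F.map (dualCounit Y X d) := by
  have h1 := δₗ_associativity F X Y d
  have h2 := δₗ_naturality_left F (ε_ Y X) d
  have h3 := δₗ_unitality_inv (C := C) F d
  have h3' : δₗ F (𝟙_ C) d ≫ (λₗ (F.obj d)).hom = F.map (λₗ d).hom := by
    rw [← cancel_epi (F.map (λₗ[C] d).inv), ← Category.assoc, ← h3, Iso.inv_hom_id,
      ← Functor.map_comp, Iso.inv_hom_id, CategoryTheory.Functor.map_id]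
  rw [dualCounit, dualCounit, Functor.map_comp, Functor.map_comp, ← h3', reassoc_of% h2,
    ← cancel_epi (F.map (αₗ X Y d).hom), ← Functor.map_comp_assoc, Iso.hom_inv_id,
    CategoryTheory.Functor.map_id, Category.id_comp, ← reassoc_of% h1, Iso.hom_inv_id_assoc]

/-- An oplax module structure is invertible at every object `X` which is the right member of an
exact pairing: the inverse is the mate of `F (Y ⊙ (X ⊙ d)) ⟶ Y ⊙ F (X ⊙ d)`. -/
theorem isIso_δₗ_of_exactPairing (Y X : C) [ExactPairing Y X] (F : D ⥤ E)
    [F.OplaxLeftLinear C] (d : D) :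
    IsIso (δₗ F X d) := by
  refine ⟨X ⊴ₗ (F.map (dualUnit Y X d) ≫ δₗ F Y (X ⊙ₗ d)) ≫ dualCounit Y X (F.obj (X ⊙ₗ d)),
    ?_, ?_⟩
  · have h := δₗ_naturality_right F X (dualUnit Y X d)
    rw [actionHomRight_comp, Category.assoc, ← reassoc_of% h, map_dualCounit,
      ← Functor.map_comp, actionHomRight_dualUnit_comp_dualCounit, CategoryTheory.Functor.map_id]
  · rw [Category.assoc, ← dualCounit_natural, ← actionHomRight_comp_assoc, Category.assoc,
      map_dualUnit, actionHomRight_dualUnit_comp_dualCounit]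

end Duality

/-! ### Equivalences of module categories -/

namespace ModuleFunctor

universe v v₁ v₂ v₃ u₁ u₂ u₃

variable {k : Type v} [Field k] {C : Type u₁} [Category.{v₁} C] [MonoidalCategory C]
  [Preadditive C] [Linear k C]
  {D : Type u₂} [Category.{v₂} D] [Preadditive D] [Linear k D]
  [MonoidalLeftAction C D] [LinearAction k C D]
  {E : Type u₃} [Category.{v₃} E] [Preadditive E] [Linear k E]
  [MonoidalLeftAction C E] [LinearAction k C E]

open Functor.OplaxLeftLinear

/-- The structure isomorphism `F (X ⊙ d) ≅ X ⊙ F d`. -/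
noncomputable def strIso (F : ModuleFunctor k C D E) (X : C) (d : D) :
    F.functor.obj (X ⊙ₗ d) ≅ X ⊙ₗ F.functor.obj d :=
  haveI := F.isIso X d
  asIso (F.str X d)

theorem strIso_inv_natural_left (F : ModuleFunctor k C D E) {X X' : C} (f : X ⟶ X') (d : D) :
    (F.strIso X d).inv ≫ F.functor.map (f ⊵ₗ d) =
      f ⊵ₗ F.functor.obj d ≫ (F.strIso X' d).inv := by
  have h : F.functor.map (f ⊵ₗ d) ≫ (F.strIso X' d).hom =
      (F.strIso X d).hom ≫ f ⊵ₗ F.functor.obj d := δₗ_naturality_left F.functor f d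
  rw [Iso.inv_comp_eq, ← Category.assoc, Iso.eq_comp_inv, h]

theorem strIso_inv_natural_right (F : ModuleFunctor k C D E) (X : C) {d d' : D} (f : d ⟶ d') :
    (F.strIso X d).inv ≫ F.functor.map (X ⊴ₗ f) =
      X ⊴ₗ F.functor.map f ≫ (F.strIso X d').inv := by
  have h : F.functor.map (X ⊴ₗ f) ≫ (F.strIso X d').hom =
      (F.strIso X d).hom ≫ X ⊴ₗ F.functor.map f := δₗ_naturality_right F.functor X f
  rw [Iso.inv_comp_eq, ← Category.assoc, Iso.eq_comp_inv, h]

variable (F : ModuleFunctor k C D E) (hF : F.functor.FullyFaithful) (g : E → D)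
  (e : ∀ Y, F.functor.obj (g Y) ≅ Y)

/-- The module functor quasi-inverse to a fully faithful module functor `F` with chosen
isomorphisms `F (g Y) ≅ Y`. -/
noncomputable def quasiInverse : ModuleFunctor k C E D where
  functor :=
    { obj := g
      map {Y Y'} f := hF.preimage ((e Y).hom ≫ f ≫ (e Y').inv)
      map_id Y := hF.map_injective (by simp)
      map_comp f f' := hF.map_injective (by simp) }
  additive := ⟨hF.map_injective (by simp)⟩
  linear := ⟨fun f a => hF.map_injective (by simp)⟩
  oplax :=
    { δₗ X Y := hF.preimage ((e (X ⊙ₗ Y)).hom ≫ X ⊴ₗ (e Y).inv ≫ (F.strIso X (g Y)).inv)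
      δₗ_naturality_left {X X'} f Y := hF.map_injective (by
        have h := F.strIso_inv_natural_left f (g Y)
        simp [h, action_exchange_assoc])
      δₗ_naturality_right X Y Y' f := hF.map_injective (by
        have h := F.strIso_inv_natural_right X (hF.preimage ((e Y).hom ≫ f ≫ (e Y').inv))
        rw [hF.map_preimage] at h
        simp [h])
      δₗ_associativity X X' Y := hF.map_injective (by
        have h : (F.strIso (X ⊗ X') (g Y)).hom ≫ (αₗ X X' (F.functor.obj (g Y))).hom =
            F.functor.map (αₗ X X' (g Y)).hom ≫ (F.strIso X (X' ⊙ₗ g Y)).hom ≫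
              X ⊴ₗ (F.strIso X' (g Y)).hom := δₗ_associativity F.functor X X' (g Y)
        have h' := F.strIso_inv_natural_right X (hF.preimage ((e (X' ⊙ₗ Y)).hom ≫
          X' ⊴ₗ (e Y).inv ≫ (F.strIso X' (g Y)).inv))
        have h'' : F.functor.map (αₗ X X' (g Y)).hom = (F.strIso (X ⊗ X') (g Y)).hom ≫
            (αₗ X X' (F.functor.obj (g Y))).hom ≫ X ⊴ₗ (F.strIso X' (g Y)).inv ≫
              (F.strIso X (X' ⊙ₗ g Y)).inv := by
          rw [reassoc_of% h, actionHomRight_hom_inv_assoc, Iso.hom_inv_id, Category.comp_id]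
        rw [hF.map_preimage] at h'
        simp only [Functor.map_comp, hF.map_preimage, actionHomRight_comp, Category.assoc, h', h'',
          Iso.inv_hom_id_assoc, actionHomRight_inv_hom_assoc]
        have h3 : (X ⊗ X') ⊴ₗ (e Y).inv ≫ (αₗ X X' (F.functor.obj (g Y))).hom =
            (αₗ X X' Y).hom ≫ X ⊴ₗ X' ⊴ₗ (e Y).inv := by simp
        rw [reassoc_of% h3])
      δₗ_unitality_inv Y := hF.map_injective (by
        have h : (λₗ (F.functor.obj (g Y))).inv = F.functor.map (λₗ (g Y)).inv ≫
          (F.strIso (𝟙_ C) (g Y)).hom := δₗ_unitality_inv (C := C) F.functor (g Y)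
        rw [← Iso.comp_inv_eq] at h
        simp only [Functor.map_comp, hF.map_preimage, Category.assoc, ← h]
        simp only [unit_actionHomRight, Iso.hom_inv_id_assoc, Category.assoc,
          Iso.inv_hom_id_assoc]) }
  isIso X Y := by
    change IsIso (hF.preimage ((e (X ⊙ₗ Y)).hom ≫ X ⊴ₗ (e Y).inv ≫ (F.strIso X (g Y)).inv))
    have : IsIso (F.functor.map (hF.preimage
        ((e (X ⊙ₗ Y)).hom ≫ X ⊴ₗ (e Y).inv ≫ (F.strIso X (g Y)).inv))) := by
      rw [hF.map_preimage]; infer_instance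
    exact hF.isIso_of_isIso_map _

/-- A fully faithful, essentially surjective module functor is an equivalence of module
categories. -/
theorem isEquivalence_of_fullyFaithful (F : ModuleFunctor k C D E)
    (hF : F.functor.FullyFaithful) (g : E → D) (e : ∀ Y, F.functor.obj (g Y) ≅ Y) :
    F.IsEquivalence := by
  refine ⟨F.quasiInverse hF g e, ⟨?_⟩, ⟨?_⟩⟩
  · refine OplaxModuleFunctor.isoMk (NatIso.ofComponents
      (fun d => (hF.preimageIso (e (F.functor.obj d))).symm) ?_) ?_
    · intro d d' f
      refine hF.map_injective ?_
      change F.functor.map (f ≫ hF.preimage (e (F.functor.obj d')).inv) = F.functor.map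
        (hF.preimage (e (F.functor.obj d)).inv ≫ hF.preimage ((e (F.functor.obj d)).hom ≫
          F.functor.map f ≫ (e (F.functor.obj d')).inv))
      simp
    · intro X d
      refine hF.map_injective ?_
      change F.functor.map (hF.preimage (e (F.functor.obj (X ⊙ₗ d))).inv ≫
        hF.preimage ((e (F.functor.obj (X ⊙ₗ d))).hom ≫ (F.strIso X d).hom ≫
          (e (X ⊙ₗ F.functor.obj d)).inv) ≫
        hF.preimage ((e (X ⊙ₗ F.functor.obj d)).hom ≫ X ⊴ₗ (e (F.functor.obj d)).inv ≫
          (F.strIso X (g (F.functor.obj d))).inv)) =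
        F.functor.map (𝟙 (X ⊙ₗ d) ≫ X ⊴ₗ hF.preimage (e (F.functor.obj d)).inv)
      have h := F.strIso_inv_natural_right X (hF.preimage (e (F.functor.obj d)).inv)
      rw [hF.map_preimage, Iso.inv_comp_eq] at h
      simp [h]
  · refine OplaxModuleFunctor.isoMk (NatIso.ofComponents (fun Y => (e Y).symm) ?_) ?_
    · intro Y Y' f
      change f ≫ (e Y').inv = (e Y).inv ≫ F.functor.map (hF.preimage
        ((e Y).hom ≫ f ≫ (e Y').inv))
      simp
    · intro X Y
      change (e (X ⊙ₗ Y)).inv ≫ F.functor.map (hF.preimage ((e (X ⊙ₗ Y)).hom ≫ X ⊴ₗ (e Y).inv ≫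
        (F.strIso X (g Y)).inv)) ≫ (F.strIso X (g Y)).hom = 𝟙 (X ⊙ₗ Y) ≫ X ⊴ₗ (e Y).inv
      simp

end ModuleFunctor

namespace FinMod

/-! ### Duals of representations of a Hopf algebra -/

section Dual

variable {k H : Type u} [Field k] [Ring H] [HopfAlgebra k H]

/-- The dual module `X*`, with `(h f)(x) = f (S(h) x)` for the antipode `S`. -/
def dual (X : FinMod k H) : FinMod k H where
  carrier := Module.Dual k X
  act := AlgHom.ofLinearMap
    (Module.Dual.transpose ∘ₗ X.act.toLinearMap ∘ₗ HopfAlgebra.antipode k)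
    (by ext f x; simp [Module.Dual.transpose])
    (fun a b => by ext f x; simp [Module.Dual.transpose, HopfAlgebra.antipode_mul_antidistrib])

/-- The evaluation `X* ⊗ X ⟶ k` as a linear map. -/
def dualPairing (X : FinMod k H) : X.dual ⊗[k] X →ₗ[k] k := contractLeft k X

theorem dualPairing_pair (X : FinMod k H) (z : H ⊗[k] H) (f : X.dual) (x : X) :
    X.dualPairing (pair X.dual.act.toLinearMap X.act.toLinearMap z (f ⊗ₜ[k] x)) =
      X.dualPairing (f ⊗ₜ
        X.act (LinearMap.mul' k H ((HopfAlgebra.antipode k).rTensor H z)) x) := by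
  induction z with
  | zero => simp
  | add z w hz hw => simp only [map_add, LinearMap.add_apply, hz, hw, TensorProduct.tmul_add]
  | tmul a b =>
    rw [pair_tmul, LinearMap.rTensor_tmul, LinearMap.mul'_apply, act_mul]
    rfl

theorem triv_act (h : H) (c : k) : (triv k H).act h c = Coalgebra.counit (R := k) h * c := rfl

theorem act_algebraMap {A : Type u} [Ring A] [Algebra k A] (X : FinMod k A) (c : k) (x : X) :
    X.act (algebraMap k A c) x = c • x := by
  rw [AlgHom.commutes]; rfl

/-- The evaluation `X* ⊗ X ⟶ k`. -/
def evaluation (X : FinMod k H) : X.dual ⊗ X ⟶ 𝟙_ (FinMod k H) where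
  lin := X.dualPairing
  comm h v := by
    change X.dualPairing ((tens _ X.dual X).act h v) = (triv k H).act h (X.dualPairing v)
    rw [tens_act, triv_act]
    refine LinearMap.congr_fun (f := X.dualPairing ∘ₗ pair X.dual.act.toLinearMap
      X.act.toLinearMap (Bialgebra.comulAlgHom k H h)) (g := LinearMap.mul k k
        (Coalgebra.counit (R := k) h) ∘ₗ X.dualPairing) (TensorProduct.ext' fun f x => ?_) v
    refine (X.dualPairing_pair _ f x).trans ?_
    rw [Bialgebra.comulAlgHom_apply, HopfAlgebra.mul_antipode_rTensor_comul_apply,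
      act_algebraMap, TensorProduct.tmul_smul, map_smul]
    rfl

/-- The isomorphism `X ⊗ X* ≅ End X` as a linear map. -/
def tensDualToEnd (X : FinMod k H) : X ⊗[k] X.dual →ₗ[k] Module.End k X :=
  dualTensorHom k X X ∘ₗ (TensorProduct.comm k X (Module.Dual k X)).toLinearMap

theorem tensDualToEnd_injective (X : FinMod k H) : Function.Injective X.tensDualToEnd :=
  (dualTensorHom_bijective (R := k) (M := X) (N := X)).1.comp
    (TensorProduct.comm k X (Module.Dual k X)).injective

theorem tensDualToEnd_tmul (X : FinMod k H) (x y : X) (f : X.dual) :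
    X.tensDualToEnd (x ⊗ₜ f) y = (show Module.Dual k X from f) y • x := rfl

/-- On `X ⊗ X* ≅ End X` the element `a ⊗ b` acts by `φ ↦ a φ S(b)`. -/
theorem tensDualToEnd_pair (X : FinMod k H) (a b : H) (v : X ⊗[k] X.dual) (x : X) :
    X.tensDualToEnd (pair X.act.toLinearMap X.dual.act.toLinearMap (a ⊗ₜ b) v) x =
      X.act a (X.tensDualToEnd v (X.act (HopfAlgebra.antipode k b) x)) := by
  induction v with
  | zero => simp
  | add v w hv hw => simp only [map_add, LinearMap.add_apply, hv, hw]
  | tmul y f =>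
    rw [pair_tmul, TensorProduct.map_tmul, tensDualToEnd_tmul, tensDualToEnd_tmul, map_smul]
    rfl

theorem tensDualToEnd_pair_of_eq_id (X : FinMod k H) (z : H ⊗[k] H) (v : X ⊗[k] X.dual)
    (hv : X.tensDualToEnd v = LinearMap.id) :
    X.tensDualToEnd (pair X.act.toLinearMap X.dual.act.toLinearMap z v) =
      X.act (LinearMap.mul' k H ((HopfAlgebra.antipode k).lTensor H z)) := by
  induction z with
  | zero => simp
  | add z w hz hw => simp only [map_add, LinearMap.add_apply, hz, hw]
  | tmul a b =>
    refine LinearMap.ext fun x => ?_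
    rw [tensDualToEnd_pair, hv, LinearMap.lTensor_tmul, LinearMap.mul'_apply, act_mul]
    rfl

/-- The coevaluation `k ⟶ X ⊗ X*` as a linear map. -/
noncomputable def dualCopairing (X : FinMod k H) : k →ₗ[k] X ⊗[k] X.dual := coevaluation k X

theorem tensDualToEnd_dualCopairing (X : FinMod k H) :
    X.tensDualToEnd (X.dualCopairing 1) = LinearMap.id := by
  refine LinearMap.ext fun v => ?_
  change dualTensorHom k X X (TensorProduct.comm k X (Module.Dual k X) (coevaluation k X 1)) v = v
  rw [coevaluation_apply_one]
  simp only [map_sum, LinearMap.sum_apply, TensorProduct.comm_tmul, dualTensorHom_apply]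
  exact (Module.Basis.ofVectorSpace k X).sum_repr v

/-- The coevaluation `k ⟶ X ⊗ X*`. -/
noncomputable def coev (X : FinMod k H) : 𝟙_ (FinMod k H) ⟶ X ⊗ X.dual where
  lin := X.dualCopairing
  comm h c := by
    change X.dualCopairing ((triv k H).act h c) = (tens _ X X.dual).act h (X.dualCopairing c)
    rw [tens_act]
    refine LinearMap.congr_fun (f := X.dualCopairing ∘ₗ LinearMap.mul k k
        (Coalgebra.counit (R := k) h)) (g := pair X.act.toLinearMap
      X.dual.act.toLinearMap (Bialgebra.comulAlgHom k H h) ∘ₗ X.dualCopairing)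
      (LinearMap.ext_ring (X.tensDualToEnd_injective ?_)) c
    refine Eq.trans ?_ (X.tensDualToEnd_pair_of_eq_id _ _ X.tensDualToEnd_dualCopairing).symm
    rw [Bialgebra.comulAlgHom_apply, HopfAlgebra.mul_antipode_lTensor_comul_apply,
      LinearMap.comp_apply, LinearMap.mul_apply', ← smul_eq_mul, map_smul, map_smul,
      tensDualToEnd_dualCopairing, AlgHom.commutes]
    rfl

/-- The dual `X*` as a right dual of `X`. -/
@[reducible] noncomputable def exactPairingDual (X : FinMod k H) :
    ExactPairing X X.dual where
  coevaluation' := X.coev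
  evaluation' := X.evaluation
  coevaluation_evaluation' := by
    ext : 1
    exact contractLeft_assoc_coevaluation k X
  evaluation_coevaluation' := by
    ext : 1
    exact contractLeft_assoc_coevaluation' k X

end Dual

end FinMod

/-- Over a quasi-triangular Hopf algebra the structure maps
`P ⊗_S (X ⊗ N) ⟶ X ⊗ (P ⊗_S N)`, `p ⊗ (x ⊗ n) ↦ p₋₁ x ⊗ (p₀ ⊗ n)`, are isomorphisms: by the
braiding, the dual of `X` is a dual on both sides. -/
theorem HopfBimod.isIso_str {k H K S : Type u} [Field k] [Ring H] [HopfAlgebra k H]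
    [QuasiTriangular k H] [Ring K] [Algebra k K] [LeftComoduleAlgebra k H K] [Ring S]
    [Algebra k S] [LeftComoduleAlgebra k H S] (P : HopfBimod k H K S) (X : FinMod k H)
    (N : FinMod k S) : IsIso (P.toOplax.str X N) :=
  letI := FinMod.exactPairingDual X
  letI := BraidedCategory.exactPairing_swap X X.dual
  isIso_δₗ_of_exactPairing X.dual X P.functor N

namespace FinMod

/-! ### Submodules, quotients and dimensions of spaces of homomorphisms -/

section Sub

variable {k A : Type u} [Field k] [Ring A] [Algebra k A]

/-- The submodule given by a subspace stable under the action. -/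
def sub (W : FinMod k A) (p : Submodule k W) (hp : ∀ a, ∀ w ∈ p, W.act a w ∈ p) :
    FinMod k A where
  carrier := p
  act := AlgHom.ofLinearMap
    { toFun a := (W.act a).restrict (hp a)
      map_add' a b := by ext; simp
      map_smul' c a := by ext; simp }
    (by ext; simp) (fun a b => by ext; simp)

/-- The quotient by a subspace stable under the action. -/
def quot (W : FinMod k A) (p : Submodule k W) (hp : ∀ a, ∀ w ∈ p, W.act a w ∈ p) :
    FinMod k A where
  carrier := W ⧸ p
  act := AlgHom.ofLinearMap
    { toFun a := p.mapQ p (W.act a) (hp a)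
      map_add' a b := by ext; simp
      map_smul' c a := by ext; simp }
    (by ext; simp) (fun a b => by ext; simp)

/-- The inclusion of a submodule. -/
def subι (W : FinMod k A) (p : Submodule k W) (hp : ∀ a, ∀ w ∈ p, W.act a w ∈ p) :
    W.sub p hp ⟶ W where
  lin := p.subtype
  comm _ _ := rfl

/-- The projection to a quotient. -/
def quotπ (W : FinMod k A) (p : Submodule k W) (hp : ∀ a, ∀ w ∈ p, W.act a w ∈ p) :
    W ⟶ W.quot p hp where
  lin := p.mkQ
  comm _ _ := rfl

/-- A short exact sequence of modules. -/
structure IsShortExact {U V W : FinMod k A} (i : U ⟶ V) (p : V ⟶ W) : Prop where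
  injective : Function.Injective i.lin
  exact : Function.Exact i.lin p.lin
  surjective : Function.Surjective p.lin

theorem isShortExact_sub_quot (W : FinMod k A) (p : Submodule k W)
    (hp : ∀ a, ∀ w ∈ p, W.act a w ∈ p) : IsShortExact (W.subι p hp) (W.quotπ p hp) where
  injective := p.injective_subtype
  exact := LinearMap.exact_iff.2 (p.ker_mkQ.trans p.range_subtype.symm)
  surjective := p.mkQ_surjective

theorem IsShortExact.of_injective {U V : FinMod k A} (i : U ⟶ V) (hi : Function.Injective i.lin) :
    ∃ (W : FinMod k A) (p : V ⟶ W), IsShortExact i p :=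
  ⟨V.quot (LinearMap.range i.lin) (by rintro a _ ⟨u, rfl⟩; exact ⟨U.act a u, i.comm a u⟩),
    V.quotπ _ _, hi, LinearMap.exact_iff.2 (Submodule.ker_mkQ _), Submodule.mkQ_surjective _⟩

theorem IsShortExact.of_surjective {V W : FinMod k A} (p : V ⟶ W)
    (hp : Function.Surjective p.lin) :
    ∃ (U : FinMod k A) (i : U ⟶ V), IsShortExact i p :=
  ⟨V.sub (LinearMap.ker p.lin) (fun a v hv => by
      rw [LinearMap.mem_ker, p.comm, LinearMap.mem_ker.1 hv, map_zero]),
    V.subι _ _, Submodule.injective_subtype _,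
    LinearMap.exact_iff.2 (Submodule.range_subtype _).symm, hp⟩

variable {U V W : FinMod k A} {i : U ⟶ V} {p : V ⟶ W}

theorem IsShortExact.finrank_eq (h : IsShortExact i p) :
    Module.finrank k V = Module.finrank k U + Module.finrank k W := by
  rw [← LinearMap.finrank_range_add_finrank_ker p.lin, LinearMap.range_eq_top.2 h.surjective,
    finrank_top, LinearMap.exact_iff.1 h.exact, LinearMap.finrank_range_of_inj h.injective,
    add_comm]

variable (V W) in
/-- The underlying linear map of a homomorphism, as a linear map on the space of
homomorphisms. -/
def linHom : (V ⟶ W) →ₗ[k] (V →ₗ[k] W) where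
  toFun f := f.lin
  map_add' _ _ := rfl
  map_smul' _ _ := rfl

theorem linHom_injective : Function.Injective (linHom V W) := fun _ _ h => hom_ext h

instance : FiniteDimensional k (V ⟶ W) := FiniteDimensional.of_injective _ linHom_injective

variable (V W) in
/-- The dimension of the space of homomorphisms `V ⟶ W`. -/
noncomputable def homDim : ℕ := Module.finrank k (V ⟶ W)

theorem homDim_le : homDim V W ≤ Module.finrank k V * Module.finrank k W := by
  rw [← Module.finrank_linearMap k k]
  exact LinearMap.finrank_le_finrank_of_injective (linHom_injective (V := V) (W := W))

theorem homDim_eq_zero (h : Module.finrank k W = 0) : homDim V W = 0 :=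
  Nat.eq_zero_of_le_zero (homDim_le.trans_eq (by rw [h, mul_zero]))

/-- Homomorphisms killed by `p` factor through the kernel of `p`. -/
theorem IsShortExact.exists_lift (h : IsShortExact i p) {M : FinMod k A} (f : M ⟶ V)
    (hf : f ≫ p = 0) : ∃ g : M ⟶ U, g ≫ i = f := by
  have hf' : ∀ m, f.lin m ∈ LinearMap.range i.lin := fun m => by
    rw [← LinearMap.exact_iff.1 h.exact]
    exact LinearMap.congr_fun (congrArg Hom.lin hf) m
  let e := LinearEquiv.ofInjective i.lin h.injective
  have he : ∀ m, i.lin (e.symm (f.lin.codRestrict _ hf' m)) = f.lin m := fun m =>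
    congrArg Subtype.val (e.apply_symm_apply (f.lin.codRestrict _ hf' m))
  refine ⟨⟨e.symm.toLinearMap ∘ₗ f.lin.codRestrict _ hf', fun a m => h.injective ?_⟩,
    hom_ext (LinearMap.ext he)⟩
  exact (he _).trans ((f.comm a m).trans
    ((congrArg (V.act a) (he m)).symm.trans (i.comm a _).symm))

theorem IsShortExact.finrank_ker_le (h : IsShortExact i p) (M : FinMod k A) :
    Module.finrank k (LinearMap.ker (Linear.rightComp k M p)) ≤ homDim M U := by
  refine (Submodule.finrank_mono (t := LinearMap.range (Linear.rightComp k M i)) ?_).trans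
    (LinearMap.finrank_range_le _)
  intro f hf
  exact h.exists_lift f hf

theorem IsShortExact.homDim_le_add (h : IsShortExact i p) (M : FinMod k A) :
    homDim M V ≤ homDim M U + homDim M W := by
  rw [homDim, ← LinearMap.finrank_range_add_finrank_ker (Linear.rightComp k M p), add_comm]
  exact add_le_add (h.finrank_ker_le M) (Submodule.finrank_le _)

/-- If the dimensions of the spaces of homomorphisms from `M` are additive on a short exact
sequence, then homomorphisms from `M` lift along its surjection. -/
theorem IsShortExact.exists_comp_eq (h : IsShortExact i p) (M : FinMod k A)
    (hd : homDim M V = homDim M U + homDim M W) (f : M ⟶ W) : ∃ g : M ⟶ V, g ≫ p = f := by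
  have h1 := LinearMap.finrank_range_add_finrank_ker (Linear.rightComp k M p)
  have h2 := h.finrank_ker_le M
  have h3 : LinearMap.range (Linear.rightComp k M p) = ⊤ := by
    refine Submodule.eq_top_of_finrank_eq (le_antisymm (Submodule.finrank_le _) ?_)
    unfold homDim at hd h2
    omega
  exact LinearMap.range_eq_top.1 h3 f

end Sub

/-! ### Modules maximizing the ratio of `dim Hom(M, W)` to `dim W` -/

section Extremal

variable {k A : Type u} [Field k] [Ring A] [Algebra k A]

/-- A nonzero module `V` maximizes the ratio of `dim Hom(M, W)` to `dim W` among all nonzero `W`. -/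
structure IsMaximizer (M V : FinMod k A) : Prop where
  pos : 0 < Module.finrank k V
  le (W : FinMod k A) :
    homDim M W * Module.finrank k V ≤ homDim M V * Module.finrank k W

/-- A module `W` attains the maximal ratio of `dim Hom(M, W)` to `dim W`, which is the ratio for
`V`. The zero module is allowed. -/
def Attains (M V W : FinMod k A) : Prop :=
  homDim M W * Module.finrank k V = homDim M V * Module.finrank k W

/-- The maximal ratio exists: it is enough to consider cyclic modules, for which there are only
finitely many possible values. -/
theorem exists_isMaximizer [FiniteDimensional k A] [Nontrivial A] (M : FinMod k A) :
    ∃ V, IsMaximizer M V := by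
  let s : Set (ℕ × ℕ) := {x | ∃ V : FinMod k A, homDim M V = x.1 ∧ Module.finrank k V = x.2 ∧
    0 < x.2 ∧ x.2 ≤ Module.finrank k A}
  have hs : s.Finite := by
    refine ((Set.finite_Iic (Module.finrank k M * Module.finrank k A)).prod
      (Set.finite_Iic (Module.finrank k A))).subset ?_
    rintro ⟨a, b⟩ ⟨V, rfl, rfl, h1, h2⟩
    exact ⟨homDim_le.trans (Nat.mul_le_mul_left _ h2), h2⟩
  have hne : s.Nonempty := ⟨(homDim M (regular k A), Module.finrank k A), regular k A, rfl, rfl,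
    Module.finrank_pos, le_rfl⟩
  obtain ⟨⟨_, _⟩, ⟨V, rfl, rfl, h2, h3⟩, hV⟩ := Set.exists_max_image s
    (fun x => (x.1 : ℚ) / x.2) hs hne
  have hsmall : ∀ W : FinMod k A, 0 < Module.finrank k W →
      Module.finrank k W ≤ Module.finrank k A →
      homDim M W * Module.finrank k V ≤ homDim M V * Module.finrank k W := by
    intro W hW hW'
    have h := hV (homDim M W, Module.finrank k W) ⟨W, rfl, rfl, hW, hW'⟩
    rw [div_le_div_iff₀ (by exact_mod_cast hW) (by exact_mod_cast h2)] at h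
    exact_mod_cast h
  refine ⟨V, h2, fun W => ?_⟩
  induction hn : Module.finrank k W using Nat.strong_induction_on generalizing W with
  | _ n ih =>
    subst hn
    obtain h0 | h0 := Nat.eq_zero_or_pos (Module.finrank k W)
    · simp [homDim_eq_zero h0]
    · obtain ⟨w, hw⟩ := (Module.finrank_pos_iff_exists_ne_zero (R := k)).1 h0
      let q := LinearMap.range (ev w).lin
      have hq : ∀ a, ∀ x ∈ q, W.act a x ∈ q := by
        rintro a _ ⟨u, rfl⟩; exact ⟨_, (ev w).comm a u⟩
      have hex := W.isShortExact_sub_quot q hq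
      have hd := hex.finrank_eq
      have hwq : w ∈ q := ⟨(1 : A), act_one W w⟩
      have hpos : 0 < Module.finrank k (W.sub q hq) :=
        (Module.finrank_pos_iff_exists_ne_zero (R := k)).2
          ⟨(⟨w, hwq⟩ : q), fun h => hw (congrArg Subtype.val h)⟩
      have h4 := hsmall (W.sub q hq) hpos (LinearMap.finrank_range_le _)
      have h5 := ih _ (by omega) (W.quot q hq) rfl
      have h6 := Nat.mul_le_mul_right (Module.finrank k V) (hex.homDim_le_add M)
      rw [hd, mul_add]
      rw [add_mul] at h6
      omega

variable {M V : FinMod k A}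

theorem IsMaximizer.attains_of_isShortExact (hV : IsMaximizer M V) {U W W' : FinMod k A}
    {i : U ⟶ W} {p : W ⟶ W'} (h : IsShortExact i p) (hW : Attains M V W) :
    Attains M V U ∧ Attains M V W' := by
  have h1 := hV.le U
  have h2 := hV.le W'
  have h3 := Nat.mul_le_mul_right (Module.finrank k V) (h.homDim_le_add M)
  unfold Attains at hW ⊢
  rw [hW, h.finrank_eq, mul_add, add_mul] at h3
  omega

theorem IsMaximizer.attains_of_injective (hV : IsMaximizer M V) {U W : FinMod k A} (i : U ⟶ W)
    (hi : Function.Injective i.lin) (hW : Attains M V W) : Attains M V U := by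
  obtain ⟨_, _, h⟩ := IsShortExact.of_injective i hi
  exact (hV.attains_of_isShortExact h hW).1

/-- Homomorphisms from `M` lift along surjections from modules attaining the maximal ratio. -/
theorem IsMaximizer.exists_comp_eq (hV : IsMaximizer M V) {W W' : FinMod k A} (p : W ⟶ W')
    (hp : Function.Surjective p.lin) (hW : Attains M V W) (f : M ⟶ W') :
    ∃ g : M ⟶ W, g ≫ p = f := by
  obtain ⟨U, i, h⟩ := IsShortExact.of_surjective p hp
  obtain ⟨h1, h2⟩ := hV.attains_of_isShortExact h hW
  refine h.exists_comp_eq M (Nat.eq_of_mul_eq_mul_right hV.pos ?_) f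
  unfold Attains at hW h1 h2
  rw [hW, h.finrank_eq, mul_add, add_mul, h1, h2]

end Extremal

/-! ### Homomorphisms from `H ⊗ N` -/

section Twist

variable {k H S : Type u} [Field k] [Ring H] [HopfAlgebra k H] [FiniteDimensional k H]

theorem map_assoc_tmul {A B N' X' V' : Type u} [AddCommGroup A] [Module k A] [AddCommGroup B]
    [Module k B] [AddCommGroup N'] [Module k N'] [AddCommGroup X'] [Module k X']
    [AddCommGroup V'] [Module k V'] (f : A →ₗ[k] X') (g : B ⊗[k] N' →ₗ[k] V') (z : A ⊗[k] B)
    (n : N') : TensorProduct.map LinearMap.id g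
      (TensorProduct.map f LinearMap.id (TensorProduct.assoc k A B N' (z ⊗ₜ n))) =
    TensorProduct.map f (g ∘ₗ (TensorProduct.mk k B N').flip n) z := by
  induction z with
  | zero => simp
  | add z w hz hw => simp only [map_add, hz, hw, TensorProduct.add_tmul]
  | tmul a b => rfl

/-- The linear map `a ⊗ (x ⊗ v) ↦ S(a) x ⊗ v`. -/
noncomputable def antipodeAct (X : FinMod k H) (V : Type u) [AddCommGroup V] [Module k V] :
    H ⊗[k] (X ⊗[k] V) →ₗ[k] X ⊗[k] V :=
  TensorProduct.lift (LinearMap.rTensorHom V ∘ₗ X.act.toLinearMap ∘ₗ HopfAlgebra.antipode k)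

/-- The identity `S(h₁) h₂ x ⊗ g(h₃) = x ⊗ g(h)`. -/
theorem antipodeAct_lTensor_comul (X : FinMod k H) {V : Type u} [AddCommGroup V] [Module k V]
    (x : X) (g : H →ₗ[k] V) (h : H) :
    antipodeAct X V (LinearMap.lTensor H
      (TensorProduct.map (LinearMap.flip X.act.toLinearMap x) g ∘ₗ Coalgebra.comul (R := k))
      (Coalgebra.comul (R := k) h)) = x ⊗ₜ g h := by
  rw [LinearMap.lTensor_comp_apply, ← Coalgebra.coassoc_apply]
  have h1 : antipodeAct X V ∘ₗ
      LinearMap.lTensor H (TensorProduct.map (LinearMap.flip X.act.toLinearMap x) g) ∘ₗ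
        (TensorProduct.assoc k H H H).toLinearMap =
      TensorProduct.map (LinearMap.flip X.act.toLinearMap x ∘ₗ LinearMap.mul' k H ∘ₗ
        (HopfAlgebra.antipode k).rTensor H) g := by
    refine TensorProduct.ext_threefold fun a b c => ?_
    simp [antipodeAct, act_mul]
  refine (LinearMap.congr_fun h1 _).trans ?_
  have h2 : ∀ z : H ⊗[k] H, TensorProduct.map (LinearMap.flip X.act.toLinearMap x ∘ₗ
      LinearMap.mul' k H ∘ₗ (HopfAlgebra.antipode k).rTensor H) g
        ((Coalgebra.comul (R := k)).rTensor H z) =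
      TensorProduct.map (LinearMap.toSpanSingleton k X x) g
        ((Coalgebra.counit (R := k)).rTensor H z) := by
    intro z
    induction z with
    | zero => simp
    | add z w hz hw => simp only [map_add, hz, hw]
    | tmul a b =>
      simp [HopfAlgebra.mul_antipode_rTensor_comul_apply]
  rw [h2, Coalgebra.rTensor_counit_comul]
  simp

variable [Ring S] [Algebra k S] [LeftComoduleAlgebra k H S]

variable (X : FinMod k H) (N V : FinMod k S)

/-- For `x ∈ X` and `f : H ⊗ N ⟶ V`, the homomorphism `H ⊗ N ⟶ X ⊗ V`,
`h ⊗ n ↦ h₁ x ⊗ f (h₂ ⊗ n)`. -/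
noncomputable def twist (x : X) (f : regular k H ⊙ₗ N ⟶ V) : regular k H ⊙ₗ N ⟶ X ⊙ₗ V :=
  comulHom k H ⊵ₗ N ≫ (αₗ (regular k H) (regular k H) N).hom ≫
    ev x ⊵ₗ (regular k H ⊙ₗ N) ≫ X ⊴ₗ f

theorem twist_tmul (x : X) (f : regular k H ⊙ₗ N ⟶ V) (h : H) (n : N) :
    (twist X N V x f).lin (h ⊗ₜ[k] n) = TensorProduct.map (LinearMap.flip X.act.toLinearMap x)
      (f.lin ∘ₗ (TensorProduct.mk k H N).flip n) (Coalgebra.comul (R := k) h) := by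
  exact map_assoc_tmul (LinearMap.flip X.act.toLinearMap x) (V' := V) f.lin _ n

/-- `twist` as a linear map `X ⊗ Hom(H ⊗ N, V) → Hom(H ⊗ N, X ⊗ V)`. -/
noncomputable def twistLin :
    X ⊗[k] (regular k H ⊙ₗ N ⟶ V) →ₗ[k] (regular k H ⊙ₗ N ⟶ X ⊙ₗ V) :=
  TensorProduct.lift (LinearMap.mk₂ k (twist X N V)
    (fun x y f => by
      simp only [twist, ev_add, LinearAction.left_add (k := k), Preadditive.add_comp,
        Preadditive.comp_add])
    (fun c x f => by
      simp only [twist, ev_smul, LinearAction.left_smul (k := k), Linear.smul_comp,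
        Linear.comp_smul])
    (fun x f g => by simp only [twist, LinearAction.right_add (k := k), Preadditive.comp_add])
    (fun c x f => by simp only [twist, LinearAction.right_smul (k := k), Linear.comp_smul]))

/-- By means of the antipode, `x ⊗ f` can be recovered from `h ⊗ n ↦ h₁ x ⊗ f (h₂ ⊗ n)`. -/
theorem twistLin_injective : Function.Injective (twistLin X N V) := by
  rw [← LinearMap.ker_eq_bot, LinearMap.ker_eq_bot']
  intro t ht
  let ι : (regular k H ⊙ₗ N ⟶ V) →ₗ[k] (H ⊗[k] N →ₗ[k] V) := linHom (regular k H ⊙ₗ N) V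
  have h1 : Function.Injective (LinearMap.lTensor X ι) :=
    Module.Flat.lTensor_preserves_injective_linearMap _ linHom_injective
  have h2 : ∀ (t : X ⊗[k] (regular k H ⊙ₗ N ⟶ V)) (h : H) (n : N), antipodeAct X V
      (LinearMap.lTensor H ((twistLin X N V t).lin ∘ₗ (TensorProduct.mk k H N).flip n)
        (Coalgebra.comul (R := k) h)) =
      TensorProduct.lTensorHomToHomLTensor (RingHom.id k) (H ⊗[k] N) X V
        (LinearMap.lTensor X ι t) (h ⊗ₜ n) := by
    intro t h n
    -- both sides are linear in `t`
    let L : (regular k H ⊙ₗ N ⟶ X ⊙ₗ V) →ₗ[k] X ⊗[k] V :=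
      antipodeAct X V ∘ₗ LinearMap.applyₗ (Coalgebra.comul (R := k) h) ∘ₗ LinearMap.lTensorHom H ∘ₗ
        LinearMap.lcomp k (X ⊗[k] V) ((TensorProduct.mk k H N).flip n) ∘ₗ
          linHom (regular k H ⊙ₗ N) (X ⊙ₗ V)
    refine LinearMap.congr_fun (f := L ∘ₗ twistLin X N V)
      (g := LinearMap.applyₗ (h ⊗ₜ[k] n) ∘ₗ TensorProduct.lTensorHomToHomLTensor (RingHom.id k)
        (H ⊗[k] N) X V ∘ₗ LinearMap.lTensor X ι)
      (TensorProduct.ext' fun x f => ?_) t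
    have h3 : (twist X N V x f).lin ∘ₗ (TensorProduct.mk k H N).flip n =
        TensorProduct.map (LinearMap.flip X.act.toLinearMap x)
          (f.lin ∘ₗ (TensorProduct.mk k H N).flip n) ∘ₗ Coalgebra.comul (R := k) :=
      LinearMap.ext fun h => twist_tmul X N V x f h n
    refine Eq.trans ?_ (antipodeAct_lTensor_comul X x
      (f.lin ∘ₗ (TensorProduct.mk k H N).flip n) h)
    rw [← h3]
    rfl
  have h4 : TensorProduct.lTensorHomToHomLTensor (RingHom.id k) (H ⊗[k] N) X V
      (LinearMap.lTensor X ι t) = 0 := by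
    refine TensorProduct.ext' fun h n => ?_
    rw [← h2, ht]
    have h5 : ((0 : regular k H ⊙ₗ N ⟶ X ⊙ₗ V).lin ∘ₗ (TensorProduct.mk k H N).flip n :
      H →ₗ[k] X ⊗[k] V) = (0 : H →ₗ[k] X ⊗[k] V) := rfl
    refine (congrArg (fun φ : H →ₗ[k] X ⊗[k] V => antipodeAct X V
      (LinearMap.lTensor H φ (Coalgebra.comul (R := k) h))) h5).trans ?_
    rw [LinearMap.lTensor_zero, LinearMap.zero_apply, map_zero, LinearMap.zero_apply]
  refine h1 ((lTensorHomEquivHomLTensor k (H ⊗[k] N) X V).injective ?_)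
  rw [map_zero, map_zero]
  exact (lTensorHomEquivHomLTensor_apply _).trans h4

theorem finrank_mul_homDim_le :
    Module.finrank k X * homDim (regular k H ⊙ₗ N) V ≤ homDim (regular k H ⊙ₗ N) (X ⊙ₗ V) := by
  have h := LinearMap.finrank_le_finrank_of_injective (twistLin_injective X N V)
  rwa [Module.finrank_tensorProduct] at h

theorem IsMaximizer.attains_action {V : FinMod k S} (hV : IsMaximizer (regular k H ⊙ₗ N) V)
    {W : FinMod k S} (hW : Attains (regular k H ⊙ₗ N) V W) (X : FinMod k H) :
    Attains (regular k H ⊙ₗ N) V (X ⊙ₗ W) := by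
  have h1 := hV.le (X ⊙ₗ W)
  have h2 := Nat.mul_le_mul_right (Module.finrank k V) (finrank_mul_homDim_le X N W)
  have h3 : Module.finrank k (X ⊙ₗ W : FinMod k S) = Module.finrank k X * Module.finrank k W :=
    Module.finrank_tensorProduct
  unfold Attains at hW ⊢
  refine le_antisymm h1 ?_
  rw [h3, mul_left_comm, ← hW, ← mul_assoc]
  exact h2

end Twist

/-! ### Projectivity of `H ⊗ N` over a right simple comodule algebra -/

section Projective

open LeftComoduleAlgebra

section Bialgebra

variable {k H S : Type u} [Field k] [Ring H] [Bialgebra k H] [Ring S] [Algebra k S]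
  [LeftComoduleAlgebra k H S]

variable (k H) in
/-- A vector space with the trivial action of `H`. -/
def trivOn (Z : Type u) [AddCommGroup Z] [Module k Z] [FiniteDimensional k Z] : FinMod k H where
  carrier := Z
  act := (Algebra.ofId k (Module.End k Z)).comp (Bialgebra.counitAlgHom k H)

variable (Z : Type u) [AddCommGroup Z] [Module k Z] [FiniteDimensional k Z] (N : FinMod k S)

theorem trivOn_pair (t : H ⊗[k] S) (z : Z) (n : N) :
    pair (trivOn k H Z).act.toLinearMap N.act.toLinearMap t (z ⊗ₜ n) =
      (z ⊗ₜ N.act (TensorProduct.lid k S ((Coalgebra.counit (R := k) (A := H)).rTensor S t)) n :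
        Z ⊗[k] N) := by
  induction t with
  | zero => simp; rfl
  | add t t' h h' =>
    simp only [map_add, LinearMap.add_apply, h, h', TensorProduct.tmul_add]; rfl
  | tmul a s =>
    rw [LinearMap.rTensor_tmul, TensorProduct.lid_tmul, map_smul, LinearMap.smul_apply,
      TensorProduct.tmul_smul, TensorProduct.smul_tmul']
    rfl

/-- On `Z ⊗ N` with trivial action of `H` on `Z` the algebra `S` acts on the second factor. -/
theorem trivOn_action_act (s : S) :
    (trivOn k H Z ⊙ₗ N).act s = LinearMap.lTensor Z (N.act s) := by
  refine TensorProduct.ext' fun z n => ?_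
  rw [action_act]
  refine (trivOn_pair Z N _ z n).trans ?_
  rw [LeftComoduleAlgebra.counit, TensorProduct.lid_tmul, one_smul]
  rfl

/-- The homomorphism `N ⊗ S ⟶ N`, `n ⊗ s ↦ s n`, where `H` and `S` act on the underlying vector
space of `N` and on `S`, respectively. -/
def actHom [FiniteDimensional k S] : trivOn k H N ⊙ₗ regular k S ⟶ N where
  lin := TensorProduct.lift (LinearMap.flip N.act.toLinearMap)
  comm a v := LinearMap.congr_fun (f := TensorProduct.lift (LinearMap.flip N.act.toLinearMap) ∘ₗ
      (trivOn k H N ⊙ₗ regular k S).act a)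
    (g := N.act a ∘ₗ TensorProduct.lift (LinearMap.flip N.act.toLinearMap)) (by
      rw [trivOn_action_act]
      exact TensorProduct.ext' fun n s => act_mul N a s n) v

theorem actHom_surjective [FiniteDimensional k S] :
    Function.Surjective (actHom (H := H) N).lin :=
  fun n => ⟨n ⊗ₜ[k] (1 : S), act_one N n⟩

/-- If `S` acts faithfully on `W`, then `S` embeds into a power of `W`, namely into `W* ⊗ W`, by
acting on the element which corresponds to the identity of `W`. -/
theorem exists_injective_of_faithful [FiniteDimensional k S] (W : FinMod k S)
    (hW : Function.Injective W.act) :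
    ∃ i : regular k S ⟶ trivOn k H (Module.Dual k W) ⊙ₗ W, Function.Injective i.lin := by
  refine ⟨ev (N := trivOn k H (Module.Dual k W) ⊙ₗ W)
    ((dualTensorHomEquiv k W W).symm LinearMap.id), fun s t hst => hW ?_⟩
  have h (s : S) : dualTensorHom k W W ((trivOn k H (Module.Dual k W) ⊙ₗ W).act s
      ((dualTensorHomEquiv k W W).symm LinearMap.id)) = W.act s := by
    refine (congrArg (dualTensorHom k W W) (LinearMap.congr_fun
      (trivOn_action_act (H := H) (Module.Dual k W) W s) _)).trans ?_
    refine (LinearMap.congr_fun (dualTensorHom_comp_lTensor (W.act s)) _).trans ?_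
    exact congrArg (W.act s ∘ₗ ·) ((dualTensorHomEquiv k W W).apply_symm_apply LinearMap.id)
  rw [← h s, ← h t]
  exact congrArg (dualTensorHom k W W) hst

variable (k H S) in
/-- The map `S → H ⊗ End V`, `s ↦ s₋₁ ⊗ (v ↦ s₀ v)`. -/
noncomputable def coactEnd (V : FinMod k S) : S →ₐ[k] H ⊗[k] Module.End k V :=
  (Algebra.TensorProduct.map (AlgHom.id k H) V.act).comp coact

/-- The kernel of `S → H ⊗ End V` is costable, by coassociativity of the coaction. -/
theorem coact_mem_of_coactEnd_eq_zero (V : FinMod k S) {s : S} (hs : coactEnd k H S V s = 0) :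
    coact (k := k) (H := H) s ∈ LinearMap.range
      ((LinearMap.ker (coactEnd k H S V).toLinearMap).subtype.lTensor H) := by
  have hex := Module.Flat.lTensor_exact (R := k) H
    (LinearMap.exact_subtype_ker_map (coactEnd k H S V).toLinearMap)
  refine (hex _).1 ?_
  have h1 : (coactEnd k H S V).toLinearMap = V.act.toLinearMap.lTensor H ∘ₗ
    (coact (k := k) (H := H)).toLinearMap := rfl
  have h2 := LinearMap.congr_fun (coassoc (k := k) (H := H) (S := S)) s
  simp only [LinearMap.comp_apply, LinearEquiv.coe_coe, AlgHom.toLinearMap_apply] at h2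
  rw [h1, LinearMap.lTensor_comp_apply, ← h2]
  have h3 : V.act.toLinearMap.lTensor H (coact (k := k) (H := H) s) = 0 := hs
  have h4 : ∀ z : H ⊗[k] S, LinearMap.lTensor H (V.act.toLinearMap.lTensor H)
      (TensorProduct.assoc k H H S ((Coalgebra.comul (R := k)).rTensor S z)) =
      TensorProduct.assoc k H H _ ((Coalgebra.comul (R := k)).rTensor _
        (V.act.toLinearMap.lTensor H z)) := by
    intro z
    induction z with
    | zero => simp
    | add z z' h h' => simp only [map_add, h, h']
    | tmul a t =>
      rw [LinearMap.rTensor_tmul, LinearMap.lTensor_tmul, LinearMap.rTensor_tmul]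
      generalize Coalgebra.comul (R := k) a = w
      induction w with
      | zero => simp
      | add z z' h h' => simp only [map_add, h, h', TensorProduct.add_tmul]
      | tmul a b => rfl
  rw [h4, h3, map_zero, map_zero]

end Bialgebra

variable {k H S : Type u} [Field k] [Ring H] [Bialgebra k H] [FiniteDimensional k H] [Ring S]
  [Algebra k S] [LeftComoduleAlgebra k H S]

/-- If `S` is right simple, then it acts faithfully on `H ⊗ V` for `V ≠ 0`. -/
theorem faithful_of_isRightSimple (hS : IsRightSimple k H S) (V : FinMod k S)
    (hV : 0 < Module.finrank k V) : Function.Injective (regular k H ⊙ₗ V).act := by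
  obtain ⟨v, hv⟩ := (Module.finrank_pos_iff_exists_ne_zero (R := k)).1 hV
  have : Nontrivial V := ⟨⟨v, 0, hv⟩⟩
  have : Nontrivial H := ⟨⟨1, 0, fun h => by simpa using congrArg (Coalgebra.counit (R := k)) h⟩⟩
  have h1 : Function.Injective (coactEnd k H S V) := by
    obtain h | h := hS (LinearMap.ker (coactEnd k H S V).toLinearMap)
      (fun x hx s => by
        have hx' : coactEnd k H S V x = 0 := hx
        change coactEnd k H S V (x * s) = 0
        rw [map_mul, hx', zero_mul])
      (fun x hx => coact_mem_of_coactEnd_eq_zero V hx)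
    · exact LinearMap.ker_eq_bot.1 h
    · have h2 : (1 : S) ∈ LinearMap.ker (coactEnd k H S V).toLinearMap := by rw [h]; trivial
      have h3 : coactEnd k H S V 1 = 0 := h2
      rw [map_one] at h3
      exact (one_ne_zero h3).elim
  intro s t hst
  refine h1 ?_
  have h2 (z : H ⊗[k] S) (v : V) : pair (regular k H).act.toLinearMap V.act.toLinearMap z
      ((1 : H) ⊗ₜ[k] v) = (TensorProduct.lTensorHomToHomLTensor (RingHom.id k) V H V
        (V.act.toLinearMap.lTensor H z) v : H ⊗[k] V) := by
    induction z with
    | zero => simp; rfl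
    | add z z' h h' => simp only [map_add, LinearMap.add_apply, h, h']; rfl
    | tmul a t => exact congrArg (fun b : H => b ⊗ₜ[k] V.act t v) (mul_one a)
  refine (lTensorHomEquivHomLTensor k V H V).injective ?_
  rw [lTensorHomEquivHomLTensor_apply, lTensorHomEquivHomLTensor_apply]
  refine LinearMap.ext fun v => ?_
  refine (h2 (coact s) v).symm.trans (Eq.trans ?_ (h2 (coact t) v))
  rw [action_act, action_act] at hst
  exact LinearMap.congr_fun hst _

/-- Over a right simple comodule algebra the module `H ⊗ N` is projective. -/
theorem exists_section_of_isRightSimple {k H S : Type u} [Field k] [Ring H] [HopfAlgebra k H]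
    [FiniteDimensional k H] [Ring S] [Algebra k S] [LeftComoduleAlgebra k H S]
    [FiniteDimensional k S] (hS : IsRightSimple k H S) (N : FinMod k S) :
    ∃ σ : regular k H ⊙ₗ N ⟶ trivOn k H (regular k H ⊙ₗ N : FinMod k S) ⊙ₗ regular k S,
      σ ≫ actHom (regular k H ⊙ₗ N) = 𝟙 _ := by
  obtain h | h := subsingleton_or_nontrivial S
  · refine ⟨0, hom_ext (LinearMap.ext fun v => ?_)⟩
    have h1 (w : (regular k H ⊙ₗ N : FinMod k S)) : w = 0 := by
      rw [← act_one _ w, Subsingleton.elim (1 : S) 0, map_zero]; rfl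
    exact (h1 _).trans (h1 _).symm
  · obtain ⟨V, hV⟩ := exists_isMaximizer (regular k H ⊙ₗ N)
    have h1 : Attains (regular k H ⊙ₗ N) V V := rfl
    obtain ⟨i, hi⟩ := exists_injective_of_faithful (H := H) (regular k H ⊙ₗ V)
      (faithful_of_isRightSimple hS V hV.pos)
    have h2 := hV.attains_of_injective i hi
      (hV.attains_action N (hV.attains_action N h1 (regular k H)) _)
    exact hV.exists_comp_eq _ (actHom_surjective _) (hV.attains_action N h2 _) (𝟙 _)

end Projective

end FinMod

/-! ### Module functors are tensor products with Hopf bimodules -/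

namespace FinMod

variable {k A : Type u} [Field k] [Ring A] [Algebra k A]

theorem isIso_iff_bijective_lin {V W : FinMod k A} (f : V ⟶ W) :
    IsIso f ↔ Function.Bijective f.lin := by
  refine ⟨fun h => ?_, fun h => ?_⟩
  · exact Function.bijective_iff_has_inverse.2 ⟨(inv f).lin,
      fun v => LinearMap.congr_fun (congrArg Hom.lin (IsIso.hom_inv_id f)) v,
      fun w => LinearMap.congr_fun (congrArg Hom.lin (IsIso.inv_hom_id f)) w⟩
  · exact (isoMk (LinearEquiv.ofBijective f.lin h) f.comm).isIso_hom

/-- Tensoring with a nonzero representation of `H` reflects isomorphisms. -/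
theorem isIso_of_isIso_actionHomRight {H S : Type u} [Ring H] [Bialgebra k H] [Ring S]
    [Algebra k S] [LeftComoduleAlgebra k H S] (X : FinMod k H) [Nontrivial X] {N N' : FinMod k S}
    (f : N ⟶ N') [IsIso (X ⊴ₗ f)] : IsIso f := by
  have h := (isIso_iff_bijective_lin (X ⊴ₗ f)).1 inferInstance
  exact (isIso_iff_bijective_lin f).2
    ((Module.FaithfullyFlat.lTensor_bijective_iff_bijective k X (f := f.lin)).1 h)

end FinMod

namespace HopfBimod

open ModCat.Bimod ModCat.FinMod

variable {k H K S : Type u} [Field k] [Ring H] [HopfAlgebra k H] [FiniteDimensional k H]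
  [Ring K] [Algebra k K] [LeftComoduleAlgebra k H K] [Ring S] [Algebra k S]
  [LeftComoduleAlgebra k H S] [FiniteDimensional k S]

theorem unitBal_bijective (P : HopfBimod k H K S) : Function.Bijective P.unitBal :=
  Function.bijective_iff_has_inverse.2 ⟨P.unitInv,
    fun y => LinearMap.congr_fun (f := P.unitInv ∘ₗ P.unitBal) (g := LinearMap.id)
      (bal_ext fun p (s : S) => (cls_right p s (N := regular k S) (1 : S)).trans
        (congrArg (P.cls (regular k S) p) (mul_one s))) y,
    P.right_one⟩

variable [QuasiTriangular k H] (F : ModuleFunctor k (FinMod k H) (FinMod k S) (FinMod k K))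

theorem isIso_evalHom_regular : IsIso (evalHom F.toOplaxModuleFunctor (regular k S)) :=
  (isIso_iff_bijective_lin _).2 (unitBal_bijective (ofFunctor F.toOplaxModuleFunctor))

/-- The structure isomorphisms identify `F(S) ⊗_S (X ⊗ N) ⟶ F(X ⊗ N)` with `X` tensored with
`F(S) ⊗_S N ⟶ F(N)`. -/
theorem isIso_evalHom_action_iff (X : FinMod k H) (N : FinMod k S) :
    IsIso (evalHom F.toOplaxModuleFunctor (X ⊙ₗ N)) ↔
      IsIso (X ⊴ₗ evalHom F.toOplaxModuleFunctor N) := by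
  have h := evalHom_str F.toOplaxModuleFunctor X N
  have h1 : IsIso (F.str X N) := F.isIso X N
  have h2 : IsIso ((ofFunctor F.toOplaxModuleFunctor).str X N) :=
    isIso_str (ofFunctor F.toOplaxModuleFunctor) X N
  rw [← isIso_comp_right_iff _ (F.str X N), h, isIso_comp_left_iff]

/-- The morphism `F(S) ⊗_S N ⟶ F(N)` is an isomorphism for retracts of the modules for which it
is an isomorphism. -/
theorem isIso_evalHom_of_retract {N N' : FinMod k S} (i : N ⟶ N') (r : N' ⟶ N) (h : i ≫ r = 𝟙 N)
    [IsIso (evalHom F.toOplaxModuleFunctor N')] :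
    IsIso (evalHom F.toOplaxModuleFunctor N) := by
  have h1 := evalHom_natural F.toOplaxModuleFunctor i
  have h2 := evalHom_natural F.toOplaxModuleFunctor r
  have h3 : (ofFunctor F.toOplaxModuleFunctor).tensMap i ≫
      (ofFunctor F.toOplaxModuleFunctor).tensMap r = 𝟙 _ := by
    have h4 := congrArg (ofFunctor F.toOplaxModuleFunctor).functor.map h
    rwa [Functor.map_comp, CategoryTheory.Functor.map_id] at h4
  refine ⟨F.functor.map i ≫ inv (evalHom F.toOplaxModuleFunctor N') ≫
    (ofFunctor F.toOplaxModuleFunctor).tensMap r, ?_, ?_⟩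
  · rw [← reassoc_of% h1, IsIso.hom_inv_id_assoc, h3]
  · rw [Category.assoc, Category.assoc, h2, IsIso.inv_hom_id_assoc, ← Functor.map_comp, h,
      CategoryTheory.Functor.map_id]

/-- Over a right simple `S` every module functor `F` is isomorphic to `F(S) ⊗_S -`, without any
exactness assumption. -/
theorem isIso_evalHom (hS : IsRightSimple k H S) (N : FinMod k S) :
    IsIso (evalHom F.toOplaxModuleFunctor N) := by
  have : Nontrivial (regular k H) :=
    ⟨⟨(1 : H), (0 : H), fun h => by simpa using congrArg (Coalgebra.counit (R := k) (A := H)) h⟩⟩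
  obtain ⟨σ, hσ⟩ := exists_section_of_isRightSimple hS N
  have h1 := isIso_evalHom_regular F
  have h2 := (isIso_evalHom_action_iff F (trivOn k H (regular k H ⊙ₗ N : FinMod k S))
    (regular k S)).2 inferInstance
  have h3 := isIso_evalHom_of_retract F σ _ hσ
  have h4 := (isIso_evalHom_action_iff F (regular k H) N).1 h3
  exact isIso_of_isIso_actionHomRight (regular k H) _

/-- The isomorphism of module functors `F(S) ⊗_S - ≅ F`. -/
noncomputable def evalIso (hS : IsRightSimple k H S) :
    (ofFunctor F.toOplaxModuleFunctor).toOplax ≅ F.toOplaxModuleFunctor :=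
  OplaxModuleFunctor.isoMk
    (NatIso.ofComponents (fun N => @asIso _ _ _ _ (evalHom F.toOplaxModuleFunctor N)
      (isIso_evalHom F hS N))
      (fun f => evalHom_natural F.toOplaxModuleFunctor f))
    (fun X N => evalHom_str F.toOplaxModuleFunctor X N)

/-- The functor `P ↦ P ⊗_S -` to module functors is fully faithful because its composition with the
full embedding into oplax module functors is. -/
def balancedTensorFullyFaithful (h : ∀ (P : HopfBimod k H K S) (X : FinMod k H) (N : FinMod k S),
    IsIso (P.toOplax.str X N)) : (balancedTensor k H K S h).functor.FullyFaithful where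
  preimage t := (fullyFaithful k H K S).preimage t
  map_preimage t := (fullyFaithful k H K S).map_preimage t
  preimage_map f := (fullyFaithful k H K S).preimage_map f

end HopfBimod

end ModCat

theorem mainTheorem7 {k : Type u} [Field k] [IsAlgClosed k] [CharZero k]
    {H : Type u} [Ring H] [HopfAlgebra k H] [FiniteDimensional k H] [ModCat.QuasiTriangular k H]
    (K S : Type u)
    [Ring K] [Algebra k K] [FiniteDimensional k K] [ModCat.LeftComoduleAlgebra k H K]
    [Ring S] [Algebra k S] [FiniteDimensional k S] [ModCat.LeftComoduleAlgebra k H S]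
    (hK : ModCat.IsRightSimple k H K) (hS : ModCat.IsRightSimple k H S) :
    ∃ h : ∀ (P : ModCat.HopfBimod k H K S) (X : ModCat.FinMod k H) (N : ModCat.FinMod k S),
        IsIso (P.toOplax.str X N),
      (ModCat.HopfBimod.balancedTensor k H K S h).IsEquivalence :=
  ⟨ModCat.HopfBimod.isIso_str, ModCat.ModuleFunctor.isEquivalence_of_fullyFaithful _
    (ModCat.HopfBimod.balancedTensorFullyFaithful ModCat.HopfBimod.isIso_str)
    (fun F => ModCat.HopfBimod.ofFunctor F.toOplaxModuleFunctor)
    (fun F => ModCat.ModuleFunctor.isoMk (ModCat.HopfBimod.evalIso F hS))⟩
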